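/- Let $\gamma_0$ be a regular smooth closed plane curve parametrised by arc length $x\in\mathbb R/\ell\mathbb Z$, where $\ell>0$; functions on $\gamma_0$ are functions of $x$. Let $a,b,c:\gamma_0\times(0,\infty)\to\mathbb R$ be bounded measurable functions such that $a\ge\lambda$ for some constant $\lambda>0$ and $|a(x,s)-a(x,t)|\le S|s-t|$ for some constant $S$ and all $x,s,t$, and let $$\mathcal L_0u=u_t-(a\,u_x)_x+b\,u_x+c\,u .$$ Let $W_2^{k}$ be the space of functions in $L^2(\gamma_0)$ whose weak derivatives of order at most $k$ lie in $L^2(\gamma_0)$, and $W_2^{\alpha,\beta}$ the space of functions in $L^2(\gamma_0\times(0,\infty))$ whose weak derivatives $\partial_x^i$ ($i\le\alpha$) and $\partial_t^j$ ($j\le\beta$) lie in $L^2(\gamma_0\times(0,\infty))$. Write $L^2_m$ for the space $L^2(\gamma_0\times(0,\infty),\,e^{-mt}\,dx\,dt)$. For functions $f$ on $\gamma_0\times(0,\infty)$, the condition $f(\cdot,0)=f_0$ means that $f(\cdot,t)\to f_0$ in $L^2(\gamma_0)$ as $t\downarrow0$ outside a null set of times. For $m\in\mathbb R$, a *weak solution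 with weight $m$* of $$(\mathbf{LP})\qquad \mathcal L_0(u)=h,\qquad u(\cdot,0)=u_0$$ is a function $u$ such that $u$ and its weak derivatives $u_x,u_t$ lie in $L^2_m$, $u(\cdot,0)=u_0$, and, for every $\varepsilon>0$ and every $\varphi\in W_2^{1,1}$ with $\varphi(\cdot,0)=0$, $$\int_{\gamma_0\times(0,\varepsilon)}\bigl(u_t\varphi+a\,u_x\varphi_x+b\,u_x\varphi+c\,u\varphi\bigr)\,dx\,dt=\int_{\gamma_0\times(0,\varepsilon)}h\varphi\,dx\,dt .$$ **Theorem.** There is $m_0>0$, depending only on $\ell,a,b,c$, such that for all $m\ge m_0$, all integers $\alpha,\beta\ge0$, all $u_0\in W_2^{\alpha+1}$ and all $h\in W_2^{\alpha,\beta}$, the problem $(\mathbf{LP})$ has a weak solution $u$ with weight $m$. Moreover, $(a u_x)_x$ exists as a weak derivative in $L^2_m$, and $\mathcal L_0(u)=h$ almost everywhere on $\gamma_0\times(0,\infty)$. If in addition $a$ is Lipschitz in $x$ uniformly in $t$, then $u_{xx}\in L^2_m$. The solution is unique: every weak solution of $(\mathbf{LP})$ with the same $u_0,h$ and any real weight $m'$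 equals $u$ almost everywhere. -/

import Mathlib

open MeasureTheory Filter Topology Set
open scoped ContDiff

namespace ParabolicOnCurve

noncomputable section

/-- A regular smooth closed plane curve, parametrised by arc length.  It may intersect itself;
functions on the curve are functions of the arc-length parameter `x ∈ ℝ / length ℤ`. -/
structure ClosedPlaneCurve where
  length : ℝ
  length_pos : 0 < length
  toFun : ℝ → EuclideanSpace ℝ (Fin 2)
  smooth : ContDiff ℝ ∞ toFun
  periodic : Function.Periodic toFun length
  unit_speed : ∀ s, ‖deriv toFun s‖ = 1

/-- The circle of arc-length parameters; its `volume` is the arc-length measure `dx`. -/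
abbrev ClosedPlaneCurve.Param (γ : ClosedPlaneCurve) : Type := AddCircle γ.length

instance (γ : ClosedPlaneCurve) : Fact (0 < γ.length) := ⟨γ.length_pos⟩

variable {ℓ : ℝ} [Fact (0 < ℓ)]

/-! ### Functions of the space variable -/

/-- Smooth functions on the circle `ℝ / ℓℤ`. -/
def IsTest₁ (φ : AddCircle ℓ → ℝ) : Prop :=
  ContDiff ℝ ∞ (fun x : ℝ => φ (x : AddCircle ℓ))

/-- The `k`-th derivative of a function on the circle. -/
def deriv₁ (k : ℕ) (φ : AddCircle ℓ → ℝ) (x : AddCircle ℓ) : ℝ :=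
  iteratedDeriv k (fun y : ℝ => φ (x + (y : AddCircle ℓ))) 0

/-- `g` is the `k`-th weak derivative of `f` on the circle. -/
def HasWeakDeriv₁ (k : ℕ) (f g : AddCircle ℓ → ℝ) : Prop :=
  ∀ φ : AddCircle ℓ → ℝ, IsTest₁ φ →
    ∫ x, f x * deriv₁ k φ x = (-1) ^ k * ∫ x, g x * φ x

/-- The Sobolev space `W₂ᵏ` over the curve. -/
def MemW (k : ℕ) (f : AddCircle ℓ → ℝ) : Prop :=
  MemLp f 2 volume ∧
    ∀ i ≤ k, ∃ g : AddCircle ℓ → ℝ, MemLp g 2 volume ∧ HasWeakDeriv₁ i f g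

/-! ### Functions on the curve times `(0, ∞)` -/

/-- The measure `dx dt` on the curve times `(0, ∞)`. -/
def cylMeasure (ℓ : ℝ) [Fact (0 < ℓ)] : Measure (AddCircle ℓ × ℝ) :=
  (volume : Measure (AddCircle ℓ × ℝ)).restrict (univ ×ˢ Ioi 0)

/-- The measure `exp (-m t) dx dt` on the curve times `(0, ∞)`. -/
def weightedMeasure (ℓ : ℝ) [Fact (0 < ℓ)] (m : ℝ) : Measure (AddCircle ℓ × ℝ) :=
  (cylMeasure ℓ).withDensity (fun p => ENNReal.ofReal (Real.exp (-m * p.2)))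

/-- Smooth functions with compact support in the curve times the open half-line `(0, ∞)`. -/
def IsTest (φ : AddCircle ℓ × ℝ → ℝ) : Prop :=
  ContDiff ℝ ∞ (fun p : ℝ × ℝ => φ ((p.1 : AddCircle ℓ), p.2)) ∧
    HasCompactSupport φ ∧ tsupport φ ⊆ univ ×ˢ Ioi 0

/-- `∂ₓᵏ φ`. -/
def derivX (k : ℕ) (φ : AddCircle ℓ × ℝ → ℝ) (p : AddCircle ℓ × ℝ) : ℝ :=
  iteratedDeriv k (fun y : ℝ => φ (p.1 + (y : AddCircle ℓ), p.2)) 0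

/-- `∂ₜᵏ φ`. -/
def derivT (k : ℕ) (φ : AddCircle ℓ × ℝ → ℝ) (p : AddCircle ℓ × ℝ) : ℝ :=
  iteratedDeriv k (fun s : ℝ => φ (p.1, s)) p.2

/-- `g` is the weak derivative `∂ₓᵏ f` on the curve times `(0, ∞)`. -/
def HasWeakDerivX (k : ℕ) (f g : AddCircle ℓ × ℝ → ℝ) : Prop :=
  ∀ φ : AddCircle ℓ × ℝ → ℝ, IsTest φ →
    ∫ p, f p * derivX k φ p ∂(cylMeasure ℓ) = (-1) ^ k * ∫ p, g p * φ p ∂(cylMeasure ℓ)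

/-- `g` is the weak derivative `∂ₜᵏ f` on the curve times `(0, ∞)`. -/
def HasWeakDerivT (k : ℕ) (f g : AddCircle ℓ × ℝ → ℝ) : Prop :=
  ∀ φ : AddCircle ℓ × ℝ → ℝ, IsTest φ →
    ∫ p, f p * derivT k φ p ∂(cylMeasure ℓ) = (-1) ^ k * ∫ p, g p * φ p ∂(cylMeasure ℓ)

/-- The space of functions whose weak derivatives `∂ₓⁱ`, `i ≤ α`, and `∂ₜʲ`, `j ≤ β`, lie in
`L²(μ)`. -/
def MemSobolev (μ : Measure (AddCircle ℓ × ℝ)) (α β : ℕ) (f : AddCircle ℓ × ℝ → ℝ) : Prop :=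
  MemLp f 2 μ ∧
    (∀ i ≤ α, ∃ g : AddCircle ℓ × ℝ → ℝ, MemLp g 2 μ ∧ HasWeakDerivX i f g) ∧
    (∀ j ≤ β, ∃ g : AddCircle ℓ × ℝ → ℝ, MemLp g 2 μ ∧ HasWeakDerivT j f g)

/-- The space `W₂^{α,β}` over the curve times `(0, ∞)`. -/
def MemWW (α β : ℕ) (f : AddCircle ℓ × ℝ → ℝ) : Prop :=
  MemSobolev (cylMeasure ℓ) α β f

/-- `f(·, 0) = f₀`: `f(·, t) → f₀` in `L²` as `t ↓ 0` outside a null set of times, so that the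
condition depends only on the almost-everywhere class of `f`. -/
def HasInitialValue (f : AddCircle ℓ × ℝ → ℝ) (f₀ : AddCircle ℓ → ℝ) : Prop :=
  Tendsto (fun t : ℝ => eLpNorm (fun x => f (x, t) - f₀ x) 2 volume)
    (𝓝[>] 0 ⊓ ae volume) (𝓝 0)

/-! ### The operator `L₀ u = uₜ - (a uₓ)ₓ + b uₓ + c u` -/

/-- The operator `∂ₜ - ∂ₓ (a ∂ₓ ·) + b ∂ₓ + c` is uniformly parabolic: its coefficients are bounded
and measurable, `a` is bounded below by a positive constant, and `a` is Lipschitz in time. -/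
structure IsParabolic (a b c : AddCircle ℓ × ℝ → ℝ) : Prop where
  meas_a : AEStronglyMeasurable a (cylMeasure ℓ)
  meas_b : AEStronglyMeasurable b (cylMeasure ℓ)
  meas_c : AEStronglyMeasurable c (cylMeasure ℓ)
  bounded : ∃ M : ℝ, ∀ x : AddCircle ℓ, ∀ t : ℝ, 0 < t →
    |a (x, t)| ≤ M ∧ |b (x, t)| ≤ M ∧ |c (x, t)| ≤ M
  elliptic : ∃ lam : ℝ, 0 < lam ∧ ∀ x : AddCircle ℓ, ∀ t : ℝ, 0 < t → lam ≤ a (x, t)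
  lipschitz_time : ∃ S : ℝ, ∀ x : AddCircle ℓ, ∀ s t : ℝ, 0 < s → 0 < t →
    |a (x, s) - a (x, t)| ≤ S * |s - t|

/-- The coefficient `a` is Lipschitz in space, uniformly in time. -/
def LipschitzInSpace (a : AddCircle ℓ × ℝ → ℝ) : Prop :=
  ∃ K : ℝ, ∀ x y : AddCircle ℓ, ∀ t : ℝ, 0 < t → |a (x, t) - a (y, t)| ≤ K * dist x y

/-- `u` is a weak solution of `L₀ u = h`, `u(·, 0) = u₀`, for the exponential weight `exp (-m t)`:
`u`, `uₓ`, `uₜ` are square integrable for `exp (-m t) dx dt`, the initial value is attained, and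
the integral identity holds on the curve times `(0, ε)`, for all `ε > 0`, against all `φ` in
`W₂^{1,1}` that vanish at `t = 0`. -/
def IsWeakSolution (a b c h : AddCircle ℓ × ℝ → ℝ) (u₀ : AddCircle ℓ → ℝ) (m : ℝ)
    (u : AddCircle ℓ × ℝ → ℝ) : Prop :=
  ∃ ux ut : AddCircle ℓ × ℝ → ℝ,
    MemLp u 2 (weightedMeasure ℓ m) ∧
    MemLp ux 2 (weightedMeasure ℓ m) ∧ HasWeakDerivX 1 u ux ∧
    MemLp ut 2 (weightedMeasure ℓ m) ∧ HasWeakDerivT 1 u ut ∧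
    HasInitialValue u u₀ ∧
    ∀ φ φx φt : AddCircle ℓ × ℝ → ℝ,
      MemLp φ 2 (cylMeasure ℓ) →
      MemLp φx 2 (cylMeasure ℓ) → HasWeakDerivX 1 φ φx →
      MemLp φt 2 (cylMeasure ℓ) → HasWeakDerivT 1 φ φt →
      HasInitialValue φ (fun _ => 0) →
      ∀ ε : ℝ, 0 < ε →
        ∫ p in univ ×ˢ Ioo 0 ε,
            (ut p * φ p + a p * ux p * φx p + b p * ux p * φ p + c p * u p * φ p) =
          ∫ p in univ ×ˢ Ioo 0 ε, h p * φ p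

/-- `L₀ u = h` almost everywhere on the curve times `(0, ∞)`, where `q` stands for the weak
derivative `(a uₓ)ₓ` and all terms are square integrable for `exp (-m t) dx dt`. -/
def SolvesAE (a b c h : AddCircle ℓ × ℝ → ℝ) (m : ℝ) (u : AddCircle ℓ × ℝ → ℝ) : Prop :=
  ∃ ux ut q : AddCircle ℓ × ℝ → ℝ,
    MemLp u 2 (weightedMeasure ℓ m) ∧
    MemLp ux 2 (weightedMeasure ℓ m) ∧ HasWeakDerivX 1 u ux ∧
    MemLp ut 2 (weightedMeasure ℓ m) ∧ HasWeakDerivT 1 u ut ∧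
    MemLp q 2 (weightedMeasure ℓ m) ∧ HasWeakDerivX 1 (fun p => a p * ux p) q ∧
    ∀ᵐ p ∂(cylMeasure ℓ), ut p - q p + b p * ux p + c p * u p = h p

end

end ParabolicOnCurve

/-!
# Weak solutions of a linear parabolic equation on a closed curve

Subtract the initial value: `w = u - u₀` has to vanish at `t = 0`, that is, `w = ∫₀ᵗ wₜ`. The
equation for `w` is tested with the *time derivatives* `ψ = φₜ` of functions `φ = ∫₀ᵗ ψ`, in
`L²(exp (-m t) dx dt)`. The leading term of the resulting form is `∫ exp (-m t) (φₜ² + a φₓ φₓₜ)`,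
and an integration by parts in time gives `∫ exp (-m t) a φₓ φₓₜ ≥ ½ ∫ exp (-m t) (m a - aₜ) φₓ²`
(`energy_cyl`). Since `a ≥ λ > 0` and `a` is Lipschitz in time, this dominates `φₓ²` with a
constant growing with `m`, so that for large `m` the terms with `b` and `c` are absorbed and the
form is coercive in the norm of `(φ, φₓ, φₜ)` (`IsParabolicWith.coercive`). The initial datum
enters through `∫ exp (-m t) a u₀' ψₓ`, which is bounded by the norm of `φₓ` after another
integration by parts in time (`IsParabolicWith.abs_integral_le`). Lions' projection lemma
(`exists_inner_eq_of_coercive`) then yields a triple `(w, wₓ, wₜ)` in the closure of the test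
triples, and testing with products of trigonometric functions of `x` and smooth functions of `t`
shows that the second and third component are the derivatives of the first and that
`(a uₓ)ₓ = uₜ + b uₓ + c u - h`.

Weak derivatives in `x` are handled slice by slice. A relation `∂ₓ f = g` on the cylinder amounts
to countably many Fourier relations on almost every time slice (`CircleDeriv`), from which
Parseval's identity gives the integration by parts (`CircleDeriv.integral_mul`) and the bound for
difference quotients (`CircleDeriv.integral_translate_sub_sq_le`). If `a` is Lipschitz in `x`, the
latter passes from `a uₓ` to `uₓ`, and the Riesz representation theorem produces `uₓₓ`
(`IsParabolicWith.exists_hasWeakDerivX_of_flux`).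

For uniqueness, the difference `w` of two solutions is the primitive in time of its weak derivative
(`ae_eq_timePrim`).  The function `exp (-k t) w` is admissible as a test function for large `k`, and
the same energy inequality forces `∫ exp (-k t) w² = 0`
(`IsParabolicWith.ae_eq_of_isWeakSolution`).
-/

namespace ParabolicOnCurve

noncomputable section

variable {ℓ : ℝ} [Fact (0 < ℓ)]

set_option linter.unusedSectionVars false

/-! ### Fourier test functions on the circle -/

/-- The real trigonometric functions on the circle: the real and imaginary parts of the monomials
`fourier n`. -/
def trig (i : Bool × ℤ) (x : AddCircle ℓ) : ℝ :=
  if i.1 then (fourier i.2 x).re else (fourier i.2 x).im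

/-- The derivative of `trig i` with respect to arc length. -/
def trigDeriv (i : Bool × ℤ) (x : AddCircle ℓ) : ℝ :=
  2 * Real.pi * i.2 / ℓ * if i.1 then -(fourier i.2 x).im else (fourier i.2 x).re

/-- `g` is the weak derivative of `f` on the circle, tested against the trigonometric functions
only.  These are countably many, so that for functions of `(x, t)` the relation can be required for
almost every `t`. -/
def CircleDeriv (f g : AddCircle ℓ → ℝ) : Prop :=
  ∀ i : Bool × ℤ, ∫ x, f x * trigDeriv i x = -∫ x, g x * trig i x

lemma continuous_trig (i : Bool × ℤ) : Continuous (trig (ℓ := ℓ) i) := by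
  unfold trig
  split_ifs
  · exact Complex.continuous_re.comp (map_continuous _)
  · exact Complex.continuous_im.comp (map_continuous _)

lemma continuous_trigDeriv (i : Bool × ℤ) : Continuous (trigDeriv (ℓ := ℓ) i) := by
  unfold trigDeriv
  split_ifs
  · exact continuous_const.mul (Complex.continuous_im.comp (map_continuous _)).neg
  · exact continuous_const.mul (Complex.continuous_re.comp (map_continuous _))

lemma contDiff_trig (i : Bool × ℤ) :
    ContDiff ℝ ∞ (fun y : ℝ => trig i (y : AddCircle ℓ)) := by
  have h : ContDiff ℝ ∞ (fun y : ℝ => fourier i.2 (y : AddCircle ℓ)) := by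
    simp only [fourier_coe_apply]
    have : ContDiff ℝ ∞ (fun y : ℝ => (y : ℂ)) := Complex.ofRealCLM.contDiff
    exact ((contDiff_const.mul this).div_const _).cexp
  unfold trig
  split_ifs
  · exact Complex.reCLM.contDiff.comp h
  · exact Complex.imCLM.contDiff.comp h

lemma hasDerivAt_trig (i : Bool × ℤ) (x : ℝ) :
    HasDerivAt (fun y : ℝ => trig i (y : AddCircle ℓ)) (trigDeriv i (x : AddCircle ℓ)) x := by
  have h := hasDerivAt_fourier ℓ i.2 x
  have e : (2 * Real.pi * Complex.I * i.2 / ℓ * fourier i.2 (x : AddCircle ℓ) : ℂ) =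
      ((2 * Real.pi * i.2 / ℓ : ℝ) : ℂ) * (Complex.I * fourier i.2 (x : AddCircle ℓ)) := by
    push_cast; ring
  rw [e] at h
  unfold trig trigDeriv
  split_ifs
  · have := Complex.reCLM.hasFDerivAt.comp_hasDerivAt x h
    rw [Complex.reCLM_apply, Complex.re_ofReal_mul] at this
    refine this.congr_deriv ?_
    simp
  · have := Complex.imCLM.hasFDerivAt.comp_hasDerivAt x h
    rw [Complex.imCLM_apply, Complex.im_ofReal_mul] at this
    refine this.congr_deriv ?_
    simp

lemma integral_circle_deriv {F F' : AddCircle ℓ → ℝ}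
    (h : ∀ x : ℝ, HasDerivAt (fun y : ℝ => F (y : AddCircle ℓ)) (F' (x : AddCircle ℓ)) x)
    (hF' : Continuous F') : ∫ x, F' x = 0 := by
  rw [← AddCircle.intervalIntegral_preimage ℓ 0 F',
    intervalIntegral.integral_eq_sub_of_hasDerivAt (fun x _ => h x)]
  · simp [AddCircle.coe_period]
  · exact (hF'.comp (AddCircle.continuous_mk' ℓ)).intervalIntegrable _ _

lemma continuous_of_lift {F : AddCircle ℓ → ℝ}
    (h : Continuous fun y : ℝ => F (y : AddCircle ℓ)) : Continuous F :=
  (QuotientAddGroup.isQuotientMap_mk (N := AddSubgroup.zmultiples ℓ)).continuous_iff.2 h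

lemma circle_integrable {F : AddCircle ℓ → ℝ} (h : Continuous F) : Integrable F :=
  h.integrable_of_hasCompactSupport (HasCompactSupport.of_compactSpace F)

lemma memLp_trig (i : Bool × ℤ) : MemLp (trig (ℓ := ℓ) i) 2 volume :=
  (continuous_trig i).memLp_of_hasCompactSupport (HasCompactSupport.of_compactSpace _)

lemma memLp_trigDeriv (i : Bool × ℤ) : MemLp (trigDeriv (ℓ := ℓ) i) 2 volume :=
  (continuous_trigDeriv i).memLp_of_hasCompactSupport (HasCompactSupport.of_compactSpace _)

lemma circleDeriv_of_hasDerivAt {F F' : AddCircle ℓ → ℝ}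
    (h : ∀ x : ℝ, HasDerivAt (fun y : ℝ => F (y : AddCircle ℓ)) (F' (x : AddCircle ℓ)) x)
    (hF' : Continuous F') : CircleDeriv F F' := by
  intro i
  have hF : Continuous F := continuous_of_lift
    (continuous_iff_continuousAt.2 fun x => (h x).continuousAt)
  have key := integral_circle_deriv (F := fun x => F x * trig i x)
    (F' := fun x => F' x * trig i x + F x * trigDeriv i x)
    (fun x => (h x).mul (hasDerivAt_trig i x))
    ((hF'.mul (continuous_trig i)).add (hF.mul (continuous_trigDeriv i)))
  have e := integral_add (circle_integrable (hF'.mul (continuous_trig i)))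
    (circle_integrable (hF.mul (continuous_trigDeriv i)))
  simp only [Pi.mul_apply] at e
  linarith

lemma memLp_ofReal {f : AddCircle ℓ → ℝ} (hf : MemLp f 2 volume) :
    MemLp (fun x => (f x : ℂ)) 2 (AddCircle.haarAddCircle (T := ℓ)) :=
  MemLp.haarAddCircle hf.ofReal

lemma integrable_mul_continuous {f θ : AddCircle ℓ → ℝ} (hf : MemLp f 2 volume)
    (hθ : Continuous θ) : Integrable (fun x => f x * θ x) :=
  hf.integrable_mul (p := 2) (q := 2)
    (hθ.memLp_of_hasCompactSupport (HasCompactSupport.of_compactSpace θ))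

lemma fourierCoeff_ofReal {f : AddCircle ℓ → ℝ} (hf : MemLp f 2 volume) (n : ℤ) :
    fourierCoeff (fun x => (f x : ℂ)) n =
      (ℓ : ℂ)⁻¹ * (((∫ x, f x * trig (true, n) x : ℝ) : ℂ) -
        Complex.I * ((∫ x, f x * trig (false, n) x : ℝ) : ℂ)) := by
  rw [fourierCoeff, AddCircle.integral_haarAddCircle, ← integral_complex_ofReal,
    ← integral_complex_ofReal,
    ← integral_const_mul, ← integral_sub]
  · rw [Complex.real_smul, Complex.ofReal_inv]
    congr 1
    refine integral_congr_ae (Eventually.of_forall fun x => ?_)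
    simp only [trig, fourier_neg, smul_eq_mul]
    apply Complex.ext <;> simp <;> ring
  · exact (integrable_mul_continuous hf (continuous_trig _)).ofReal
  · exact (integrable_mul_continuous hf (continuous_trig _)).ofReal.const_mul _

lemma CircleDeriv.fourierCoeff_eq {f g : AddCircle ℓ → ℝ} (hf : MemLp f 2 volume)
    (hg : MemLp g 2 volume) (h : CircleDeriv f g) (n : ℤ) :
    fourierCoeff (fun x => (g x : ℂ)) n =
      ((2 * Real.pi * n / ℓ : ℝ) : ℂ) * Complex.I * fourierCoeff (fun x => (f x : ℂ)) n := by
  rw [fourierCoeff_ofReal hf, fourierCoeff_ofReal hg]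
  have h1 := h (true, n)
  have h2 := h (false, n)
  have e1 : ∫ x, f x * trigDeriv (true, n) x =
      -(2 * Real.pi * n / ℓ * ∫ x, f x * trig (false, n) x) := by
    rw [← integral_const_mul, ← integral_neg]
    refine integral_congr_ae (Eventually.of_forall fun x => ?_)
    simp [trig, trigDeriv]; ring
  have e2 : ∫ x, f x * trigDeriv (false, n) x =
      2 * Real.pi * n / ℓ * ∫ x, f x * trig (true, n) x := by
    rw [← integral_const_mul]
    refine integral_congr_ae (Eventually.of_forall fun x => ?_)
    simp [trig, trigDeriv]; ring
  rw [e1] at h1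
  rw [e2] at h2
  rw [← neg_inj.1 h1, ← neg_eq_iff_eq_neg.2 h2]
  push_cast
  linear_combination ((2 * Real.pi * n / ℓ * (ℓ : ℂ)⁻¹ *
    ∫ x, f x * trig (false, n) x : ℂ)) * Complex.I_sq

open ComplexConjugate in
/-- Parseval's identity for the product of two real functions. -/
lemma hasSum_fourierCoeff_mul {f φ : AddCircle ℓ → ℝ} (hf : MemLp f 2 volume)
    (hφ : MemLp φ 2 volume) :
    HasSum (fun n : ℤ => conj (fourierCoeff (fun x => (f x : ℂ)) n) *
      fourierCoeff (fun x => (φ x : ℂ)) n) ((ℓ⁻¹ * ∫ x, f x * φ x : ℝ) : ℂ) := by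
  have key := fourierBasis.hasSum_inner_mul_inner (memLp_ofReal hf).toLp (memLp_ofReal hφ).toLp
  have e : inner ℂ ((memLp_ofReal hf).toLp) ((memLp_ofReal hφ).toLp) =
      ((ℓ⁻¹ * ∫ x, f x * φ x : ℝ) : ℂ) := by
    rw [L2.inner_def, Complex.ofReal_mul, ← integral_complex_ofReal, ← smul_eq_mul,
      Complex.coe_smul,
      ← AddCircle.integral_haarAddCircle]
    refine integral_congr_ae ?_
    filter_upwards [(memLp_ofReal hf).coeFn_toLp, (memLp_ofReal hφ).coeFn_toLp] with x h1 h2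
    rw [h1, h2]
    simp [mul_comm]
  rw [e] at key
  convert! key using 2 with n
  rw [← inner_conj_symm, ← fourierBasis.repr_apply_apply, ← fourierBasis.repr_apply_apply,
    fourierBasis_repr, fourierBasis_repr, fourierCoeff_congr_ae (memLp_ofReal hf).coeFn_toLp,
    fourierCoeff_congr_ae (memLp_ofReal hφ).coeFn_toLp]

/-- Integration by parts on the circle for functions in `W₂¹`. -/
lemma CircleDeriv.integral_mul {f g φ ψ : AddCircle ℓ → ℝ} (hf : MemLp f 2 volume)
    (hg : MemLp g 2 volume) (hφ : MemLp φ 2 volume) (hψ : MemLp ψ 2 volume)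
    (h : CircleDeriv f g) (h' : CircleDeriv φ ψ) :
    ∫ x, f x * ψ x = -∫ x, g x * φ x := by
  have h1 := hasSum_fourierCoeff_mul hf hψ
  have h2 := (hasSum_fourierCoeff_mul hg hφ).neg
  have : (ℓ⁻¹ * ∫ x, f x * ψ x : ℝ) = -(ℓ⁻¹ * ∫ x, g x * φ x : ℝ) := by
    have e := h1.unique (by
      convert! h2 using 2 with n
      rw [h.fourierCoeff_eq hf hg, h'.fourierCoeff_eq hφ hψ, map_mul, map_mul, Complex.conj_ofReal,
        Complex.conj_I]
      ring)
    exact_mod_cast e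
  have hl : ℓ ≠ 0 := (Fact.out : 0 < ℓ).ne'
  field_simp at this
  exact this

/-- Parseval's identity for a real function. -/
lemma hasSum_norm_fourierCoeff {f : AddCircle ℓ → ℝ} (hf : MemLp f 2 volume) :
    HasSum (fun n : ℤ => ‖fourierCoeff (fun x => (f x : ℂ)) n‖ ^ 2) (ℓ⁻¹ * ∫ x, f x ^ 2) := by
  have h := hasSum_fourierCoeff_mul hf hf
  simp only [← sq] at h
  rw [← Complex.hasSum_ofReal]
  convert! h using 2 with n
  rw [Complex.conj_mul']
  push_cast; ring

/-- A square integrable function orthogonal to all trigonometric functions vanishes. -/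
lemma ae_eq_zero_of_integral_trig {f : AddCircle ℓ → ℝ} (hf : MemLp f 2 volume)
    (h : ∀ i, ∫ x, f x * trig i x = 0) : f =ᵐ[volume] 0 := by
  have h1 := hasSum_norm_fourierCoeff hf
  have h2 : ℓ⁻¹ * ∫ x, f x ^ 2 = 0 := by
    refine h1.unique ?_
    convert! hasSum_zero using 2 with n
    rw [fourierCoeff_ofReal hf, h, h]
    simp
  have hl : ℓ⁻¹ ≠ 0 := inv_ne_zero (Fact.out : 0 < ℓ).ne'
  have h3 := (mul_eq_zero.1 h2).resolve_left hl
  rw [integral_eq_zero_iff_of_nonneg (fun x => sq_nonneg _) hf.integrable_sq] at h3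
  filter_upwards [h3] with x hx
  simpa using hx

lemma _root_.MeasureTheory.MemLp.translate {f : AddCircle ℓ → ℝ} (hf : MemLp f 2 volume)
    (y : AddCircle ℓ) :
    MemLp (fun x => f (x + y)) 2 volume :=
  hf.comp_measurePreserving (measurePreserving_add_right volume y)

lemma fourierCoeff_translate (f : AddCircle ℓ → ℂ) (y : AddCircle ℓ) (n : ℤ) :
    fourierCoeff (fun x => f (x + y)) n = fourier n y * fourierCoeff f n := by
  unfold fourierCoeff
  rw [← integral_const_mul,
    ← integral_add_right_eq_self (fun x => fourier n y * fourier (-n) x • f x) y]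
  refine integral_congr_ae (Eventually.of_forall fun x => ?_)
  have : fourier n y * fourier (-n) (x + y) = fourier (-n) x := by
    simp only [fourier_apply, ← Circle.coe_mul, ← AddCircle.toCircle_add]
    congr 2
    simp [smul_add]
  simp only [smul_eq_mul]
  rw [← this]; ring

/-- The difference quotients of a function in `W₂¹` are bounded by its derivative. -/
lemma CircleDeriv.integral_translate_sub_sq_le {f g : AddCircle ℓ → ℝ} (hf : MemLp f 2 volume)
    (hg : MemLp g 2 volume) (h : CircleDeriv f g) (y : ℝ) :
    ∫ x, (f (x + (y : AddCircle ℓ)) - f x) ^ 2 ≤ y ^ 2 * ∫ x, g x ^ 2 := by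
  have hl : 0 < ℓ := Fact.out
  have hfy := (hf.translate (y : AddCircle ℓ))
  have h1 := hasSum_norm_fourierCoeff (hfy.sub hf)
  have h2 := (hasSum_norm_fourierCoeff hg).mul_left (y ^ 2)
  have key := hasSum_le (fun n => ?_) h1 h2
  · simp only [Pi.sub_apply] at key
    rw [mul_left_comm] at key
    exact le_of_mul_le_mul_left key (inv_pos.2 hl)
  · have e : fourierCoeff (fun x => (((fun x => f (x + (y : AddCircle ℓ))) - f) x : ℝ) : _ → ℂ) n =
        (fourier n (y : AddCircle ℓ) - 1) * fourierCoeff (fun x => (f x : ℂ)) n := by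
      have i1 := (memLp_ofReal hfy).integrable (by norm_num)
      have i2 := (memLp_ofReal hf).integrable (by norm_num)
      rw [sub_mul, one_mul, ← fourierCoeff_translate (fun x => (f x : ℂ))]
      unfold fourierCoeff
      rw [← integral_sub (i1.fourier_smul _) (i2.fourier_smul _)]
      simp [mul_sub]
    rw [e, h.fourierCoeff_eq hf hg, norm_mul, norm_mul, norm_mul, Complex.norm_I, mul_one,
      ← sq_abs y, ← mul_pow, ← mul_assoc]
    gcongr
    -- `|exp (i θ) - 1| ≤ |θ|`
    have := Real.norm_exp_I_mul_ofReal_sub_one_le (x := 2 * Real.pi * n / ℓ * y)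
    rw [fourier_coe_apply, Complex.norm_real]
    convert! this using 1
    · congr 3
      push_cast; ring
    · rw [norm_mul, mul_comm, Real.norm_eq_abs y]

lemma deriv₁_one_coe (φ : AddCircle ℓ → ℝ) (x : ℝ) :
    deriv₁ 1 φ (x : AddCircle ℓ) = deriv (fun y : ℝ => φ (y : AddCircle ℓ)) x := by
  unfold deriv₁
  rw [iteratedDeriv_one]
  have := deriv_comp_const_add (f := fun y : ℝ => φ (y : AddCircle ℓ)) x 0
  simpa using this

lemma deriv₁_trig (i : Bool × ℤ) (x : AddCircle ℓ) : deriv₁ 1 (trig i) x = trigDeriv i x := by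
  induction x using QuotientAddGroup.induction_on with
  | H x => exact (deriv₁_one_coe _ x).trans (hasDerivAt_trig i x).deriv

/-- A function in `W₂ᵏ`, `k ≥ 1`, has a square integrable derivative. -/
lemma MemW.exists_circleDeriv {k : ℕ} {f : AddCircle ℓ → ℝ} (hf : MemW (k + 1) f) :
    ∃ g, MemLp g 2 volume ∧ CircleDeriv f g := by
  obtain ⟨g, hg, h⟩ := hf.2 1 (by omega)
  refine ⟨g, hg, fun i => ?_⟩
  have := h (trig i) (contDiff_trig i)
  simpa [deriv₁_trig] using this

/-! ### Weighted square integrable functions on the cylinder -/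

/-- Lebesgue measure on the open half-line of times. -/
abbrev timeMeasure : Measure ℝ := volume.restrict (Ioi 0)

lemma cylMeasure_eq_prod :
    cylMeasure ℓ = (volume : Measure (AddCircle ℓ)).prod timeMeasure := by
  rw [cylMeasure, Measure.volume_eq_prod, ← Measure.prod_restrict, Measure.restrict_univ]

lemma ae_cyl_pos : ∀ᵐ p ∂(cylMeasure ℓ), 0 < p.2 := by
  unfold cylMeasure
  filter_upwards [ae_restrict_mem (MeasurableSet.univ.prod measurableSet_Ioi)] with p hp
  exact hp.2

lemma measurable_expWeight (k : ℝ) :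
    Measurable fun p : AddCircle ℓ × ℝ => Real.exp (k * p.2) := by
  fun_prop

lemma weightedMeasure_eq (m : ℝ) : weightedMeasure ℓ m = (cylMeasure ℓ).withDensity
    (fun p => ((Real.exp (-m * p.2)).toNNReal : ENNReal)) := rfl

lemma aestronglyMeasurable_expWeight_mul {f : AddCircle ℓ × ℝ → ℝ} (k : ℝ) :
    AEStronglyMeasurable (fun p => Real.exp (k * p.2) * f p) (cylMeasure ℓ) ↔
      AEStronglyMeasurable f (cylMeasure ℓ) := by
  constructor
  · intro h
    have := (measurable_expWeight (-k)).aestronglyMeasurable.mul h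
    refine this.congr (Eventually.of_forall fun p => ?_)
    simp [← mul_assoc, ← Real.exp_add]
  · exact fun h => (measurable_expWeight k).aestronglyMeasurable.mul h

lemma memLp_weighted_iff_integrable {f : AddCircle ℓ × ℝ → ℝ} {m : ℝ} :
    MemLp f 2 (weightedMeasure ℓ m) ↔ AEStronglyMeasurable f (cylMeasure ℓ) ∧
      Integrable (fun p => Real.exp (-m * p.2) * f p ^ 2) (cylMeasure ℓ) := by
  have hm : Measurable fun p : AddCircle ℓ × ℝ => (Real.exp (-m * p.2)).toNNReal :=
    (measurable_expWeight (-m)).real_toNNReal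
  have h1 : AEStronglyMeasurable f (weightedMeasure ℓ m) ↔
      AEStronglyMeasurable f (cylMeasure ℓ) := by
    rw [weightedMeasure_eq, aestronglyMeasurable_withDensity_iff hm]
    refine Iff.trans ?_ (aestronglyMeasurable_expWeight_mul (-m))
    simp [Real.coe_toNNReal _ (Real.exp_pos _).le]
  have h2 : Integrable (fun p => f p ^ 2) (weightedMeasure ℓ m) ↔
      Integrable (fun p => Real.exp (-m * p.2) * f p ^ 2) (cylMeasure ℓ) := by
    rw [weightedMeasure_eq, integrable_withDensity_iff_integrable_smul hm]
    simp [NNReal.smul_def, Real.coe_toNNReal _ (Real.exp_pos _).le]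
  rw [← h1, ← h2]
  exact ⟨fun h => ⟨h.1, h.integrable_sq⟩, fun h => (memLp_two_iff_integrable_sq h.1).2 h.2⟩

/-- Multiplication by an exponential in time shifts the weight. -/
lemma memLp_expWeight_mul_iff {f : AddCircle ℓ × ℝ → ℝ} {m : ℝ} (k : ℝ) :
    MemLp (fun p => Real.exp (k * p.2) * f p) 2 (weightedMeasure ℓ m) ↔
      MemLp f 2 (weightedMeasure ℓ (m - 2 * k)) := by
  rw [memLp_weighted_iff_integrable, memLp_weighted_iff_integrable,
    aestronglyMeasurable_expWeight_mul]
  refine and_congr_right fun _ => integrable_congr (Eventually.of_forall fun p => ?_)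
  simp only [mul_pow, ← mul_assoc, ← Real.exp_nat_mul, ← Real.exp_add]
  ring_nf

lemma weightedMeasure_zero : weightedMeasure ℓ 0 = cylMeasure ℓ := by
  simp [weightedMeasure]

lemma memLp_weighted_iff {f : AddCircle ℓ × ℝ → ℝ} {m : ℝ} :
    MemLp f 2 (weightedMeasure ℓ m) ↔
      MemLp (fun p => Real.exp (-(m / 2) * p.2) * f p) 2 (cylMeasure ℓ) := by
  rw [← weightedMeasure_zero, memLp_expWeight_mul_iff]
  ring_nf

lemma _root_.MeasureTheory.MemLp.weighted_mono {f : AddCircle ℓ × ℝ → ℝ} {m m' : ℝ}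
    (h : MemLp f 2 (weightedMeasure ℓ m)) (hm : m ≤ m') : MemLp f 2 (weightedMeasure ℓ m') := by
  rw [memLp_weighted_iff_integrable] at h ⊢
  refine ⟨h.1, h.2.mono ((measurable_expWeight _).aestronglyMeasurable.mul (h.1.pow 2)) ?_⟩
  filter_upwards [ae_cyl_pos] with p hp
  rw [norm_mul, norm_mul]
  gcongr
  rw [Real.norm_of_nonneg (Real.exp_pos _).le, Real.norm_of_nonneg (Real.exp_pos _).le]
  gcongr

lemma _root_.MeasureTheory.MemLp.weighted_of_cyl {f : AddCircle ℓ × ℝ → ℝ} {m : ℝ}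
    (h : MemLp f 2 (cylMeasure ℓ))
    (hm : 0 ≤ m) : MemLp f 2 (weightedMeasure ℓ m) := by
  rw [← weightedMeasure_zero] at h
  exact MemLp.weighted_mono h hm

lemma _root_.MeasureTheory.MemLp.aesm_cyl {f : AddCircle ℓ × ℝ → ℝ} {m : ℝ}
    (h : MemLp f 2 (weightedMeasure ℓ m)) :
    AEStronglyMeasurable f (cylMeasure ℓ) := (memLp_weighted_iff_integrable.1 h).1

/-- The weighted spaces with weights `m` and `-m` are in duality. -/
lemma _root_.MeasureTheory.MemLp.integrable_mul_weighted {f g : AddCircle ℓ × ℝ → ℝ} {m m' : ℝ}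
    (hf : MemLp f 2 (weightedMeasure ℓ m)) (hg : MemLp g 2 (weightedMeasure ℓ m'))
    (h : m + m' ≤ 0) : Integrable (fun p => f p * g p) (cylMeasure ℓ) := by
  have h1 := memLp_weighted_iff.1 hf
  have h2 := memLp_weighted_iff.1 (MemLp.weighted_mono hg (show m' ≤ -m by linarith))
  refine (h1.integrable_mul (p := 2) (q := 2) h2).congr (Eventually.of_forall fun p => ?_)
  simp only [Pi.mul_apply]
  rw [mul_mul_mul_comm, ← Real.exp_add]
  ring_nf
  try simp

lemma _root_.MeasureTheory.MemLp.bdd_mul_weighted {a f : AddCircle ℓ × ℝ → ℝ} {m M : ℝ}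
    (hf : MemLp f 2 (weightedMeasure ℓ m)) (ha : AEStronglyMeasurable a (cylMeasure ℓ))
    (hM : ∀ᵐ p ∂(cylMeasure ℓ), |a p| ≤ M) :
    MemLp (fun p => a p * f p) 2 (weightedMeasure ℓ m) := by
  rw [memLp_weighted_iff] at hf ⊢
  refine MemLp.of_le_mul (c := M) hf ?_ ?_
  · rw [aestronglyMeasurable_expWeight_mul]
    exact ha.mul ((aestronglyMeasurable_expWeight_mul _).1 hf.1)
  · filter_upwards [hM] with p hM
    rw [norm_mul, norm_mul, norm_mul, mul_left_comm]
    exact mul_le_mul_of_nonneg_right hM (by positivity)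

lemma _root_.MeasureTheory.MemLp.weighted_of_continuous {θ : AddCircle ℓ × ℝ → ℝ} (h : Continuous θ)
    (hc : HasCompactSupport θ) (m : ℝ) : MemLp θ 2 (weightedMeasure ℓ m) := by
  rw [memLp_weighted_iff]
  have : Continuous fun p : AddCircle ℓ × ℝ => Real.exp (-(m / 2) * p.2) * θ p := by fun_prop
  have h' := this.memLp_of_hasCompactSupport (p := 2) (μ := (volume : Measure (AddCircle ℓ × ℝ)))
    hc.mul_left
  exact h'.restrict _

/-- Tensor products of square integrable functions. -/
lemma _root_.MeasureTheory.MemLp.weighted_tensor {g : AddCircle ℓ → ℝ} {η : ℝ → ℝ} {m : ℝ}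
    (hg : MemLp g 2 volume)
    (hη : AEStronglyMeasurable η timeMeasure)
    (hη2 : Integrable (fun t => Real.exp (-m * t) * η t ^ 2) timeMeasure) :
    MemLp (fun p : AddCircle ℓ × ℝ => g p.1 * η p.2) 2 (weightedMeasure ℓ m) := by
  rw [memLp_weighted_iff_integrable, cylMeasure_eq_prod]
  refine ⟨hg.1.comp_fst.mul hη.comp_snd, ?_⟩
  refine (hg.integrable_sq.mul_prod hη2).congr (Eventually.of_forall fun p => ?_)
  simp only; ring

lemma integrable_exp_timeMeasure {k : ℝ} (hk : 0 < k) :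
    Integrable (fun t => Real.exp (-k * t)) timeMeasure :=
  exp_neg_integrableOn_Ioi 0 hk

lemma _root_.MeasureTheory.MemLp.weighted_tensor_exp {g : AddCircle ℓ → ℝ} {m k : ℝ}
    (hg : MemLp g 2 volume)
    (h : 0 < m + 2 * k) :
    MemLp (fun p : AddCircle ℓ × ℝ => g p.1 * Real.exp (-k * p.2)) 2 (weightedMeasure ℓ m) := by
  refine MemLp.weighted_tensor (η := fun t => Real.exp (-k * t)) hg
    (Continuous.aestronglyMeasurable (by fun_prop))
    ((integrable_exp_timeMeasure h).congr (Eventually.of_forall fun t => ?_))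
  simp only [← Real.exp_nat_mul, ← Real.exp_add]
  congr 1
  push_cast; ring

lemma _root_.MeasureTheory.MemLp.weighted_fst {g : AddCircle ℓ → ℝ} {m : ℝ}
    (hg : MemLp g 2 volume) (h : 0 < m) :
    MemLp (fun p : AddCircle ℓ × ℝ => g p.1) 2 (weightedMeasure ℓ m) := by
  simpa using MemLp.weighted_tensor_exp (k := 0) hg (by simpa using h)

/-- Almost every time slice of a function in the weighted space is square integrable. -/
lemma _root_.MeasureTheory.MemLp.ae_slice {f : AddCircle ℓ × ℝ → ℝ} {m : ℝ}
    (hf : MemLp f 2 (weightedMeasure ℓ m)) :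
    ∀ᵐ t ∂timeMeasure, MemLp (fun x => f (x, t)) 2 volume := by
  rw [memLp_weighted_iff_integrable, cylMeasure_eq_prod] at hf
  filter_upwards [hf.2.prod_left_ae, hf.1.prodMk_right] with t h1 h2
  rw [memLp_two_iff_integrable_sq h2]
  refine (h1.const_mul (Real.exp (m * t))).congr (Eventually.of_forall fun x => ?_)
  simp [← mul_assoc, ← Real.exp_add]

/-- Almost every line in the time direction carries a locally integrable function. -/
lemma _root_.MeasureTheory.MemLp.ae_intervalIntegrable {f : AddCircle ℓ × ℝ → ℝ} {m : ℝ}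
    (hf : MemLp f 2 (weightedMeasure ℓ m)) :
    ∀ᵐ x : AddCircle ℓ, ∀ s t : ℝ, 0 ≤ s → 0 ≤ t →
      IntervalIntegrable (fun r => f (x, r)) volume s t := by
  have h : MemLp (fun p : AddCircle ℓ × ℝ => (1 : ℝ) * Real.exp (-(|m| + 1) * p.2)) 2
      (weightedMeasure ℓ (-m)) :=
    MemLp.weighted_tensor_exp (g := fun _ => (1 : ℝ)) (memLp_const _)
      (by linarith [le_abs_self m, abs_nonneg m])
  have := hf.integrable_mul_weighted h (by linarith)
  rw [cylMeasure_eq_prod] at this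
  filter_upwards [this.prod_right_ae] with x hx s t hs ht
  have h2 : IntervalIntegrable (fun r => f (x, r) * (1 * Real.exp (-(|m| + 1) * r)))
      volume s t := by
    rw [intervalIntegrable_iff]
    refine IntegrableOn.mono_set hx fun r hr => ?_
    exact lt_of_le_of_lt (le_min hs ht) hr.1
  have h3 := h2.mul_continuousOn (g := fun r => Real.exp ((|m| + 1) * r)) (by fun_prop)
  refine h3.congr (fun r _ => ?_)
  have e : -(|m| + 1) * r + (|m| + 1) * r = 0 := by ring
  simp only [one_mul, mul_assoc, ← Real.exp_add, e, Real.exp_zero, mul_one]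

/-! ### Test functions on the cylinder -/

lemma integral_cyl {F : AddCircle ℓ × ℝ → ℝ} (hF : Integrable F (cylMeasure ℓ)) :
    ∫ p, F p ∂(cylMeasure ℓ) = ∫ t in Ioi 0, ∫ x, F (x, t) := by
  rw [cylMeasure_eq_prod] at hF ⊢
  exact integral_prod_symm F hF

lemma integral_cyl' {F : AddCircle ℓ × ℝ → ℝ} (hF : Integrable F (cylMeasure ℓ)) :
    ∫ p, F p ∂(cylMeasure ℓ) = ∫ x, ∫ t in Ioi 0, F (x, t) := by
  rw [cylMeasure_eq_prod] at hF ⊢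
  exact integral_prod F hF

/-- Smooth functions of time with compact support in `(0, ∞)`. -/
def IsTimeTest (η : ℝ → ℝ) : Prop :=
  ContDiff ℝ ∞ η ∧ HasCompactSupport η ∧ tsupport η ⊆ Ioi 0

lemma IsTimeTest.mul {η ρ : ℝ → ℝ} (hη : IsTimeTest η) (hρ : ContDiff ℝ ∞ ρ) :
    IsTimeTest fun t => ρ t * η t :=
  ⟨hρ.mul hη.1, hη.2.1.mul_left, (tsupport_mul_subset_right).trans hη.2.2⟩

lemma hasCompactSupport_tensor {θ : AddCircle ℓ → ℝ} {η : ℝ → ℝ} (hη : HasCompactSupport η) :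
    HasCompactSupport fun p : AddCircle ℓ × ℝ => θ p.1 * η p.2 :=
  HasCompactSupport.of_support_subset_isCompact (isCompact_univ.prod hη) fun _ hp =>
    ⟨mem_univ _, subset_tsupport _ (right_ne_zero_of_mul hp)⟩

lemma IsTimeTest.isTest {θ : AddCircle ℓ → ℝ} {η : ℝ → ℝ} (hη : IsTimeTest η)
    (hθ : IsTest₁ θ) : IsTest fun p : AddCircle ℓ × ℝ => θ p.1 * η p.2 := by
  refine ⟨(ContDiff.comp hθ contDiff_fst).mul (hη.1.comp contDiff_snd),
    hasCompactSupport_tensor hη.2.1, ?_⟩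
  refine (closure_minimal (t := univ ×ˢ tsupport η) (fun p hp =>
    ⟨mem_univ _, subset_tsupport _ (right_ne_zero_of_mul hp)⟩)
    (isClosed_univ.prod (isClosed_tsupport η))).trans (prod_mono_right hη.2.2)

lemma IsTest.mul_time {φ : AddCircle ℓ × ℝ → ℝ} {ρ : ℝ → ℝ} (hφ : IsTest φ)
    (hρ : ContDiff ℝ ∞ ρ) : IsTest fun p => ρ p.2 * φ p :=
  ⟨(hρ.comp contDiff_snd).mul hφ.1, hφ.2.1.mul_left,
    (tsupport_mul_subset_right (f := fun p : AddCircle ℓ × ℝ => ρ p.2)).trans hφ.2.2⟩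

lemma isOpenQuotientMap_coe_prod :
    IsOpenQuotientMap (fun p : ℝ × ℝ => ((p.1 : AddCircle ℓ), p.2)) :=
  (QuotientAddGroup.isOpenQuotientMap_mk (N := AddSubgroup.zmultiples ℓ)).prodMap .id

lemma continuous_of_lift₂ {φ : AddCircle ℓ × ℝ → ℝ}
    (h : Continuous fun p : ℝ × ℝ => φ ((p.1 : AddCircle ℓ), p.2)) : Continuous φ :=
  isOpenQuotientMap_coe_prod.isQuotientMap.continuous_iff.2 h

lemma IsTest.continuous {φ : AddCircle ℓ × ℝ → ℝ} (hφ : IsTest φ) : Continuous φ :=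
  continuous_of_lift₂ hφ.1.continuous

lemma derivX_one_coe (φ : AddCircle ℓ × ℝ → ℝ) (x t : ℝ) :
    derivX 1 φ ((x : AddCircle ℓ), t) = deriv (fun y : ℝ => φ ((y : AddCircle ℓ), t)) x :=
  deriv₁_one_coe (fun y => φ (y, t)) x

lemma derivT_one (φ : AddCircle ℓ × ℝ → ℝ) (p : AddCircle ℓ × ℝ) :
    derivT 1 φ p = deriv (fun s : ℝ => φ (p.1, s)) p.2 := by
  rw [derivT, iteratedDeriv_one]

lemma derivX_zero (φ : AddCircle ℓ × ℝ → ℝ) : derivX 0 φ = φ := by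
  ext p; simp [derivX]

lemma derivT_zero (φ : AddCircle ℓ × ℝ → ℝ) : derivT 0 φ = φ := by
  ext p; simp [derivT]

lemma derivX_succ (k : ℕ) (φ : AddCircle ℓ × ℝ → ℝ) :
    derivX (k + 1) φ = derivX k (derivX 1 φ) := by
  ext ⟨x, t⟩
  induction x using QuotientAddGroup.induction_on with
  | H x =>
    simp only [derivX]
    rw [iteratedDeriv_succ']
    congr 1
    ext y
    rw [iteratedDeriv_one]
    have := deriv_comp_const_add
      (f := fun y : ℝ => φ ((x : AddCircle ℓ) + (y : AddCircle ℓ), t)) y 0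
    simpa [add_assoc] using this.symm

lemma IsTest.hasDerivAt_derivX {φ : AddCircle ℓ × ℝ → ℝ} (hφ : IsTest φ) (x t : ℝ) :
    HasDerivAt (fun y : ℝ => φ ((y : AddCircle ℓ), t))
      (derivX 1 φ ((x : AddCircle ℓ), t)) x := by
  rw [derivX_one_coe, hasDerivAt_deriv_iff]
  have : ContDiff ℝ ∞ fun y : ℝ => φ ((y : AddCircle ℓ), t) :=
    hφ.1.comp (contDiff_prodMk_left t)
  exact (this.differentiable (by simp)).differentiableAt

lemma IsTest.hasDerivAt_derivT {φ : AddCircle ℓ × ℝ → ℝ} (hφ : IsTest φ) (x : AddCircle ℓ)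
    (t : ℝ) : HasDerivAt (fun s : ℝ => φ (x, s)) (derivT 1 φ (x, t)) t := by
  induction x using QuotientAddGroup.induction_on with
  | H x =>
    rw [derivT_one, hasDerivAt_deriv_iff]
    have : ContDiff ℝ ∞ fun s : ℝ => φ ((x : AddCircle ℓ), s) :=
      hφ.1.comp (contDiff_prodMk_right x)
    exact (this.differentiable (by simp)).differentiableAt

/-- A function supported in the support of a test function, given by a directional derivative of
its lift, is again a test function. -/
lemma IsTest.of_fderiv {φ ψ : AddCircle ℓ × ℝ → ℝ} (hφ : IsTest φ) (v : ℝ × ℝ)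
    (h : ∀ x t : ℝ, ψ ((x : AddCircle ℓ), t) =
      fderiv ℝ (fun p : ℝ × ℝ => φ ((p.1 : AddCircle ℓ), p.2)) (x, t) v) : IsTest ψ := by
  have hs : tsupport ψ ⊆ tsupport φ := by
    refine closure_minimal (fun p hp => ?_) (isClosed_tsupport φ)
    by_contra hn
    obtain ⟨q, rfl⟩ := isOpenQuotientMap_coe_prod.surjective p
    refine hp ((h q.1 q.2).trans ?_)
    have : (fun p : ℝ × ℝ => φ ((p.1 : AddCircle ℓ), p.2)) =ᶠ[𝓝 q] fun _ => 0 :=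
      isOpenQuotientMap_coe_prod.continuous.continuousAt.eventually
        (notMem_tsupport_iff_eventuallyEq.1 hn)
    rw [Prod.mk.eta, this.fderiv_eq]
    simp
  refine ⟨?_, hφ.2.1.mono' ((subset_tsupport _).trans hs), hs.trans hφ.2.2⟩
  have e : (fun p : ℝ × ℝ => ψ ((p.1 : AddCircle ℓ), p.2)) =
      fun p => fderiv ℝ (fun p : ℝ × ℝ => φ ((p.1 : AddCircle ℓ), p.2)) p v := by
    ext p; exact h p.1 p.2
  rw [e]
  exact (hφ.1.fderiv_right (m := ∞) (by simp)).clm_apply contDiff_const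

lemma IsTest.derivX {φ : AddCircle ℓ × ℝ → ℝ} (hφ : IsTest φ) : IsTest (derivX 1 φ) := by
  refine hφ.of_fderiv (1, 0) fun x t => ?_
  have h := (hφ.1.differentiable (by simp) (x, t)).hasFDerivAt.comp_hasDerivAt x
    ((hasDerivAt_id x).prodMk (hasDerivAt_const x t))
  exact (hφ.hasDerivAt_derivX x t).unique h

lemma IsTest.derivT {φ : AddCircle ℓ × ℝ → ℝ} (hφ : IsTest φ) : IsTest (derivT 1 φ) := by
  refine hφ.of_fderiv (0, 1) fun x t => ?_
  have h := (hφ.1.differentiable (by simp) (x, t)).hasFDerivAt.comp_hasDerivAt t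
    ((hasDerivAt_const t x).prodMk (hasDerivAt_id t))
  exact (hφ.hasDerivAt_derivT x t).unique h

lemma IsTest.memLp {φ : AddCircle ℓ × ℝ → ℝ} (hφ : IsTest φ) (m : ℝ) :
    MemLp φ 2 (weightedMeasure ℓ m) :=
  MemLp.weighted_of_continuous hφ.continuous hφ.2.1 m

lemma IsTest.circleDeriv {φ : AddCircle ℓ × ℝ → ℝ} (hφ : IsTest φ) (t : ℝ) :
    CircleDeriv (fun x => φ (x, t)) (fun x => ParabolicOnCurve.derivX 1 φ (x, t)) :=
  circleDeriv_of_hasDerivAt (fun x => hφ.hasDerivAt_derivX x t)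
    (hφ.derivX.continuous.comp (by fun_prop))

lemma derivX_tensor_trig (i : Bool × ℤ) (η : ℝ → ℝ) (p : AddCircle ℓ × ℝ) :
    derivX 1 (fun p : AddCircle ℓ × ℝ => trig i p.1 * η p.2) p = trigDeriv i p.1 * η p.2 := by
  obtain ⟨x, t⟩ := p
  induction x using QuotientAddGroup.induction_on with
  | H x => exact (derivX_one_coe _ x t).trans ((hasDerivAt_trig i x).mul_const (η t)).deriv

/-! ### The weak derivative in space, slice by slice -/

/-- A function on the cylinder whose integrals against all smooth functions of time vanish has
vanishing mean on almost all time slices. -/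
lemma ae_integral_slice_eq_zero {F : AddCircle ℓ × ℝ → ℝ} {k : ℝ}
    (hF : Integrable (fun p => Real.exp (k * p.2) * F p) (cylMeasure ℓ))
    (h : ∀ η, IsTimeTest η → ∫ p, η p.2 * F p ∂(cylMeasure ℓ) = 0) :
    ∀ᵐ t ∂timeMeasure, ∫ x, F (x, t) = 0 := by
  have hF' := hF
  rw [cylMeasure_eq_prod] at hF'
  have hJ := hF'.integral_prod_right
  have key := isOpen_Ioi.ae_eq_zero_of_integral_contDiff_smul_eq_zero (μ := volume)
    (IntegrableOn.locallyIntegrableOn hJ) (fun η h1 h2 h3 => ?_)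
  · rw [ae_restrict_iff' measurableSet_Ioi]
    filter_upwards [key] with t ht h0
    have := ht h0
    rw [integral_const_mul] at this
    exact (mul_eq_zero.1 this).resolve_left (Real.exp_pos _).ne'
  · have hη : IsTimeTest η := ⟨h1, h2, h3⟩
    have h4 := h _ (hη.mul (ρ := fun t => Real.exp (k * t)) (by fun_prop))
    have hint : Integrable (fun p : AddCircle ℓ × ℝ => η p.2 * (Real.exp (k * p.2) * F p))
        (cylMeasure ℓ) := by
      obtain ⟨C, hC⟩ := h1.continuous.bounded_above_of_compact_support h2
      exact hF.bdd_mul (c := C) (by fun_prop) (Eventually.of_forall fun p => hC p.2)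
    have h5 : ∫ p, η p.2 * (Real.exp (k * p.2) * F p) ∂(cylMeasure ℓ) = 0 := by
      rw [← h4]
      congr 1; ext p; ring
    rw [integral_cyl hint] at h5
    rw [← h5, ← integral_indicator measurableSet_Ioi]
    congr 1; ext t
    by_cases ht : t ∈ Ioi (0 : ℝ)
    · simp [indicator_of_mem ht, integral_const_mul]
    · rw [indicator_of_notMem ht, image_eq_zero_of_notMem_tsupport (fun h => ht (h3 h)), zero_smul]

lemma integrable_exp_mul_tensor {f : AddCircle ℓ × ℝ → ℝ} {m : ℝ}
    (hf : MemLp f 2 (weightedMeasure ℓ m)) {θ : AddCircle ℓ → ℝ} (hθ : MemLp θ 2 volume) :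
    Integrable (fun p => Real.exp (-(|m| + 1) * p.2) * (f p * θ p.1)) (cylMeasure ℓ) := by
  have h := MemLp.weighted_tensor_exp (m := -m) (k := |m| + 1) hθ
    (by linarith [le_abs_self m, abs_nonneg m])
  refine (hf.integrable_mul_weighted h (by linarith)).congr (Eventually.of_forall fun p => ?_)
  simp only; ring

/-- To have a weak derivative in `x` on almost all slices it suffices to test with products of
trigonometric functions of `x` and smooth functions of `t`. -/
lemma ae_circleDeriv_of_tensor {f g : AddCircle ℓ × ℝ → ℝ} {m : ℝ}
    (hf : MemLp f 2 (weightedMeasure ℓ m)) (hg : MemLp g 2 (weightedMeasure ℓ m))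
    (h : ∀ i η, IsTimeTest η → ∫ p, f p * (trigDeriv i p.1 * η p.2) ∂(cylMeasure ℓ) =
      -∫ p, g p * (trig i p.1 * η p.2) ∂(cylMeasure ℓ)) :
    ∀ᵐ t ∂timeMeasure, CircleDeriv (fun x => f (x, t)) (fun x => g (x, t)) := by
  have key : ∀ i : Bool × ℤ, ∀ᵐ t ∂timeMeasure,
      ∫ x, (f (x, t) * trigDeriv i x + g (x, t) * trig i x) = 0 := by
    intro i
    have c1 := continuous_trig (ℓ := ℓ) i
    have c2 := continuous_trigDeriv (ℓ := ℓ) i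
    refine ae_integral_slice_eq_zero
      (F := fun p => f p * trigDeriv i p.1 + g p * trig i p.1) (k := -(|m| + 1)) ?_ fun η hη => ?_
    · refine ((integrable_exp_mul_tensor hf (memLp_trigDeriv i)).add
        (integrable_exp_mul_tensor hg (memLp_trig i))).congr
        (Eventually.of_forall fun p => ?_)
      simp only [Pi.add_apply]; ring
    · have h1 := h i η hη
      have i1 := hf.integrable_mul_weighted (MemLp.weighted_of_continuous
        (θ := fun p : AddCircle ℓ × ℝ => trigDeriv i p.1 * η p.2)
        ((c2.comp continuous_fst).mul (hη.1.continuous.comp continuous_snd))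
        (hasCompactSupport_tensor hη.2.1) (-m)) (by linarith)
      have i2 := hg.integrable_mul_weighted (MemLp.weighted_of_continuous
        (θ := fun p : AddCircle ℓ × ℝ => trig i p.1 * η p.2)
        ((c1.comp continuous_fst).mul (hη.1.continuous.comp continuous_snd))
        (hasCompactSupport_tensor hη.2.1) (-m)) (by linarith)
      have : ∫ p, η p.2 * (f p * trigDeriv i p.1 + g p * trig i p.1) ∂(cylMeasure ℓ) =
          ∫ p, (f p * (trigDeriv i p.1 * η p.2) + g p * (trig i p.1 * η p.2))
            ∂(cylMeasure ℓ) := by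
        congr 1; ext p; ring
      rw [this, integral_add i1 i2, h1]
      ring
  filter_upwards [ae_all_iff.2 key, hf.ae_slice, hg.ae_slice] with t ht h1 h2 i
  have := ht i
  rw [integral_add (integrable_mul_continuous h1 (continuous_trigDeriv i))
    (integrable_mul_continuous h2 (continuous_trig i))] at this
  linarith

lemma HasWeakDerivX.ae_circleDeriv {f g : AddCircle ℓ × ℝ → ℝ} {m : ℝ}
    (hf : MemLp f 2 (weightedMeasure ℓ m)) (hg : MemLp g 2 (weightedMeasure ℓ m))
    (h : HasWeakDerivX 1 f g) :
    ∀ᵐ t ∂timeMeasure, CircleDeriv (fun x => f (x, t)) (fun x => g (x, t)) := by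
  refine ae_circleDeriv_of_tensor hf hg fun i η hη => ?_
  have := h _ (hη.isTest (contDiff_trig i))
  simpa [derivX_tensor_trig] using this

/-- Integration by parts in `x` on the cylinder. -/
lemma integral_mul_of_ae_circleDeriv {f g φ ψ : AddCircle ℓ × ℝ → ℝ} {m m' : ℝ}
    (hf : MemLp f 2 (weightedMeasure ℓ m)) (hg : MemLp g 2 (weightedMeasure ℓ m))
    (hφ : MemLp φ 2 (weightedMeasure ℓ m')) (hψ : MemLp ψ 2 (weightedMeasure ℓ m'))
    (hm : m + m' ≤ 0)
    (h : ∀ᵐ t ∂timeMeasure, CircleDeriv (fun x => f (x, t)) (fun x => g (x, t)))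
    (h' : ∀ᵐ t ∂timeMeasure, CircleDeriv (fun x => φ (x, t)) (fun x => ψ (x, t))) :
    ∫ p, f p * ψ p ∂(cylMeasure ℓ) = -∫ p, g p * φ p ∂(cylMeasure ℓ) := by
  rw [integral_cyl (hf.integrable_mul_weighted hψ hm),
    integral_cyl (hg.integrable_mul_weighted hφ hm), ← integral_neg]
  refine integral_congr_ae ?_
  filter_upwards [h, h', hf.ae_slice, hg.ae_slice, hφ.ae_slice, hψ.ae_slice]
    with t h1 h2 h3 h4 h5 h6
  exact h1.integral_mul h3 h4 h5 h6 h2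

lemma hasWeakDerivX_one_of_ae_circleDeriv {f g : AddCircle ℓ × ℝ → ℝ} {m : ℝ}
    (hf : MemLp f 2 (weightedMeasure ℓ m)) (hg : MemLp g 2 (weightedMeasure ℓ m))
    (h : ∀ᵐ t ∂timeMeasure, CircleDeriv (fun x => f (x, t)) (fun x => g (x, t))) :
    HasWeakDerivX 1 f g := by
  intro φ hφ
  rw [pow_one, neg_one_mul]
  exact integral_mul_of_ae_circleDeriv hf hg (hφ.memLp (-m)) (hφ.derivX.memLp (-m)) (by linarith)
    h (Eventually.of_forall fun t => hφ.circleDeriv t)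

/-! ### Primitives in time -/

lemma integral_primitive_mul_deriv {f g : ℝ → ℝ} {T : ℝ} (hf : IntervalIntegrable f volume 0 T)
    (hg : AbsolutelyContinuousOnInterval g 0 T) :
    ∫ t in (0 : ℝ)..T, (∫ s in (0 : ℝ)..t, f s) * deriv g t =
      (∫ s in (0 : ℝ)..T, f s) * g T - ∫ t in (0 : ℝ)..T, f t * g t := by
  have hw := hf.absolutelyContinuousOnInterval_intervalIntegral (c := 0) (by simp)
  rw [hw.integral_mul_deriv_eq_deriv_mul hg]
  simp only [intervalIntegral.integral_same, zero_mul, sub_zero]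
  congr 1
  refine intervalIntegral.integral_congr_ae ?_
  filter_upwards [hf.ae_hasDerivAt_integral] with t ht h
  rw [(ht (uIoc_subset_uIcc h) 0 (by simp)).deriv]

/-- The energy identity: integration by parts of `a w w'` for `w` a primitive. -/
lemma integral_mul_primitive_mul {f a : ℝ → ℝ} {T : ℝ} (hf : IntervalIntegrable f volume 0 T)
    (ha : AbsolutelyContinuousOnInterval a 0 T) :
    ∫ t in (0 : ℝ)..T, a t * ((∫ s in (0 : ℝ)..t, f s) * f t) =
      a T * (∫ s in (0 : ℝ)..T, f s) ^ 2 / 2 -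
        ∫ t in (0 : ℝ)..T, deriv a t * (∫ s in (0 : ℝ)..t, f s) ^ 2 / 2 := by
  have hw := hf.absolutelyContinuousOnInterval_intervalIntegral (c := 0) (by simp)
  have key := ha.integral_mul_deriv_eq_deriv_mul (hw.fun_mul hw)
  have e : ∫ t in (0 : ℝ)..T, a t *
        deriv (fun t => (∫ s in (0 : ℝ)..t, f s) * ∫ s in (0 : ℝ)..t, f s) t =
      ∫ t in (0 : ℝ)..T, 2 * (a t * ((∫ s in (0 : ℝ)..t, f s) * f t)) := by
    refine intervalIntegral.integral_congr_ae ?_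
    filter_upwards [hf.ae_hasDerivAt_integral] with t ht h
    have := ht (uIoc_subset_uIcc h) 0 (by simp)
    rw [(this.fun_mul this).deriv]
    ring
  rw [e, intervalIntegral.integral_const_mul] at key
  simp only [intervalIntegral.integral_same, mul_zero, sub_zero] at key
  simp only [sq, intervalIntegral.integral_div]
  linarith

/-- An exponential times a Lipschitz function is absolutely continuous, with the expected
derivative. -/
lemma expWeight_mul_lipschitz {a : ℝ → ℝ} {S : NNReal} (ha : LipschitzWith S a) (m T : ℝ) :
    AbsolutelyContinuousOnInterval (fun t => Real.exp (-m * t) * a t) 0 T ∧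
      ∀ᵐ t, |deriv (fun t => Real.exp (-m * t) * a t) t + m * (Real.exp (-m * t) * a t)| ≤
        S * Real.exp (-m * t) := by
  have h1 : ContDiff ℝ 1 fun t : ℝ => Real.exp (-m * t) := by fun_prop
  refine ⟨(h1.contDiffOn.absolutelyContinuousOnInterval).fun_mul
    (ha.lipschitzOnWith).absolutelyContinuousOnInterval, ?_⟩
  filter_upwards [ha.ae_differentiableAt_real] with t ht
  have h2 : HasDerivAt (fun t : ℝ => Real.exp (-m * t)) (Real.exp (-m * t) * -m) t := by
    simpa using ((hasDerivAt_id t).const_mul (-m)).exp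
  rw [(h2.fun_mul ht.hasDerivAt).deriv]
  have h3 := norm_deriv_le_of_lipschitz ha (x₀ := t)
  rw [show Real.exp (-m * t) * -m * a t + Real.exp (-m * t) * deriv a t +
    m * (Real.exp (-m * t) * a t) = deriv a t * Real.exp (-m * t) by ring, abs_mul,
    abs_of_pos (Real.exp_pos _)]
  exact mul_le_mul_of_nonneg_right h3 (Real.exp_pos _).le

/-- The coefficients are only controlled for positive times; an extension to the real line makes the
theory of Lipschitz functions applicable up to `t = 0`. -/
lemma exists_lipschitz_extension {a : ℝ → ℝ} {S : ℝ}
    (ha : ∀ s t, 0 < s → 0 < t → |a s - a t| ≤ S * |s - t|) :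
    ∃ b : ℝ → ℝ, LipschitzWith S.toNNReal b ∧ ∀ t, 0 < t → a t = b t := by
  have h : LipschitzOnWith S.toNNReal a (Ioi 0) := by
    refine LipschitzOnWith.of_dist_le_mul fun s hs t ht => ?_
    refine (ha s t hs ht).trans ?_
    rw [Real.dist_eq]
    exact mul_le_mul_of_nonneg_right (Real.le_coe_toNNReal S) (abs_nonneg _)
  obtain ⟨b, hb, hab⟩ := h.extend_real
  exact ⟨b, hb, fun t ht => hab ht⟩

lemma lipschitz_const_nonneg {a : ℝ → ℝ} {S : ℝ}
    (ha : ∀ s t, 0 < s → 0 < t → |a s - a t| ≤ S * |s - t|) : 0 ≤ S := by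
  have := (abs_nonneg _).trans (ha 1 2 one_pos two_pos)
  norm_num at this
  exact this

/-- The energy inequality for the primitive `w` of `f`: half the weight `m a - a'`, which is at
least `m λ - S`, appears in front of `w²`; the boundary term at `T` has the good sign. -/
lemma energy_interval {a f : ℝ → ℝ} {S lam m T : ℝ} (hT : 0 < T) (hm : 0 ≤ m) (hlam : 0 ≤ lam)
    (ha : ∀ s t, 0 < s → 0 < t → |a s - a t| ≤ S * |s - t|) (hal : ∀ t, 0 < t → lam ≤ a t)
    (hf : IntervalIntegrable f volume 0 T) :
    (m * lam - S) / 2 * ∫ t in (0 : ℝ)..T, Real.exp (-m * t) * (∫ s in (0 : ℝ)..t, f s) ^ 2 ≤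
      ∫ t in (0 : ℝ)..T, Real.exp (-m * t) * (a t * ((∫ s in (0 : ℝ)..t, f s) * f t)) := by
  have hS := lipschitz_const_nonneg ha
  obtain ⟨b, hb, hab⟩ := exists_lipschitz_extension ha
  obtain ⟨hAC, hder⟩ := expWeight_mul_lipschitz hb m T
  have hw := hf.absolutelyContinuousOnInterval_intervalIntegral (c := 0) (by simp)
  have e : ∫ t in (0 : ℝ)..T, Real.exp (-m * t) * (a t * ((∫ s in (0 : ℝ)..t, f s) * f t)) =
      ∫ t in (0 : ℝ)..T, (Real.exp (-m * t) * b t) * ((∫ s in (0 : ℝ)..t, f s) * f t) := by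
    refine intervalIntegral.integral_congr_ae (Eventually.of_forall fun t ht => ?_)
    rw [uIoc_of_le hT.le] at ht
    rw [hab t ht.1]; ring
  rw [e, integral_mul_primitive_mul hf hAC]
  have h0 : 0 ≤ Real.exp (-m * T) * b T * (∫ s in (0 : ℝ)..T, f s) ^ 2 / 2 := by
    have : 0 ≤ b T := (hab T hT) ▸ hlam.trans (hal T hT)
    positivity
  have h1 : (m * lam - S) / 2 *
        ∫ t in (0 : ℝ)..T, Real.exp (-m * t) * (∫ s in (0 : ℝ)..t, f s) ^ 2 ≤
      -∫ t in (0 : ℝ)..T, deriv (fun t => Real.exp (-m * t) * b t) t *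
        (∫ s in (0 : ℝ)..t, f s) ^ 2 / 2 := by
    rw [← intervalIntegral.integral_const_mul, ← intervalIntegral.integral_neg]
    refine intervalIntegral.integral_mono_ae_restrict hT.le ?_ ?_ ?_
    · refine ContinuousOn.intervalIntegrable ?_
      exact continuousOn_const.mul ((by fun_prop : Continuous fun t : ℝ =>
        Real.exp (-m * t)).continuousOn.mul (hw.continuousOn.pow 2))
    · exact ((hAC.intervalIntegrable_deriv.mul_continuousOn
        (hw.continuousOn.pow 2)).div_const 2).neg
    · filter_upwards [ae_restrict_of_ae hder, ae_restrict_mem measurableSet_Icc,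
        ae_restrict_of_ae (Measure.ae_ne volume (0 : ℝ))] with t ht hI h0
      have hpos : 0 < t := lt_of_le_of_ne hI.1 (Ne.symm h0)
      have h2 := hal t hpos
      rw [hab t hpos] at h2
      rw [Real.coe_toNNReal S hS] at ht
      have h3 := (abs_le.1 ht).2
      have h4 : (m * lam - S) * Real.exp (-m * t) ≤
          -deriv (fun t => Real.exp (-m * t) * b t) t := by
        have : m * (Real.exp (-m * t) * lam) ≤ m * (Real.exp (-m * t) * b t) := by gcongr
        nlinarith
      have h5 := mul_le_mul_of_nonneg_right h4 (sq_nonneg (∫ s in (0 : ℝ)..t, f s))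
      linarith
  linarith

/-- A weighted integral of `a f` is bounded by the primitive of `f` alone, because the derivative
can be moved to the Lipschitz function `a`. -/
lemma abs_integral_le_primitive_interval {a f : ℝ → ℝ} {S M m T : ℝ} (hT : 0 < T) (hm : 0 ≤ m)
    (ha : ∀ s t, 0 < s → 0 < t → |a s - a t| ≤ S * |s - t|) (haM : ∀ t, 0 < t → |a t| ≤ M)
    (hf : IntervalIntegrable f volume 0 T) :
    |∫ t in (0 : ℝ)..T, Real.exp (-m * t) * (a t * f t)| ≤
      Real.exp (-m * T) * M * |∫ s in (0 : ℝ)..T, f s| +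
      (m * M + S) * ∫ t in (0 : ℝ)..T, Real.exp (-m * t) * |∫ s in (0 : ℝ)..t, f s| := by
  have hS := lipschitz_const_nonneg ha
  obtain ⟨b, hb, hab⟩ := exists_lipschitz_extension ha
  obtain ⟨hAC, hder⟩ := expWeight_mul_lipschitz hb m T
  have hw := hf.absolutelyContinuousOnInterval_intervalIntegral (c := 0) (by simp)
  have key := integral_primitive_mul_deriv hf hAC
  have e : ∫ t in (0 : ℝ)..T, Real.exp (-m * t) * (a t * f t) =
      ∫ t in (0 : ℝ)..T, f t * (Real.exp (-m * t) * b t) := by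
    refine intervalIntegral.integral_congr_ae (Eventually.of_forall fun t ht => ?_)
    rw [uIoc_of_le hT.le] at ht
    rw [hab t ht.1]; ring
  have h1 : |∫ t in (0 : ℝ)..T, (∫ s in (0 : ℝ)..t, f s) *
        deriv (fun t => Real.exp (-m * t) * b t) t| ≤
      (m * M + S) * ∫ t in (0 : ℝ)..T, Real.exp (-m * t) * |∫ s in (0 : ℝ)..t, f s| := by
    rw [← intervalIntegral.integral_const_mul]
    refine (intervalIntegral.abs_integral_le_integral_abs hT.le).trans ?_
    refine intervalIntegral.integral_mono_ae_restrict hT.le ?_ ?_ ?_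
    · exact (hAC.intervalIntegrable_deriv.continuousOn_mul hw.continuousOn).abs
    · refine ContinuousOn.intervalIntegrable ?_
      exact continuousOn_const.mul ((by fun_prop : Continuous fun t : ℝ =>
        Real.exp (-m * t)).continuousOn.mul hw.continuousOn.abs)
    · filter_upwards [ae_restrict_of_ae hder, ae_restrict_mem measurableSet_Icc,
        ae_restrict_of_ae (Measure.ae_ne volume (0 : ℝ))] with t ht hI h0
      have hpos : 0 < t := lt_of_le_of_ne hI.1 (Ne.symm h0)
      have h2 := haM t hpos
      rw [hab t hpos] at h2
      rw [Real.coe_toNNReal S hS] at ht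
      have h4 : |deriv (fun t => Real.exp (-m * t) * b t) t| ≤
          (m * M + S) * Real.exp (-m * t) := by
        have h5 : |m * (Real.exp (-m * t) * b t)| ≤ m * (Real.exp (-m * t) * M) := by
          rw [abs_mul, abs_mul, abs_of_nonneg hm, abs_of_pos (Real.exp_pos _)]
          gcongr
        have h6 := abs_sub (deriv (fun t => Real.exp (-m * t) * b t) t +
          m * (Real.exp (-m * t) * b t)) (m * (Real.exp (-m * t) * b t))
        rw [add_sub_cancel_right] at h6
        nlinarith
      simp only [abs_mul]
      rw [mul_comm, ← mul_assoc]
      exact mul_le_mul_of_nonneg_right h4 (abs_nonneg _)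
  have h2 : |(∫ s in (0 : ℝ)..T, f s) * (Real.exp (-m * T) * b T)| ≤
      Real.exp (-m * T) * M * |∫ s in (0 : ℝ)..T, f s| := by
    rw [abs_mul, abs_mul, abs_of_pos (Real.exp_pos _), mul_comm, ← hab T hT]
    have := haM T hT
    gcongr
  have h3 : ∫ t in (0 : ℝ)..T, f t * (Real.exp (-m * t) * b t) =
      (∫ s in (0 : ℝ)..T, f s) * (Real.exp (-m * T) * b T) -
      ∫ t in (0 : ℝ)..T, (∫ s in (0 : ℝ)..t, f s) *
        deriv (fun t => Real.exp (-m * t) * b t) t := by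
    linarith
  rw [e, h3]
  exact (abs_sub _ _).trans (add_le_add h2 h1)

/-- Cauchy-Schwarz for a primitive, with an exponential weight. -/
lemma sq_integral_le_weighted {f : ℝ → ℝ} {m t : ℝ} (hm : 0 ≤ m) (ht : 0 < t)
    (hf : IntervalIntegrable f volume 0 t)
    (hf2 : IntegrableOn (fun s => Real.exp (-m * s) * f s ^ 2) (Ioi 0)) :
    (∫ s in (0 : ℝ)..t, f s) ^ 2 ≤
      t * Real.exp (m * t) * ∫ s in Ioi 0, Real.exp (-m * s) * f s ^ 2 := by
  set I := ∫ s in (0 : ℝ)..t, f s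
  have i2 : IntervalIntegrable (fun s => Real.exp (-m * s) * f s ^ 2) volume 0 t := by
    rw [intervalIntegrable_iff, uIoc_of_le ht.le]
    exact hf2.mono_set fun s hs => hs.1
  have i3 : IntervalIntegrable (fun s => f s ^ 2) volume 0 t := by
    have h3 := i2.mul_continuousOn (g := fun s => Real.exp (m * s)) (by fun_prop)
    refine h3.congr fun s _ => ?_
    have e : -m * s + m * s = 0 := by ring
    change Real.exp (-m * s) * f s ^ 2 * Real.exp (m * s) = f s ^ 2
    rw [mul_right_comm, ← Real.exp_add, e, Real.exp_zero, one_mul]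
  have h1 : I ^ 2 ≤ t * ∫ s in (0 : ℝ)..t, f s ^ 2 := by
    -- integrate `(f - I / t)² ≥ 0`
    have h : 0 ≤ ∫ s in (0 : ℝ)..t, (f s ^ 2 - 2 * (I / t) * f s + (I / t) ^ 2) :=
      intervalIntegral.integral_nonneg ht.le fun s _ => by nlinarith [sq_nonneg (f s - I / t)]
    rw [intervalIntegral.integral_add (i3.sub (hf.const_mul _)) intervalIntegrable_const,
      intervalIntegral.integral_sub i3 (hf.const_mul _), intervalIntegral.integral_const_mul,
      intervalIntegral.integral_const, sub_zero, smul_eq_mul] at h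
    have h2 : (∫ s in (0 : ℝ)..t, f s ^ 2) - 2 * (I / t) * I + t * (I / t) ^ 2 =
        (∫ s in (0 : ℝ)..t, f s ^ 2) - I ^ 2 / t := by field_simp; ring
    rw [h2] at h
    have h3 : I ^ 2 / t ≤ ∫ s in (0 : ℝ)..t, f s ^ 2 := by linarith
    rwa [div_le_iff₀' ht] at h3
  have h2 : ∫ s in (0 : ℝ)..t, f s ^ 2 ≤
      Real.exp (m * t) * ∫ s in (0 : ℝ)..t, Real.exp (-m * s) * f s ^ 2 := by
    rw [← intervalIntegral.integral_const_mul]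
    refine intervalIntegral.integral_mono_on ht.le i3 (i2.const_mul _) fun s hs => ?_
    rw [← mul_assoc, ← Real.exp_add]
    refine le_mul_of_one_le_left (sq_nonneg _) (Real.one_le_exp ?_)
    nlinarith [hs.2]
  have h3 : ∫ s in (0 : ℝ)..t, Real.exp (-m * s) * f s ^ 2 ≤
      ∫ s in Ioi 0, Real.exp (-m * s) * f s ^ 2 := by
    rw [intervalIntegral.integral_of_le ht.le]
    exact setIntegral_mono_set hf2 (Eventually.of_forall fun s => by positivity)
      (Eventually.of_forall fun s hs => hs.1)
  calc I ^ 2 ≤ t * ∫ s in (0 : ℝ)..t, f s ^ 2 := h1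
    _ ≤ t * (Real.exp (m * t) * ∫ s in Ioi 0, Real.exp (-m * s) * f s ^ 2) := by
        have := h2.trans (mul_le_mul_of_nonneg_left h3 (Real.exp_pos (m * t)).le)
        gcongr
    _ = _ := by ring

/-- The primitive in time vanishing at `t = 0`. -/
def timePrim (v : AddCircle ℓ × ℝ → ℝ) (p : AddCircle ℓ × ℝ) : ℝ :=
  ∫ s in (0 : ℝ)..p.2, v (p.1, s)

lemma ae_slice_eq {f g : AddCircle ℓ × ℝ → ℝ} (h : f =ᵐ[cylMeasure ℓ] g) :
    ∀ᵐ x : AddCircle ℓ, ∀ᵐ t ∂timeMeasure, f (x, t) = g (x, t) := by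
  rw [cylMeasure_eq_prod] at h
  exact Measure.ae_ae_of_ae_prod h

lemma ae_cyl_of_ae_fst {P : AddCircle ℓ → Prop} (h : ∀ᵐ x, P x) :
    ∀ᵐ p ∂(cylMeasure ℓ), P p.1 := by
  rw [cylMeasure_eq_prod]
  exact Measure.quasiMeasurePreserving_fst.ae h

lemma timePrim_congr {f g : AddCircle ℓ × ℝ → ℝ} (h : f =ᵐ[cylMeasure ℓ] g) :
    ∀ᵐ x : AddCircle ℓ, ∀ t, 0 ≤ t → timePrim f (x, t) = timePrim g (x, t) := by
  filter_upwards [ae_slice_eq h] with x hx t ht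
  rw [ae_restrict_iff' measurableSet_Ioi] at hx
  refine intervalIntegral.integral_congr_ae ?_
  filter_upwards [hx] with s hs h
  rw [uIoc_of_le ht] at h
  exact hs h.1

lemma aestronglyMeasurable_timePrim {v : AddCircle ℓ × ℝ → ℝ}
    (hv : AEStronglyMeasurable v (cylMeasure ℓ)) :
    AEStronglyMeasurable (timePrim v) (cylMeasure ℓ) := by
  obtain ⟨w, hw, hvw⟩ := hv
  have h1 : StronglyMeasurable fun q : (AddCircle ℓ × ℝ) × ℝ =>
      (if 0 < q.2 ∧ q.2 ≤ q.1.2 then w (q.1.1, q.2) else 0) := by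
    refine StronglyMeasurable.ite ?_ (hw.comp_measurable (by fun_prop)) stronglyMeasurable_const
    exact (measurableSet_lt measurable_const measurable_snd).inter
      (measurableSet_le measurable_snd (by fun_prop))
  refine ⟨_, h1.integral_prod_right' (ν := volume), ?_⟩
  filter_upwards [ae_cyl_of_ae_fst (timePrim_congr hvw), ae_cyl_pos] with p hp hpos
  rw [← Prod.mk.eta (p := p), hp _ hpos.le, timePrim, intervalIntegral.integral_of_le hpos.le,
    ← integral_indicator measurableSet_Ioc]
  refine integral_congr_ae (Eventually.of_forall fun s => ?_)
  simp [indicator_apply]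

/-- On almost every line, a primitive in time is `O(√(t exp (m t)))`, with a square integrable
constant: the weighted norm of its derivative on that line. -/
lemma exists_abs_timePrim_le {v : AddCircle ℓ × ℝ → ℝ} {m : ℝ} (hm : 0 ≤ m)
    (hv : MemLp v 2 (weightedMeasure ℓ m)) :
    ∃ G : AddCircle ℓ → ℝ, MemLp G 2 volume ∧ (∀ x, 0 ≤ G x) ∧ ∀ᵐ x, ∀ t, 0 < t →
      |timePrim v (x, t)| ≤ Real.sqrt (t * Real.exp (m * t)) * G x := by
  have h := (memLp_weighted_iff_integrable.1 hv).2
  rw [cylMeasure_eq_prod] at h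
  have h1 := h.integral_prod_left
  have h0 : ∀ x : AddCircle ℓ, 0 ≤ ∫ t in Ioi 0, Real.exp (-m * t) * v (x, t) ^ 2 :=
    fun x => integral_nonneg fun t => by positivity
  refine ⟨fun x => Real.sqrt (∫ t in Ioi 0, Real.exp (-m * t) * v (x, t) ^ 2), ?_,
    fun x => Real.sqrt_nonneg _, ?_⟩
  · rw [memLp_two_iff_integrable_sq (Real.continuous_sqrt.comp_aestronglyMeasurable h1.1)]
    exact h1.congr (Eventually.of_forall fun x => (Real.sq_sqrt (h0 x)).symm)
  · filter_upwards [h.prod_right_ae, hv.ae_intervalIntegrable] with x hx hx2 t ht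
    rw [← Real.sqrt_mul (by positivity)]
    exact Real.abs_le_sqrt (sq_integral_le_weighted hm ht (hx2 0 t le_rfl ht.le) hx)

/-- The loss of `2` in the weight makes room for the growth `√(t exp (m t))` of the primitive. -/
lemma _root_.MeasureTheory.MemLp.timePrim {v : AddCircle ℓ × ℝ → ℝ} {m : ℝ} (hm : 0 ≤ m)
    (hv : MemLp v 2 (weightedMeasure ℓ m)) :
    MemLp (timePrim v) 2 (weightedMeasure ℓ (m + 2)) := by
  obtain ⟨G, hG, hG0, h⟩ := exists_abs_timePrim_le hm hv
  have h2 := MemLp.weighted_tensor_exp (m := m + 2) (k := -(m + 1) / 2) hG (by linarith)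
  rw [memLp_weighted_iff] at h2 ⊢
  refine h2.mono ((aestronglyMeasurable_expWeight_mul _).2
    (aestronglyMeasurable_timePrim hv.aesm_cyl)) ?_
  filter_upwards [ae_cyl_of_ae_fst h, ae_cyl_pos] with p hp hpos
  rw [norm_mul, norm_mul]
  gcongr
  refine (hp p.2 hpos).trans ?_
  have h3 : Real.sqrt (p.2 * Real.exp (m * p.2)) ≤ Real.exp (-(-(m + 1) / 2) * p.2) := by
    rw [Real.sqrt_le_left (Real.exp_pos _).le, ← Real.exp_nat_mul]
    calc p.2 * Real.exp (m * p.2) ≤ Real.exp p.2 * Real.exp (m * p.2) := by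
          gcongr
          linarith [Real.add_one_le_exp p.2]
      _ = _ := by rw [← Real.exp_add]; congr 1; push_cast; ring
  rw [norm_mul, Real.norm_of_nonneg (Real.exp_pos _).le, Real.norm_of_nonneg (hG0 _), mul_comm]
  exact mul_le_mul_of_nonneg_left h3 (hG0 _)

/-- A primitive in time of a function in the weighted space tends to zero as `t ↓ 0`. -/
lemma hasInitialValue_add_timePrim {v : AddCircle ℓ × ℝ → ℝ} {m : ℝ} (hm : 0 ≤ m)
    (hv : MemLp v 2 (weightedMeasure ℓ m)) (f₀ : AddCircle ℓ → ℝ) :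
    HasInitialValue (fun p => f₀ p.1 + timePrim v p) f₀ := by
  obtain ⟨G, hG, hG0, h⟩ := exists_abs_timePrim_le hm hv
  unfold HasInitialValue
  have h1 : Tendsto (fun t : ℝ => ENNReal.ofReal (Real.sqrt (t * Real.exp (m * t))) *
      eLpNorm G 2 volume) (𝓝[>] 0 ⊓ ae volume) (𝓝 0) := by
    have h2 : Tendsto (fun t : ℝ => ENNReal.ofReal (Real.sqrt (t * Real.exp (m * t))))
        (𝓝 0) (𝓝 0) := by
      have : Continuous fun t : ℝ => ENNReal.ofReal (Real.sqrt (t * Real.exp (m * t))) :=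
        ENNReal.continuous_ofReal.comp (by fun_prop)
      simpa using this.tendsto 0
    have h3 := ENNReal.Tendsto.mul_const (b := eLpNorm G 2 volume) h2 (Or.inr hG.2.ne)
    rw [zero_mul] at h3
    exact h3.mono_left (inf_le_left.trans nhdsWithin_le_nhds)
  refine tendsto_of_tendsto_of_tendsto_of_le_of_le' tendsto_const_nhds h1
    (Eventually.of_forall fun _ => zero_le) ?_
  have h4 : ∀ᶠ t : ℝ in 𝓝[>] 0 ⊓ ae volume, 0 < t :=
    Filter.Eventually.filter_mono inf_le_left self_mem_nhdsWithin
  filter_upwards [h4] with t ht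
  refine eLpNorm_le_mul_eLpNorm_of_ae_le_mul ?_ 2
  filter_upwards [h] with x hx
  rw [add_sub_cancel_left, Real.norm_of_nonneg (hG0 x)]
  exact hx t ht

lemma eventually_initial {P : ℝ → Prop} (h : ∀ᵐ t ∂timeMeasure, P t) :
    ∀ᶠ t in 𝓝[>] (0 : ℝ) ⊓ ae volume, P t := by
  rw [ae_restrict_iff' measurableSet_Ioi] at h
  filter_upwards [Filter.Eventually.filter_mono inf_le_right h,
    Filter.Eventually.filter_mono inf_le_left self_mem_nhdsWithin] with t h1 h2
  exact h1 h2

/-- The filter in the definition of `HasInitialValue` is nontrivial, so that inequalities pass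
to the limit. -/
instance neBot_initial : NeBot (𝓝[>] (0 : ℝ) ⊓ ae volume) := by
  rw [(nhdsGT_basis (0 : ℝ)).inf_neBot_iff]
  intro δ hδ s hs
  by_contra hne
  rw [not_nonempty_iff_eq_empty, ← disjoint_iff_inter_eq_empty] at hne
  have h1 : volume (Ioo 0 δ) = 0 := measure_mono_null hne.subset_compl_right (mem_ae_iff.1 hs)
  rw [Real.volume_Ioo, ENNReal.ofReal_eq_zero] at h1
  linarith

lemma HasInitialValue.sub {f g : AddCircle ℓ × ℝ → ℝ} {f₀ g₀ : AddCircle ℓ → ℝ} {m m' : ℝ}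
    (hf : MemLp f 2 (weightedMeasure ℓ m)) (hg : MemLp g 2 (weightedMeasure ℓ m'))
    (hf₀ : AEStronglyMeasurable f₀ volume) (hg₀ : AEStronglyMeasurable g₀ volume)
    (h : HasInitialValue f f₀) (h' : HasInitialValue g g₀) :
    HasInitialValue (fun p => f p - g p) (fun x => f₀ x - g₀ x) := by
  have := Tendsto.add h h'
  rw [add_zero] at this
  refine tendsto_of_tendsto_of_tendsto_of_le_of_le' tendsto_const_nhds this
    (Eventually.of_forall fun _ => zero_le) ?_
  filter_upwards [eventually_initial hf.ae_slice, eventually_initial hg.ae_slice] with t h1 h2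
  have e : (fun x => f (x, t) - g (x, t) - (f₀ x - g₀ x)) =
      (fun x => f (x, t) - f₀ x) - fun x => g (x, t) - g₀ x := by
    ext x; simp only [Pi.sub_apply]; ring
  rw [e]
  exact eLpNorm_sub_le (h1.1.sub hf₀) (h2.1.sub hg₀) (by norm_num)

/-- Integration by parts in time of a primitive against a function vanishing for large times. -/
lemma integral_timePrim_mul_deriv {v θ θ' : AddCircle ℓ × ℝ → ℝ} {m m' : ℝ} (hm : 0 ≤ m)
    (hv : MemLp v 2 (weightedMeasure ℓ m)) (hm' : m + 2 + m' ≤ 0)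
    (hθ : MemLp θ 2 (weightedMeasure ℓ m')) (hθ' : MemLp θ' 2 (weightedMeasure ℓ m'))
    (hd : ∀ x t, HasDerivAt (fun s => θ (x, s)) (θ' (x, t)) t)
    (hc : ∀ x, Continuous fun s => θ' (x, s)) {T : ℝ} (hT : 0 < T)
    (hz : ∀ x t, T ≤ t → θ (x, t) = 0) :
    ∫ p, timePrim v p * θ' p ∂(cylMeasure ℓ) = -∫ p, v p * θ p ∂(cylMeasure ℓ) := by
  have hz' : ∀ x t, T < t → θ' (x, t) = 0 := by
    intro x t ht
    have h1 : (fun s => θ (x, s)) =ᶠ[𝓝 t] fun _ => 0 := by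
      filter_upwards [lt_mem_nhds ht] with s hs
      exact hz x s hs.le
    exact ((hd x t).congr_of_eventuallyEq h1.symm).unique (hasDerivAt_const t 0)
  rw [integral_cyl' ((hv.timePrim hm).integrable_mul_weighted hθ' hm'),
    integral_cyl' (hv.integrable_mul_weighted hθ (by linarith)), ← integral_neg]
  refine integral_congr_ae ?_
  filter_upwards [hv.ae_intervalIntegrable] with x hx
  have h1 : ContDiff ℝ 1 fun s => θ (x, s) := by
    rw [contDiff_one_iff_deriv]
    refine ⟨fun t => (hd x t).differentiableAt, ?_⟩
    rw [show deriv (fun s => θ (x, s)) = fun s => θ' (x, s) from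
      funext fun t => (hd x t).deriv]
    exact hc x
  have key := integral_primitive_mul_deriv (hx 0 T le_rfl hT.le)
    h1.contDiffOn.absolutelyContinuousOnInterval
  rw [hz x T le_rfl, mul_zero, zero_sub, intervalIntegral.integral_of_le hT.le,
    intervalIntegral.integral_of_le hT.le] at key
  have e1 : ∫ t in Ioi 0, timePrim v (x, t) * θ' (x, t) =
      ∫ t in Ioc 0 T, timePrim v (x, t) * θ' (x, t) := by
    refine (setIntegral_eq_of_subset_of_forall_sdiff_eq_zero measurableSet_Ioi
      (fun t ht => ht.1) fun t ht => ?_)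
    rw [hz' x t (not_le.1 fun h => ht.2 ⟨ht.1, h⟩), mul_zero]
  have e2 : ∫ t in Ioi 0, v (x, t) * θ (x, t) = ∫ t in Ioc 0 T, v (x, t) * θ (x, t) := by
    refine (setIntegral_eq_of_subset_of_forall_sdiff_eq_zero measurableSet_Ioi
      (fun t ht => ht.1) fun t ht => ?_)
    rw [hz x t (not_le.1 fun h => ht.2 ⟨ht.1, h⟩).le, mul_zero]
  rw [e1, e2, ← key]
  refine integral_congr_ae (Eventually.of_forall fun t => ?_)
  simp only [timePrim, (hd x t).deriv]

lemma exists_time_bound {φ : AddCircle ℓ × ℝ → ℝ} (hφ : HasCompactSupport φ) :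
    ∃ T, 0 < T ∧ ∀ x t, T ≤ t → φ (x, t) = 0 := by
  obtain ⟨T, hT⟩ := (hφ.image continuous_snd).bddAbove
  refine ⟨max T 0 + 1, by positivity, fun x t ht => ?_⟩
  by_contra h
  have := hT ⟨_, subset_tsupport _ h, rfl⟩
  have h2 := le_max_left T 0
  simp only at this
  linarith

lemma hasWeakDerivT_timePrim {v : AddCircle ℓ × ℝ → ℝ} {m : ℝ} (hm : 0 ≤ m)
    (hv : MemLp v 2 (weightedMeasure ℓ m)) : HasWeakDerivT 1 (timePrim v) v := by
  intro φ hφ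
  obtain ⟨T, hT, hz⟩ := exists_time_bound hφ.2.1
  rw [pow_one, neg_one_mul]
  exact integral_timePrim_mul_deriv hm hv (m' := -(m + 2)) (by linarith) (hφ.memLp _)
    (hφ.derivT.memLp _) hφ.hasDerivAt_derivT
    (fun x => hφ.derivT.continuous.comp (by fun_prop)) hT hz

lemma hasWeakDerivT_fst (g : AddCircle ℓ → ℝ) (hg : MemLp g 2 volume) :
    HasWeakDerivT 1 (fun p : AddCircle ℓ × ℝ => g p.1) (fun _ => 0) := by
  intro φ hφ
  rw [integral_cyl' ((hg.weighted_fst one_pos).integrable_mul_weighted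
    (hφ.derivT.memLp (-1)) (by norm_num))]
  simp only [zero_mul, integral_zero, mul_zero]
  refine integral_eq_zero_of_ae (Eventually.of_forall fun x => ?_)
  obtain ⟨T, hT, hz⟩ := exists_time_bound hφ.2.1
  obtain ⟨T', hT', hz'⟩ := exists_time_bound hφ.derivT.2.1
  simp only [integral_const_mul, Pi.zero_apply]
  have h0 : φ (x, 0) = 0 := image_eq_zero_of_notMem_tsupport fun h => lt_irrefl (0 : ℝ) (hφ.2.2 h).2
  have e1 : ∫ t in Ioi 0, derivT 1 φ (x, t) = ∫ t in Ioc 0 (max T T'), derivT 1 φ (x, t) := by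
    refine (setIntegral_eq_of_subset_of_forall_sdiff_eq_zero measurableSet_Ioi
      (fun t ht => ht.1) fun t ht => ?_)
    exact hz' x t ((le_max_right _ _).trans (not_le.1 fun h => ht.2 ⟨ht.1, h⟩).le)
  rw [e1, ← intervalIntegral.integral_of_le (hT.le.trans (le_max_left _ _)),
    intervalIntegral.integral_eq_sub_of_hasDerivAt (fun t _ => hφ.hasDerivAt_derivT x t)
      ((hφ.derivT.continuous.comp (by fun_prop : Continuous fun t : ℝ => (x, t))).intervalIntegrable
        _ _), h0, hz x _ (le_max_left _ _)]
  simp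

lemma HasWeakDerivT.add {f g f' g' : AddCircle ℓ × ℝ → ℝ} {m : ℝ}
    (hf : MemLp f 2 (weightedMeasure ℓ m)) (hg : MemLp g 2 (weightedMeasure ℓ m))
    (hf' : MemLp f' 2 (weightedMeasure ℓ m)) (hg' : MemLp g' 2 (weightedMeasure ℓ m))
    (h : HasWeakDerivT 1 f f') (h' : HasWeakDerivT 1 g g') :
    HasWeakDerivT 1 (fun p => f p + g p) (fun p => f' p + g' p) := by
  intro φ hφ
  have hd := hφ.derivT.memLp (-m)
  have hp := hφ.memLp (-m)
  simp only [add_mul]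
  rw [integral_add (hf.integrable_mul_weighted hd (by linarith))
    (hg.integrable_mul_weighted hd (by linarith)),
    integral_add (hf'.integrable_mul_weighted hp (by linarith))
    (hg'.integrable_mul_weighted hp (by linarith)), h φ hφ, h' φ hφ]
  ring

lemma HasWeakDerivT.neg {f f' : AddCircle ℓ × ℝ → ℝ} (h : HasWeakDerivT 1 f f') :
    HasWeakDerivT 1 (fun p => -f p) (fun p => -f' p) := by
  intro φ hφ
  simp only [neg_mul, integral_neg, h φ hφ]
  ring

/-! ### Functions with vanishing time derivative -/

lemma ae_cyl_eq_zero_of_ae_slice {D : AddCircle ℓ × ℝ → ℝ} {m : ℝ}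
    (hD : MemLp D 2 (weightedMeasure ℓ m))
    (h : ∀ᵐ t ∂timeMeasure, (fun x => D (x, t)) =ᵐ[volume] 0) : D =ᵐ[cylMeasure ℓ] 0 := by
  have hi := (memLp_weighted_iff_integrable.1 hD).2
  have h1 : ∫ p, Real.exp (-m * p.2) * D p ^ 2 ∂(cylMeasure ℓ) = 0 := by
    rw [integral_cyl hi]
    refine integral_eq_zero_of_ae ?_
    filter_upwards [h] with t ht
    refine integral_eq_zero_of_ae ?_
    filter_upwards [ht] with x hx
    simp [show D (x, t) = 0 from hx]
  rw [integral_eq_zero_iff_of_nonneg (fun p => by positivity) hi] at h1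
  filter_upwards [h1] with p hp
  simpa [(Real.exp_pos _).ne'] using hp

/-- A function orthogonal to all products of trigonometric functions and smooth functions of time
vanishes. -/
lemma ae_eq_zero_of_tensor {D : AddCircle ℓ × ℝ → ℝ} {m : ℝ}
    (hD : MemLp D 2 (weightedMeasure ℓ m))
    (h : ∀ i η, IsTimeTest η → ∫ p, D p * (trig i p.1 * η p.2) ∂(cylMeasure ℓ) = 0) :
    D =ᵐ[cylMeasure ℓ] 0 := by
  have key : ∀ i : Bool × ℤ, ∀ᵐ t ∂timeMeasure, ∫ x, D (x, t) * trig i x = 0 := fun i =>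
    ae_integral_slice_eq_zero (F := fun p => D p * trig i p.1)
      (integrable_exp_mul_tensor hD (memLp_trig i)) fun η hη => by
        rw [← h i η hη]
        congr 1; ext p; ring
  refine ae_cyl_eq_zero_of_ae_slice hD ?_
  filter_upwards [ae_all_iff.2 key, hD.ae_slice] with t h1 h2
  exact ae_eq_zero_of_integral_trig h2 h1

/-- The primitive of a smooth function of time that vanishes for large times; it is again compactly
supported in `(0, ∞)` if the integral is zero. -/
lemma IsTimeTest.exists_primitive {σ : ℝ → ℝ} (hσ : IsTimeTest σ) :
    ∃ Θ : ℝ → ℝ, (∀ t, HasDerivAt Θ (σ t) t) ∧ (∃ T, 0 < T ∧ ∀ t, T ≤ t → Θ t = 0) ∧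
      (∫ t, σ t = 0 → IsTimeTest Θ) := by
  have hc := hσ.1.continuous
  obtain ⟨T₀, hT₀⟩ := hσ.2.1.isCompact.bddAbove
  set T := max T₀ 1 with hTdef
  have hT : 0 < T := lt_of_lt_of_le one_pos (le_max_right _ _)
  have hz : ∀ t, T < t → σ t = 0 := fun t ht => image_eq_zero_of_notMem_tsupport fun h =>
    absurd (hT₀ h) (not_le.2 ((le_max_left _ _).trans_lt ht))
  have hd : ∀ t, HasDerivAt (fun t => ∫ s in T..t, σ s) (σ t) t := fun t =>
    intervalIntegral.integral_hasDerivAt_right (hc.intervalIntegrable _ _)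
      (hc.stronglyMeasurableAtFilter _ _) hc.continuousAt
  have hz2 : ∀ t, T ≤ t → ∫ s in T..t, σ s = 0 := fun t ht => by
    rw [intervalIntegral.integral_of_le ht]
    exact setIntegral_eq_zero_of_forall_eq_zero fun s hs => hz s hs.1
  refine ⟨fun t => ∫ s in T..t, σ s, hd, ⟨T, hT, hz2⟩, fun h0 => ?_⟩
  -- the support stays away from `t = 0`
  have hpos : ∃ δ, 0 < δ ∧ ∀ t, t < δ → σ t = 0 := by
    rcases (tsupport σ).eq_empty_or_nonempty with he | hne
    · exact ⟨1, one_pos, fun t _ => image_eq_zero_of_notMem_tsupport (by simp [he])⟩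
    · obtain ⟨δ, hδ⟩ := hσ.2.1.isCompact.exists_isLeast hne
      exact ⟨δ, hσ.2.2 hδ.1, fun t ht => image_eq_zero_of_notMem_tsupport fun h =>
        absurd (hδ.2 h) (not_le.2 ht)⟩
  obtain ⟨δ, hδ, hδz⟩ := hpos
  have hsupp : Function.support (fun t => ∫ s in T..t, σ s) ⊆ Icc δ T := by
    intro t ht
    by_contra hn
    rw [mem_Icc, not_and_or, not_le, not_le] at hn
    refine ht ?_
    rcases hn with hn | hn
    · simp only
      by_cases hle : T ≤ t
      · exact hz2 t hle
      rw [intervalIntegral.integral_symm, intervalIntegral.integral_of_le (not_le.1 hle).le,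
        setIntegral_eq_integral_of_forall_compl_eq_zero, h0, neg_zero]
      intro s hs
      rw [mem_Ioc, not_and_or, not_lt, not_le] at hs
      rcases hs with hs | hs
      · exact hδz s (hs.trans_lt hn)
      · exact hz s hs
    · exact hz2 t hn.le
  refine ⟨?_, HasCompactSupport.of_support_subset_isCompact isCompact_Icc hsupp,
    (closure_minimal hsupp isClosed_Icc).trans fun t ht => hδ.trans_le ht.1⟩
  rw [contDiff_infty_iff_deriv]
  refine ⟨fun t => (hd t).differentiableAt, ?_⟩
  rw [show deriv (fun t => ∫ s in T..t, σ s) = σ from funext fun t => (hd t).deriv]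
  exact hσ.1

/-- There is a smooth function of time with integral one. -/
lemma exists_isTimeTest_integral_one : ∃ σ, IsTimeTest σ ∧ ∫ t, σ t = 1 := by
  let b : ContDiffBump (2 : ℝ) := ⟨1 / 2, 1, by norm_num, by norm_num⟩
  refine ⟨b.normed volume, ⟨b.contDiff_normed, b.hasCompactSupport_normed, ?_⟩,
    b.integral_normed⟩
  rw [b.tsupport_normed_eq]
  intro t ht
  rw [Metric.mem_closedBall, Real.dist_eq] at ht
  have := (abs_le.1 ht).1
  rw [mem_Ioi]
  change -1 ≤ t - 2 at this
  linarith

lemma IsTimeTest.integrable {σ : ℝ → ℝ} (hσ : IsTimeTest σ) : Integrable σ :=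
  hσ.1.continuous.integrable_of_hasCompactSupport hσ.2.1

lemma IsTimeTest.setIntegral {σ : ℝ → ℝ} (hσ : IsTimeTest σ) :
    ∫ t in Ioi 0, σ t = ∫ t, σ t :=
  setIntegral_eq_integral_of_forall_compl_eq_zero fun _ ht =>
    image_eq_zero_of_notMem_tsupport fun h => ht (hσ.2.2 h)

lemma derivT_tensor {θ : AddCircle ℓ → ℝ} {Θ σ : ℝ → ℝ} (h : ∀ t, HasDerivAt Θ (σ t) t)
    (p : AddCircle ℓ × ℝ) :
    derivT 1 (fun p : AddCircle ℓ × ℝ => θ p.1 * Θ p.2) p = θ p.1 * σ p.2 := by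
  rw [derivT_one]
  exact ((h p.2).const_mul (θ p.1)).deriv

/-- A function with vanishing weak time derivative and vanishing initial value is zero. -/
lemma ae_eq_zero_of_hasWeakDerivT_zero {D : AddCircle ℓ × ℝ → ℝ} {m : ℝ}
    (hD : MemLp D 2 (weightedMeasure ℓ m)) (h : HasWeakDerivT 1 D fun _ => 0)
    (h0 : HasInitialValue D fun _ => 0) : D =ᵐ[cylMeasure ℓ] 0 := by
  obtain ⟨σ₀, hσ₀, hσ₀1⟩ := exists_isTimeTest_integral_one
  have hint : ∀ (i : Bool × ℤ) {η : ℝ → ℝ}, IsTimeTest η →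
      Integrable (fun p => D p * (trig i p.1 * η p.2)) (cylMeasure ℓ) := fun i η hη =>
    hD.integrable_mul_weighted ((hη.isTest (contDiff_trig i)).memLp (-m)) (by linarith)
  -- The pairing of `D` with `trig i ⊗ η` depends on `η` only through its integral.
  have hmean : ∀ (i : Bool × ℤ) {η : ℝ → ℝ}, IsTimeTest η →
      ∫ p, D p * (trig i p.1 * η p.2) ∂(cylMeasure ℓ) =
        (∫ t, η t) * ∫ p, D p * (trig i p.1 * σ₀ p.2) ∂(cylMeasure ℓ) := by
    intro i η hη
    have hτ : IsTimeTest fun t => η t - (∫ t, η t) * σ₀ t :=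
      ⟨hη.1.sub (contDiff_const.mul hσ₀.1), hη.2.1.sub hσ₀.2.1.mul_left,
        (tsupport_sub η _).trans (union_subset hη.2.2 (tsupport_mul_subset_right.trans hσ₀.2.2))⟩
    obtain ⟨Θ, hΘ, -, hΘ2⟩ := hτ.exists_primitive
    have hΘt := hΘ2 (by
      rw [integral_sub hη.integrable (hσ₀.integrable.const_mul _), integral_const_mul, hσ₀1]
      ring)
    have h1 := h _ (hΘt.isTest (contDiff_trig i))
    simp only [derivT_tensor hΘ, zero_mul, integral_zero, mul_zero] at h1
    have h2 : ∫ p, D p * (trig i p.1 * (η p.2 - (∫ t, η t) * σ₀ p.2)) ∂(cylMeasure ℓ) =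
        ∫ p, (D p * (trig i p.1 * η p.2) -
          (∫ t, η t) * (D p * (trig i p.1 * σ₀ p.2))) ∂(cylMeasure ℓ) := by
      congr 1; ext p; ring
    rw [h2, integral_sub (hint i hη) ((hint i hσ₀).const_mul _), integral_const_mul] at h1
    linarith
  have hl : (0 : ℝ) < ℓ := Fact.out
  -- Hence the Fourier coefficients of the slices do not depend on time.
  have key : ∀ i : Bool × ℤ, ∀ᵐ t ∂timeMeasure, ∫ x, D (x, t) * trig i x =
      ∫ p, D p * (trig i p.1 * σ₀ p.2) ∂(cylMeasure ℓ) := by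
    intro i
    set c := ∫ p, D p * (trig i p.1 * σ₀ p.2) ∂(cylMeasure ℓ) with hc
    have hcst : MemLp (fun _ : AddCircle ℓ => c / ℓ) 2 volume := memLp_const _
    have h1 := ae_integral_slice_eq_zero (F := fun p : AddCircle ℓ × ℝ =>
      D p * trig i p.1 - c / ℓ) (k := -(|m| + 1)) ?_ fun η hη => ?_
    · filter_upwards [h1, hD.ae_slice] with t ht h2
      rw [integral_sub (integrable_mul_continuous h2 (continuous_trig i)) (integrable_const _),
        integral_const, measureReal_def, AddCircle.measure_univ, ENNReal.toReal_ofReal hl.le,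
        smul_eq_mul, mul_div_cancel₀ _ hl.ne'] at ht
      linarith
    · have h2 := integrable_exp_mul_tensor hD (memLp_trig (ℓ := ℓ) i)
      have h3 : Integrable (fun p : AddCircle ℓ × ℝ => c / ℓ * Real.exp (-(|m| + 1) * p.2))
          (cylMeasure ℓ) := by
        rw [cylMeasure_eq_prod]
        exact Integrable.mul_prod (f := fun _ : AddCircle ℓ => c / ℓ) (integrable_const _)
          (integrable_exp_timeMeasure (by positivity))
      refine (h2.sub h3).congr (Eventually.of_forall fun p => ?_)
      simp only [Pi.sub_apply]; ring
    · have h3 : Integrable (fun p : AddCircle ℓ × ℝ => c / ℓ * η p.2) (cylMeasure ℓ) := by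
        rw [cylMeasure_eq_prod]
        exact Integrable.mul_prod (f := fun _ : AddCircle ℓ => c / ℓ) (integrable_const _)
          hη.integrable.restrict
      have h4 : ∫ p : AddCircle ℓ × ℝ, c / ℓ * η p.2 ∂(cylMeasure ℓ) = c * ∫ t, η t := by
        rw [integral_cyl' h3]
        simp only [integral_const_mul, hη.setIntegral]
        rw [integral_const, measureReal_def, AddCircle.measure_univ, ENNReal.toReal_ofReal hl.le,
          smul_eq_mul]
        field_simp
      have h5 : ∫ p, η p.2 * (D p * trig i p.1 - c / ℓ) ∂(cylMeasure ℓ) =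
          ∫ p, (D p * (trig i p.1 * η p.2) - c / ℓ * η p.2) ∂(cylMeasure ℓ) := by
        congr 1; ext p; ring
      rw [h5, integral_sub (hint i hη) h3, h4, hmean i hη]
      ring
  -- The constants vanish because of the initial value.
  have hzero : ∀ i : Bool × ℤ, ∫ p, D p * (trig i p.1 * σ₀ p.2) ∂(cylMeasure ℓ) = 0 := by
    intro i
    set c := ∫ p, D p * (trig i p.1 * σ₀ p.2) ∂(cylMeasure ℓ) with hc
    have h1 := ENNReal.Tendsto.mul_const (b := eLpNorm (trig (ℓ := ℓ) i) 2 volume) h0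
      (Or.inr (memLp_trig i).2.ne)
    rw [zero_mul] at h1
    have h2 : ∀ᶠ t in 𝓝[>] (0 : ℝ) ⊓ ae volume, ENNReal.ofReal |c| ≤
        eLpNorm (fun x => D (x, t) - 0) 2 volume * eLpNorm (trig (ℓ := ℓ) i) 2 volume := by
      filter_upwards [eventually_initial (key i), eventually_initial hD.ae_slice] with t h3 h4
      rw [hc, ← h3]
      simp only [sub_zero]
      calc ENNReal.ofReal |∫ x, D (x, t) * trig i x|
          ≤ eLpNorm (fun x => D (x, t) * trig i x) 1 volume := by
            rw [← Real.norm_eq_abs, ofReal_norm, eLpNorm_one_eq_lintegral_enorm]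
            exact enorm_integral_le_lintegral_enorm _
        _ ≤ _ := by
            have := eLpNorm_smul_le_mul_eLpNorm (p := 2) (q := 2) (r := 1) (memLp_trig i).1 h4.1
            exact this
    have h3 := ge_of_tendsto h1 h2
    have h4 : |c| ≤ 0 := by simpa using h3
    exact abs_nonpos_iff.1 h4
  refine ae_eq_zero_of_tensor hD fun i η hη => ?_
  rw [hmean i hη, hzero i, mul_zero]

/-- A function vanishing at the initial time is the primitive of its weak time derivative. -/
lemma ae_eq_timePrim {f g : AddCircle ℓ × ℝ → ℝ} {m : ℝ} (hm : 0 ≤ m)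
    (hf : MemLp f 2 (weightedMeasure ℓ m)) (hg : MemLp g 2 (weightedMeasure ℓ m))
    (h : HasWeakDerivT 1 f g) (h0 : HasInitialValue f fun _ => 0) :
    f =ᵐ[cylMeasure ℓ] timePrim g := by
  have hP := hg.timePrim hm
  have hf' := hf.weighted_mono (show m ≤ m + 2 by linarith)
  have hg' := hg.weighted_mono (show m ≤ m + 2 by linarith)
  have hD : MemLp (fun p => f p + -timePrim g p) 2 (weightedMeasure ℓ (m + 2)) := hf'.add hP.neg
  have h1 : HasWeakDerivT 1 (fun p => f p + -timePrim g p) (fun p => g p + -g p) :=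
    HasWeakDerivT.add (g := fun p => -timePrim g p) (g' := fun p => -g p) hf' hP.neg hg' hg'.neg h
      (hasWeakDerivT_timePrim hm hg).neg
  have h2 : HasInitialValue (timePrim g) fun _ => 0 := by
    have := hasInitialValue_add_timePrim hm hg fun _ => 0
    simpa only [zero_add] using this
  have h3 := h0.sub hf hP aestronglyMeasurable_const aestronglyMeasurable_const h2
  simp only [add_neg_cancel] at h1
  simp only [sub_eq_add_neg, neg_zero, add_zero] at h3
  filter_upwards [ae_eq_zero_of_hasWeakDerivT_zero hD h1 h3] with p hp
  exact add_neg_eq_zero.1 hp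

/-! ### Energy inequalities on the cylinder -/

/-- The energy inequality for a primitive in time: the reason why a large weight `m` makes the
problem coercive. -/
lemma energy_cyl {a v : AddCircle ℓ × ℝ → ℝ} {S lam M m : ℝ} (hm : 0 ≤ m) (hlam : 0 ≤ lam)
    (ham : AEStronglyMeasurable a (cylMeasure ℓ))
    (ha : ∀ x s t, 0 < s → 0 < t → |a (x, s) - a (x, t)| ≤ S * |s - t|)
    (hal : ∀ x t, 0 < t → lam ≤ a (x, t)) (haM : ∀ x t, 0 < t → |a (x, t)| ≤ M)
    (hv : MemLp v 2 (weightedMeasure ℓ m)) (hw : MemLp (timePrim v) 2 (weightedMeasure ℓ m)) :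
    (m * lam - S) / 2 * ∫ p, Real.exp (-m * p.2) * timePrim v p ^ 2 ∂(cylMeasure ℓ) ≤
      ∫ p, Real.exp (-m * p.2) * (a p * (timePrim v p * v p)) ∂(cylMeasure ℓ) := by
  have i1 := (memLp_weighted_iff_integrable.1 hw).2
  have i2 : Integrable (fun p => Real.exp (-m * p.2) * (a p * (timePrim v p * v p)))
      (cylMeasure ℓ) := by
    have h1 := hw.bdd_mul_weighted ham (M := M)
      (ae_cyl_pos.mono fun p hp => haM p.1 p.2 hp)
    have h2 := (memLp_weighted_iff.1 h1).integrable_mul (p := 2) (q := 2)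
      (memLp_weighted_iff.1 hv)
    refine h2.congr (Eventually.of_forall fun p => ?_)
    simp only [Pi.mul_apply]
    rw [mul_mul_mul_comm, ← Real.exp_add]
    ring_nf
  rw [integral_cyl' i1, integral_cyl' i2, ← integral_const_mul]
  have j1 := i1
  have j2 := i2
  rw [cylMeasure_eq_prod] at j1 j2
  refine integral_mono_ae (j1.integral_prod_left.const_mul _) j2.integral_prod_left ?_
  filter_upwards [hv.ae_intervalIntegrable, j1.prod_right_ae, j2.prod_right_ae] with x hx h1 h2
  have t1 := (intervalIntegral_tendsto_integral_Ioi 0 h1 tendsto_id).const_mul ((m * lam - S) / 2)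
  have t2 := intervalIntegral_tendsto_integral_Ioi 0 h2 tendsto_id
  refine le_of_tendsto_of_tendsto t1 t2 ?_
  filter_upwards [eventually_gt_atTop 0] with T hT
  exact energy_interval (a := fun t => a (x, t)) (f := fun t => v (x, t)) hT hm hlam
    (ha x) (hal x) (hx 0 T le_rfl hT.le)

/-! ### Lions' projection lemma -/

section Lions

variable {V H : Type*} [AddCommGroup V] [Module ℝ V] [NormedAddCommGroup H]
  [InnerProductSpace ℝ H] [CompleteSpace H]

/-- A linear functional bounded in terms of a linear map into a Hilbert space is represented by an
element of that space. -/
lemma exists_inner_eq_of_bound (A : V →ₗ[ℝ] H) (L : V →ₗ[ℝ] ℝ) (C : ℝ)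
    (h : ∀ v, |L v| ≤ C * ‖A v‖) : ∃ U : H, ∀ v, inner ℝ U (A v) = L v := by
  have hker : LinearMap.ker A ≤ LinearMap.ker L := fun v hv => by
    have := h v
    rw [LinearMap.mem_ker.1 hv, norm_zero, mul_zero] at this
    exact abs_nonpos_iff.1 this
  let f : LinearMap.range A →ₗ[ℝ] ℝ :=
    ((LinearMap.ker A).liftQ L hker).comp A.quotKerEquivRange.symm.toLinearMap
  have hf : ∀ v, f (A.rangeRestrict v) = L v := fun v => by
    have : A.quotKerEquivRange.symm (A.rangeRestrict v) = (LinearMap.ker A).mkQ v := by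
      rw [LinearEquiv.symm_apply_eq]; rfl
    simp only [f, LinearMap.comp_apply, LinearEquiv.coe_coe, this, Submodule.mkQ_apply,
      Submodule.liftQ_apply]
  let F : StrongDual ℝ (LinearMap.range A) := f.mkContinuous C (by
    rintro ⟨_, v, rfl⟩
    exact (congrArg (‖·‖) (hf v)).trans_le (h v))
  obtain ⟨g, hg, -⟩ := _root_.exists_extension_norm_eq (LinearMap.range A) F
  refine ⟨(InnerProductSpace.toDual ℝ H).symm g, fun v => ?_⟩
  rw [InnerProductSpace.toDual_symm_apply, ← hf v]
  exact hg (A.rangeRestrict v)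

/-- Lions' projection lemma: the equation `⟪U, A v⟫ = L v` for all `v` is solvable in the closure
of the range of `i` if the bilinear form `⟪i v, A w⟫` is coercive for the norm of `i v`. -/
lemma exists_inner_eq_of_coercive (i A : V →ₗ[ℝ] H) (L : V →ₗ[ℝ] ℝ) {c C : ℝ} (hc : 0 < c)
    (hco : ∀ v, c * ‖i v‖ ^ 2 ≤ inner ℝ (i v) (A v)) (hL : ∀ v, |L v| ≤ C * ‖i v‖) :
    ∃ U : H, (∀ v, inner ℝ U (A v) = L v) ∧
      ∀ Z : H, (∀ v, inner ℝ Z (i v) = 0) → inner ℝ Z U = 0 := by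
  let K : Submodule ℝ H := (LinearMap.range i).topologicalClosure
  have : CompleteSpace K := (LinearMap.range i).isClosed_topologicalClosure.completeSpace_coe
  have hiK : ∀ v, i v ∈ K := fun v =>
    (LinearMap.range i).le_topologicalClosure (LinearMap.mem_range_self i v)
  have hbound : ∀ v, c * ‖i v‖ ≤ ‖K.starProjection (A v)‖ := fun v => by
    rcases (norm_nonneg (i v)).eq_or_lt with h0 | h0
    · rw [← h0, mul_zero]; positivity
    have h1 : inner ℝ (i v) (A v) = inner ℝ (i v) (K.starProjection (A v)) := by
      rw [← Submodule.inner_starProjection_left_eq_right,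
        Submodule.starProjection_eq_self_iff.2 (hiK v)]
    have h2 := (hco v).trans (h1.le.trans (real_inner_le_norm _ _))
    nlinarith
  obtain ⟨U, hU⟩ := exists_inner_eq_of_bound (K.starProjection.toLinearMap.comp A) L (|C| / c)
    fun v => by
      refine (hL v).trans ?_
      have h1 := hbound v
      have h2 : |C| / c * (c * ‖i v‖) = |C| * ‖i v‖ := by field_simp
      calc C * ‖i v‖ ≤ |C| * ‖i v‖ := by gcongr; exact le_abs_self C
        _ ≤ _ := by rw [← h2]; gcongr; exact h1
  refine ⟨K.starProjection U, fun v => ?_, fun Z hZ => ?_⟩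
  · rw [Submodule.inner_starProjection_left_eq_right]
    exact hU v
  · have hmem : K.starProjection U ∈ K := Submodule.starProjection_apply_mem K U
    have hle : K ≤ LinearMap.ker (innerSL ℝ Z).toLinearMap := by
      refine Submodule.topologicalClosure_minimal _ ?_ (innerSL ℝ Z).isClosed_ker
      rintro _ ⟨v, rfl⟩
      exact hZ v
    exact hle hmem

end Lions

/-! ### Triples of weighted square integrable functions -/

lemma integral_weighted (m : ℝ) (f : AddCircle ℓ × ℝ → ℝ) :
    ∫ p, f p ∂(weightedMeasure ℓ m) = ∫ p, Real.exp (-m * p.2) * f p ∂(cylMeasure ℓ) := by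
  have hm : Measurable fun p : AddCircle ℓ × ℝ => (Real.exp (-m * p.2)).toNNReal :=
    (measurable_expWeight (-m)).real_toNNReal
  rw [weightedMeasure_eq, integral_withDensity_eq_integral_smul hm]
  simp [NNReal.smul_def, Real.coe_toNNReal _ (Real.exp_pos _).le]

/-- The Hilbert space in which a function, its space derivative and its time derivative live. -/
abbrev Triple (ℓ : ℝ) [Fact (0 < ℓ)] (m : ℝ) : Type :=
  PiLp 2 fun _ : Fin 3 => Lp ℝ 2 (weightedMeasure ℓ m)

/-- The element of `Triple ℓ m` given by three functions. -/
def toTriple {m : ℝ} (F : Fin 3 → AddCircle ℓ × ℝ → ℝ)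
    (hF : ∀ j, MemLp (F j) 2 (weightedMeasure ℓ m)) : Triple ℓ m :=
  WithLp.toLp 2 fun j => (hF j).toLp (F j)

lemma inner_toTriple {m : ℝ} (F : Fin 3 → AddCircle ℓ × ℝ → ℝ)
    (hF : ∀ j, MemLp (F j) 2 (weightedMeasure ℓ m)) (U : Triple ℓ m) :
    inner ℝ (toTriple F hF) U = ∑ j, ∫ p, F j p * U j p ∂(weightedMeasure ℓ m) := by
  rw [PiLp.inner_apply]
  refine Finset.sum_congr rfl fun j _ => ?_
  rw [L2.inner_def]
  refine integral_congr_ae ?_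
  filter_upwards [(hF j).coeFn_toLp] with p hp
  rw [show (toTriple F hF) j p = F j p from hp]
  simp [mul_comm]

lemma inner_toTriple_toTriple {m : ℝ} (F G : Fin 3 → AddCircle ℓ × ℝ → ℝ)
    (hF : ∀ j, MemLp (F j) 2 (weightedMeasure ℓ m))
    (hG : ∀ j, MemLp (G j) 2 (weightedMeasure ℓ m)) :
    inner ℝ (toTriple F hF) (toTriple G hG) =
      ∑ j, ∫ p, F j p * G j p ∂(weightedMeasure ℓ m) := by
  rw [inner_toTriple]
  refine Finset.sum_congr rfl fun j _ => integral_congr_ae ?_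
  filter_upwards [(hG j).coeFn_toLp] with p hp
  rw [show (toTriple G hG) j p = G j p from hp]

/-- A linear family of triples of functions, as a linear map into `Triple ℓ m`. -/
def toTripleLin {V : Type*} [AddCommGroup V] [Module ℝ V] {m : ℝ}
    (Φ : V →ₗ[ℝ] Fin 3 → AddCircle ℓ × ℝ → ℝ)
    (hΦ : ∀ v j, MemLp (Φ v j) 2 (weightedMeasure ℓ m)) : V →ₗ[ℝ] Triple ℓ m where
  toFun v := toTriple (Φ v) (hΦ v)
  map_add' v w := by
    ext1 j
    change (hΦ (v + w) j).toLp _ = (hΦ v j).toLp _ + (hΦ w j).toLp _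
    rw [← MemLp.toLp_add]
    congr 1
    simp
  map_smul' r v := by
    ext1 j
    change (hΦ (r • v) j).toLp _ = r • (hΦ v j).toLp _
    rw [← MemLp.toLp_const_smul]
    congr 1
    simp

lemma abs_integral_mul_le_norm {α : Type*} [MeasurableSpace α] {μ : Measure α} {f g : α → ℝ}
    (hf : MemLp f 2 μ) (hg : MemLp g 2 μ) :
    |∫ p, f p * g p ∂μ| ≤ ‖hf.toLp f‖ * ‖hg.toLp g‖ := by
  have h := abs_real_inner_le_norm (hf.toLp f) (hg.toLp g)
  rw [L2.inner_def] at h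
  convert! h using 2
  refine integral_congr_ae ?_
  filter_upwards [hf.coeFn_toLp, hg.coeFn_toLp] with p h1 h2
  rw [h1, h2]
  simp [mul_comm]

/-- Pairs `(ψ, ψₓ)` of continuous functions with compact support, with which the equation is tested;
`ψ` is the time derivative of `timePrim ψ`.  The second component is part of the data, since it is
only required to be the derivative of the first in the sense of `CircleDeriv`. -/
def testPairs (ℓ : ℝ) [Fact (0 < ℓ)] :
    Submodule ℝ ((AddCircle ℓ × ℝ → ℝ) × (AddCircle ℓ × ℝ → ℝ)) where
  carrier := {q | (Continuous q.1 ∧ HasCompactSupport q.1) ∧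
    (Continuous q.2 ∧ HasCompactSupport q.2) ∧
    ∀ t, CircleDeriv (fun x => q.1 (x, t)) (fun x => q.2 (x, t))}
  add_mem' := by
    rintro q r ⟨⟨h1, h2⟩, ⟨h3, h4⟩, h5⟩ ⟨⟨k1, k2⟩, ⟨k3, k4⟩, k5⟩
    refine ⟨⟨h1.add k1, h2.add k2⟩, ⟨h3.add k3, h4.add k4⟩, fun t i => ?_⟩
    have c1 := continuous_trig (ℓ := ℓ) i
    have c2 := continuous_trigDeriv (ℓ := ℓ) i
    simp only [Prod.fst_add, Prod.snd_add, Pi.add_apply, add_mul]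
    rw [integral_add (circle_integrable (by fun_prop)) (circle_integrable (by fun_prop)),
      integral_add (circle_integrable (by fun_prop)) (circle_integrable (by fun_prop)),
      h5 t i, k5 t i]
    ring
  zero_mem' := by
    refine ⟨⟨continuous_const, HasCompactSupport.zero⟩,
      ⟨continuous_const, HasCompactSupport.zero⟩, fun t i => ?_⟩
    simp
  smul_mem' := by
    rintro r q ⟨⟨h1, h2⟩, ⟨h3, h4⟩, h5⟩
    refine ⟨⟨h1.const_smul r, h2.smul_left (f := fun _ => r)⟩,
      ⟨h3.const_smul r, h4.smul_left (f := fun _ => r)⟩, fun t i => ?_⟩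
    simp only [Prod.smul_fst, Prod.smul_snd, Pi.smul_apply, smul_eq_mul, mul_assoc,
      integral_const_mul]
    rw [h5 t i]
    ring

lemma testPairs_memLp_fst (q : testPairs ℓ) (m : ℝ) : MemLp q.1.1 2 (weightedMeasure ℓ m) :=
  MemLp.weighted_of_continuous q.2.1.1 q.2.1.2 m

lemma testPairs_memLp_snd (q : testPairs ℓ) (m : ℝ) : MemLp q.1.2 2 (weightedMeasure ℓ m) :=
  MemLp.weighted_of_continuous q.2.2.1.1 q.2.2.1.2 m

lemma memLp_timePrim_fst (q : testPairs ℓ) {m : ℝ} (hm : 2 ≤ m) :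
    MemLp (timePrim q.1.1) 2 (weightedMeasure ℓ m) :=
  ((testPairs_memLp_fst q 0).timePrim le_rfl).weighted_mono (by linarith)

lemma memLp_timePrim_snd (q : testPairs ℓ) {m : ℝ} (hm : 2 ≤ m) :
    MemLp (timePrim q.1.2) 2 (weightedMeasure ℓ m) :=
  ((testPairs_memLp_snd q 0).timePrim le_rfl).weighted_mono (by linarith)

lemma timePrim_add {f g : AddCircle ℓ × ℝ → ℝ} (hf : Continuous f) (hg : Continuous g) :
    timePrim (f + g) = timePrim f + timePrim g := by
  ext p
  exact intervalIntegral.integral_add (Continuous.intervalIntegrable (by fun_prop) _ _)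
    (Continuous.intervalIntegrable (by fun_prop) _ _)

lemma timePrim_smul (r : ℝ) (f : AddCircle ℓ × ℝ → ℝ) : timePrim (r • f) = r • timePrim f := by
  ext p
  exact intervalIntegral.integral_smul r _

lemma mem_testPairs_tensor (i : Bool × ℤ) {η : ℝ → ℝ} (hη : IsTimeTest η) :
    ((fun p => trig i p.1 * η p.2, fun p => trigDeriv i p.1 * η p.2) :
      (AddCircle ℓ × ℝ → ℝ) × (AddCircle ℓ × ℝ → ℝ)) ∈ testPairs ℓ := by
  have h := hη.isTest (contDiff_trig (ℓ := ℓ) i)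
  have e : derivX 1 (fun p : AddCircle ℓ × ℝ => trig i p.1 * η p.2) =
      fun p => trigDeriv i p.1 * η p.2 := funext fun p => derivX_tensor_trig i η p
  refine ⟨⟨h.continuous, h.2.1⟩, ⟨e ▸ h.derivX.continuous, e ▸ h.derivX.2.1⟩, fun t => ?_⟩
  have := h.circleDeriv t
  rwa [e] at this

/-! ### Coercivity -/

/-- `IsParabolic` with named constants. -/
structure IsParabolicWith (a b c : AddCircle ℓ × ℝ → ℝ) (M S lam : ℝ) : Prop where
  meas_a : AEStronglyMeasurable a (cylMeasure ℓ)
  meas_b : AEStronglyMeasurable b (cylMeasure ℓ)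
  meas_c : AEStronglyMeasurable c (cylMeasure ℓ)
  bound_a : ∀ x t, 0 < t → |a (x, t)| ≤ M
  bound_b : ∀ x t, 0 < t → |b (x, t)| ≤ M
  bound_c : ∀ x t, 0 < t → |c (x, t)| ≤ M
  lam_pos : 0 < lam
  elliptic : ∀ x t, 0 < t → lam ≤ a (x, t)
  lipschitz : ∀ x s t, 0 < s → 0 < t → |a (x, s) - a (x, t)| ≤ S * |s - t|

lemma IsParabolic.exists_constants {a b c : AddCircle ℓ × ℝ → ℝ} (h : IsParabolic a b c) :
    ∃ M S lam, IsParabolicWith a b c M S lam := by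
  obtain ⟨M, hM⟩ := h.bounded
  obtain ⟨lam, hlam, hell⟩ := h.elliptic
  obtain ⟨S, hS⟩ := h.lipschitz_time
  exact ⟨M, S, lam, h.meas_a, h.meas_b, h.meas_c, fun x t ht => (hM x t ht).1,
    fun x t ht => (hM x t ht).2.1, fun x t ht => (hM x t ht).2.2, hlam, hell, hS⟩

section

variable {a b c : AddCircle ℓ × ℝ → ℝ} {M S lam : ℝ}

lemma IsParabolicWith.M_nonneg (h : IsParabolicWith a b c M S lam) : 0 ≤ M :=
  (abs_nonneg _).trans (h.bound_a 0 1 one_pos)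

lemma IsParabolicWith.S_nonneg (h : IsParabolicWith a b c M S lam) : 0 ≤ S :=
  lipschitz_const_nonneg (h.lipschitz 0)

lemma IsParabolicWith.a_mul (h : IsParabolicWith a b c M S lam) {f : AddCircle ℓ × ℝ → ℝ} {m : ℝ}
    (hf : MemLp f 2 (weightedMeasure ℓ m)) : MemLp (fun p => a p * f p) 2 (weightedMeasure ℓ m) :=
  hf.bdd_mul_weighted h.meas_a (ae_cyl_pos.mono fun p hp => h.bound_a p.1 p.2 hp)

lemma IsParabolicWith.b_mul (h : IsParabolicWith a b c M S lam) {f : AddCircle ℓ × ℝ → ℝ} {m : ℝ}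
    (hf : MemLp f 2 (weightedMeasure ℓ m)) : MemLp (fun p => b p * f p) 2 (weightedMeasure ℓ m) :=
  hf.bdd_mul_weighted h.meas_b (ae_cyl_pos.mono fun p hp => h.bound_b p.1 p.2 hp)

lemma IsParabolicWith.c_mul (h : IsParabolicWith a b c M S lam) {f : AddCircle ℓ × ℝ → ℝ} {m : ℝ}
    (hf : MemLp f 2 (weightedMeasure ℓ m)) : MemLp (fun p => c p * f p) 2 (weightedMeasure ℓ m) :=
  hf.bdd_mul_weighted h.meas_c (ae_cyl_pos.mono fun p hp => h.bound_c p.1 p.2 hp)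

lemma integrable_exp_mul {f g : AddCircle ℓ × ℝ → ℝ} {m : ℝ}
    (hf : MemLp f 2 (weightedMeasure ℓ m)) (hg : MemLp g 2 (weightedMeasure ℓ m)) :
    Integrable (fun p => Real.exp (-m * p.2) * (f p * g p)) (cylMeasure ℓ) := by
  have h1 : MemLp (fun p => Real.exp (-m * p.2) * g p) 2 (weightedMeasure ℓ (-m)) := by
    rw [memLp_expWeight_mul_iff]
    convert! hg using 2
    ring
  refine (hf.integrable_mul_weighted h1 (by linarith)).congr (Eventually.of_forall fun p => ?_)
  simp only; ring

/-- The energy inequality with constant coefficient. -/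
lemma energy_timePrim {v : AddCircle ℓ × ℝ → ℝ} {m : ℝ} (hm : 0 ≤ m)
    (hv : MemLp v 2 (weightedMeasure ℓ m)) (hw : MemLp (timePrim v) 2 (weightedMeasure ℓ m)) :
    m / 2 * ∫ p, Real.exp (-m * p.2) * timePrim v p ^ 2 ∂(cylMeasure ℓ) ≤
      ∫ p, Real.exp (-m * p.2) * (timePrim v p * v p) ∂(cylMeasure ℓ) := by
  have := energy_cyl (a := fun _ => 1) (S := 0) (lam := 1) (M := 1) hm zero_le_one
    aestronglyMeasurable_const (by simp) (by simp) (by simp) hv hw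
  simpa using this

/-- Coercivity of the bilinear form for large weights, where `ψ` stands for `φₜ`, `χ` for `φₓₜ`, and
their primitives in time for `φ` and `φₓ`. -/
lemma IsParabolicWith.coercive (h : IsParabolicWith a b c M S lam) {m : ℝ}
    (hm1 : 4 * M + 2 ≤ m) (hm2 : S + 2 * M ^ 2 + 1 ≤ m * lam) {ψ χ : AddCircle ℓ × ℝ → ℝ}
    (hψ : MemLp ψ 2 (weightedMeasure ℓ m)) (hχ : MemLp χ 2 (weightedMeasure ℓ m))
    (hPψ : MemLp (timePrim ψ) 2 (weightedMeasure ℓ m))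
    (hPχ : MemLp (timePrim χ) 2 (weightedMeasure ℓ m)) :
    1 / 4 * (∫ p, Real.exp (-m * p.2) * (timePrim ψ p * timePrim ψ p) ∂(cylMeasure ℓ) +
        ∫ p, Real.exp (-m * p.2) * (timePrim χ p * timePrim χ p) ∂(cylMeasure ℓ) +
        ∫ p, Real.exp (-m * p.2) * (ψ p * ψ p) ∂(cylMeasure ℓ)) ≤
      ∫ p, Real.exp (-m * p.2) * (timePrim ψ p * (c p * ψ p)) ∂(cylMeasure ℓ) +
      ∫ p, Real.exp (-m * p.2) * (timePrim χ p * (a p * χ p + b p * ψ p)) ∂(cylMeasure ℓ) +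
      ∫ p, Real.exp (-m * p.2) * (ψ p * ψ p) ∂(cylMeasure ℓ) := by
  have hM := h.M_nonneg
  have hm : 0 < m := by linarith
  have E1 := energy_cyl hm.le h.lam_pos.le h.meas_a h.lipschitz h.elliptic h.bound_a hχ hPχ
  have E2 := energy_timePrim hm.le hψ hPψ
  have i0 := integrable_exp_mul hPψ hPψ
  have i1 := integrable_exp_mul hPχ hPχ
  have i2 := integrable_exp_mul hψ hψ
  have j0 := integrable_exp_mul hPψ (h.c_mul hψ)
  have j1 := integrable_exp_mul hPχ (h.a_mul hχ)
  have j2 := integrable_exp_mul hPχ (h.b_mul hψ)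
  have j3 := integrable_exp_mul hPψ hψ
  simp only [← mul_assoc] at E1 E2 i0 i1 i2 j0 j1 j2 j3 ⊢
  simp only [sq, ← mul_assoc] at E1 E2
  set I0 := ∫ p, Real.exp (-m * p.2) * timePrim ψ p * timePrim ψ p ∂(cylMeasure ℓ)
  set I1 := ∫ p, Real.exp (-m * p.2) * timePrim χ p * timePrim χ p ∂(cylMeasure ℓ)
  set I2 := ∫ p, Real.exp (-m * p.2) * ψ p * ψ p ∂(cylMeasure ℓ)
  have hI0 : 0 ≤ I0 := integral_nonneg fun p => by
    rw [Pi.zero_apply, mul_assoc]; exact mul_nonneg (Real.exp_pos _).le (mul_self_nonneg _)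
  have hI1 : 0 ≤ I1 := integral_nonneg fun p => by
    rw [Pi.zero_apply, mul_assoc]; exact mul_nonneg (Real.exp_pos _).le (mul_self_nonneg _)
  have e1 : ∫ p, Real.exp (-m * p.2) * timePrim χ p * (a p * χ p + b p * ψ p) ∂(cylMeasure ℓ) =
      ∫ p, Real.exp (-m * p.2) * timePrim χ p * a p * χ p ∂(cylMeasure ℓ) +
        ∫ p, Real.exp (-m * p.2) * timePrim χ p * b p * ψ p ∂(cylMeasure ℓ) := by
    rw [← integral_add j1 j2]
    congr 1; ext p; ring
  have e2 : ∫ p, Real.exp (-m * p.2) * a p * timePrim χ p * χ p ∂(cylMeasure ℓ) =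
      ∫ p, Real.exp (-m * p.2) * timePrim χ p * a p * χ p ∂(cylMeasure ℓ) := by
    congr 1; ext p; ring
  rw [e2] at E1
  -- the terms with `c` and `b`, by Young's inequality
  have B0 : -(M ^ 2 * I0 + 1 / 4 * I2) ≤
      ∫ p, Real.exp (-m * p.2) * timePrim ψ p * c p * ψ p ∂(cylMeasure ℓ) := by
    rw [← integral_const_mul, ← integral_const_mul,
      ← integral_add (i0.const_mul _) (i2.const_mul _), ← integral_neg]
    refine integral_mono_ae ((i0.const_mul _).add (i2.const_mul _)).neg j0 ?_
    filter_upwards [ae_cyl_pos] with p hp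
    have h1 := abs_le.1 (h.bound_c p.1 p.2 hp)
    have h2 : c p ^ 2 ≤ M ^ 2 := sq_le_sq' h1.1 h1.2
    have h3 : -(M ^ 2 * (timePrim ψ p) ^ 2 + 1 / 4 * ψ p ^ 2) ≤ timePrim ψ p * c p * ψ p := by
      nlinarith [sq_nonneg (timePrim ψ p * c p + ψ p / 2),
        mul_le_mul_of_nonneg_right h2 (sq_nonneg (timePrim ψ p))]
    have h4 := mul_le_mul_of_nonneg_left h3 (Real.exp_pos (-m * p.2)).le
    linarith
  have B1 : -(M ^ 2 * I1 + 1 / 4 * I2) ≤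
      ∫ p, Real.exp (-m * p.2) * timePrim χ p * b p * ψ p ∂(cylMeasure ℓ) := by
    rw [← integral_const_mul, ← integral_const_mul,
      ← integral_add (i1.const_mul _) (i2.const_mul _), ← integral_neg]
    refine integral_mono_ae ((i1.const_mul _).add (i2.const_mul _)).neg j2 ?_
    filter_upwards [ae_cyl_pos] with p hp
    have h1 := abs_le.1 (h.bound_b p.1 p.2 hp)
    have h2 : b p ^ 2 ≤ M ^ 2 := sq_le_sq' h1.1 h1.2
    have h3 : -(M ^ 2 * (timePrim χ p) ^ 2 + 1 / 4 * ψ p ^ 2) ≤ timePrim χ p * b p * ψ p := by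
      nlinarith [sq_nonneg (timePrim χ p * b p + ψ p / 2),
        mul_le_mul_of_nonneg_right h2 (sq_nonneg (timePrim χ p))]
    have h4 := mul_le_mul_of_nonneg_left h3 (Real.exp_pos (-m * p.2)).le
    linarith
  -- Poincaré's inequality in time: `m² / 4` times the energy of the primitive is controlled.
  have B2 : m ^ 2 / 4 * I0 ≤ I2 := by
    have h5 : ∫ p, Real.exp (-m * p.2) * timePrim ψ p * ψ p ∂(cylMeasure ℓ) ≤
        m / 4 * I0 + 1 / m * I2 := by
      rw [← integral_const_mul, ← integral_const_mul,
        ← integral_add (i0.const_mul _) (i2.const_mul _)]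
      refine integral_mono_ae j3 ((i0.const_mul _).add (i2.const_mul _))
        (Eventually.of_forall fun p => ?_)
      have h3 : timePrim ψ p * ψ p ≤ m / 4 * (timePrim ψ p) ^ 2 + 1 / m * ψ p ^ 2 := by
        have : 0 ≤ 1 / m * (m / 2 * timePrim ψ p - ψ p) ^ 2 := by positivity
        have e : 1 / m * (m / 2 * timePrim ψ p - ψ p) ^ 2 =
          m / 4 * (timePrim ψ p) ^ 2 + 1 / m * ψ p ^ 2 - timePrim ψ p * ψ p := by
          field_simp; ring
        linarith
      have h4 := mul_le_mul_of_nonneg_left h3 (Real.exp_pos (-m * p.2)).le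
      simp only
      linarith
    have h6 : m / 4 * I0 ≤ 1 / m * I2 := by linarith
    have h7 := mul_le_mul_of_nonneg_left h6 hm.le
    have e : m * (1 / m * I2) = I2 := by field_simp
    rw [e] at h7
    linarith
  rw [e1]
  have hI2 : 0 ≤ I2 := le_trans (by positivity) B2
  have K0 : (M ^ 2 + 1 / 4) * I0 ≤ m ^ 2 / 16 * I0 := by
    refine mul_le_mul_of_nonneg_right ?_ hI0
    nlinarith
  have K1 : (M ^ 2 + 1 / 4) * I1 ≤ (m * lam - S) / 2 * I1 := by
    refine mul_le_mul_of_nonneg_right ?_ hI1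
    linarith
  linarith

/-- The term of the functional which contains the derivative of the test function: it is bounded
after an integration by parts in time, because `a` is Lipschitz in time. -/
lemma IsParabolicWith.abs_integral_le (h : IsParabolicWith a b c M S lam) {m : ℝ} (hm : 2 ≤ m)
    {g : AddCircle ℓ → ℝ} (hg : MemLp g 2 volume) {χ : AddCircle ℓ × ℝ → ℝ} (hχ : Continuous χ)
    (hχc : HasCompactSupport χ) :
    |∫ p, Real.exp (-m * p.2) * (a p * g p.1 * χ p) ∂(cylMeasure ℓ)| ≤
      (m * M + S) * ∫ p, Real.exp (-m * p.2) * (|g p.1| * |timePrim χ p|) ∂(cylMeasure ℓ) := by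
  have hχm := MemLp.weighted_of_continuous hχ hχc
  have hP : MemLp (timePrim χ) 2 (weightedMeasure ℓ m) :=
    ((hχm 0).timePrim le_rfl).weighted_mono (by linarith)
  have hone : MemLp (fun _ : AddCircle ℓ => (1 : ℝ)) 2 volume := memLp_const _
  have hg' := hg.weighted_fst (m := m) (by linarith)
  have h1' := hone.weighted_fst (m := m) (by linarith)
  have i1 := integrable_exp_mul (h.a_mul hg') (hχm m)
  have i2 := integrable_exp_mul hg'.abs hP.abs
  have i3 := integrable_exp_mul h1' (h.a_mul (hχm m))
  have i4 := integrable_exp_mul h1' hP.abs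
  simp only [one_mul, Pi.abs_apply] at i2 i3 i4
  rw [integral_cyl' i1, integral_cyl' i2, ← integral_const_mul]
  refine (abs_integral_le_integral_abs).trans ?_
  rw [cylMeasure_eq_prod] at i1 i2 i3 i4
  refine integral_mono_ae i1.integral_prod_left.abs (i2.integral_prod_left.const_mul _) ?_
  obtain ⟨B, hB⟩ := hχ.bounded_above_of_compact_support hχc
  filter_upwards [(hχm m).ae_intervalIntegrable, i3.prod_right_ae, i4.prod_right_ae]
    with x hx h3 h4
  have key : |∫ t in Ioi 0, Real.exp (-m * t) * (a (x, t) * χ (x, t))| ≤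
      (m * M + S) * ∫ t in Ioi 0, Real.exp (-m * t) * |timePrim χ (x, t)| := by
    have t1 := (intervalIntegral_tendsto_integral_Ioi 0 h3 tendsto_id).abs
    have t2 := (intervalIntegral_tendsto_integral_Ioi 0 h4 tendsto_id).const_mul (m * M + S)
    have t3 : Tendsto (fun T : ℝ => Real.exp (-m * T) * M * |timePrim χ (x, T)|) atTop (𝓝 0) := by
      have h5 : Tendsto (fun T : ℝ => M * B * Real.exp (-T)) atTop (𝓝 0) := by
        simpa using (Real.tendsto_exp_neg_atTop_nhds_zero).const_mul (M * B)
      have hM := h.M_nonneg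
      refine squeeze_zero' (Eventually.of_forall fun T => by positivity) ?_ h5
      filter_upwards [eventually_ge_atTop 0] with T hT
      have hB0 : 0 ≤ B := (norm_nonneg _).trans (hB (x, 0))
      have h6 : |timePrim χ (x, T)| ≤ B * T := by
        have := intervalIntegral.norm_integral_le_of_norm_le_const (a := 0) (b := T)
          (f := fun s => χ (x, s)) (C := B) fun s _ => hB (x, s)
        rwa [sub_zero, abs_of_nonneg hT] at this
      have h7 : T * Real.exp (-m * T) ≤ Real.exp (-T) := by
        calc T * Real.exp (-m * T) ≤ Real.exp T * Real.exp (-2 * T) := by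
              gcongr
              · linarith [Real.add_one_le_exp T]
          _ = Real.exp (-T) := by rw [← Real.exp_add]; ring_nf
      calc Real.exp (-m * T) * M * |timePrim χ (x, T)| ≤ Real.exp (-m * T) * M * (B * T) := by
            gcongr
        _ = M * B * (T * Real.exp (-m * T)) := by ring
        _ ≤ _ := by gcongr
    have t4 := t3.add t2
    rw [zero_add] at t4
    refine le_of_tendsto_of_tendsto t1 t4 ?_
    filter_upwards [eventually_gt_atTop 0] with T hT
    exact abs_integral_le_primitive_interval (a := fun t => a (x, t)) (f := fun t => χ (x, t)) hT
      (by linarith) (h.lipschitz x) (h.bound_a x) (hx 0 T le_rfl hT.le)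
  have e1 : ∫ t in Ioi 0, Real.exp (-m * t) * (a (x, t) * g x * χ (x, t)) =
      g x * ∫ t in Ioi 0, Real.exp (-m * t) * (a (x, t) * χ (x, t)) := by
    rw [← integral_const_mul]
    congr 1; ext t; ring
  have e2 : ∫ t in Ioi 0, Real.exp (-m * t) * (|g x| * |timePrim χ (x, t)|) =
      |g x| * ∫ t in Ioi 0, Real.exp (-m * t) * |timePrim χ (x, t)| := by
    rw [← integral_const_mul]
    congr 1; ext t; ring
  rw [e1, e2, abs_mul, mul_left_comm]
  exact mul_le_mul_of_nonneg_left key (abs_nonneg _)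

end

/-! ### The variational problem -/

section

variable {a b c : AddCircle ℓ × ℝ → ℝ} {M S lam : ℝ}

/-- The triple `(φ, φₓ, φₜ)` for `φ` the time primitive of `ψ`, where `(ψ, ψₓ)` is a test pair. -/
def energyTriple (ℓ : ℝ) [Fact (0 < ℓ)] :
    testPairs ℓ →ₗ[ℝ] Fin 3 → AddCircle ℓ × ℝ → ℝ where
  toFun q := ![timePrim q.1.1, timePrim q.1.2, q.1.1]
  map_add' q r := by
    ext j : 1
    fin_cases j
    · exact timePrim_add q.2.1.1 r.2.1.1
    · exact timePrim_add q.2.2.1.1 r.2.2.1.1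
    · rfl
  map_smul' s q := by
    ext j : 1
    fin_cases j
    · exact timePrim_smul s _
    · exact timePrim_smul s _
    · rfl

/-- The triple `(c ψ, a ψₓ + b ψ, ψ)` for a test pair `(ψ, ψₓ)`: its inner product with `(w, wₓ,
wₜ)` is the weak form of the equation, tested with `ψ`. -/
def formTriple (a b c : AddCircle ℓ × ℝ → ℝ) :
    testPairs ℓ →ₗ[ℝ] Fin 3 → AddCircle ℓ × ℝ → ℝ where
  toFun q := ![fun p => c p * q.1.1 p, fun p => a p * q.1.2 p + b p * q.1.1 p, q.1.1]
  map_add' q r := by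
    ext j p
    fin_cases j
    · exact mul_add _ _ _
    · change a p * (q.1.2 p + r.1.2 p) + b p * (q.1.1 p + r.1.1 p) =
        (a p * q.1.2 p + b p * q.1.1 p) + (a p * r.1.2 p + b p * r.1.1 p)
      ring
    · rfl
  map_smul' s q := by
    ext j p
    fin_cases j
    · exact mul_left_comm _ _ _
    · change a p * (s * q.1.2 p) + b p * (s * q.1.1 p) = s * (a p * q.1.2 p + b p * q.1.1 p)
      ring
    · rfl

/-- The triple `(ψ, ψₓ, 0)` of a test pair. -/
def pairTriple (ℓ : ℝ) [Fact (0 < ℓ)] :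
    testPairs ℓ →ₗ[ℝ] Fin 3 → AddCircle ℓ × ℝ → ℝ where
  toFun q := ![q.1.1, q.1.2, 0]
  map_add' q r := by
    ext j p
    fin_cases j
    · rfl
    · rfl
    · exact (add_zero 0).symm
  map_smul' s q := by
    ext j p
    fin_cases j
    · rfl
    · rfl
    · exact (mul_zero s).symm

lemma memLp_energyTriple {m : ℝ} (hm : 2 ≤ m) (q : testPairs ℓ) (j : Fin 3) :
    MemLp (energyTriple ℓ q j) 2 (weightedMeasure ℓ m) := by
  fin_cases j
  · exact memLp_timePrim_fst q hm
  · exact memLp_timePrim_snd q hm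
  · exact testPairs_memLp_fst q m

lemma memLp_formTriple (h : IsParabolicWith a b c M S lam) (m : ℝ) (q : testPairs ℓ)
    (j : Fin 3) : MemLp (formTriple a b c q j) 2 (weightedMeasure ℓ m) := by
  fin_cases j
  · exact h.c_mul (testPairs_memLp_fst q m)
  · exact (h.a_mul (testPairs_memLp_snd q m)).add (h.b_mul (testPairs_memLp_fst q m))
  · exact testPairs_memLp_fst q m

lemma memLp_pairTriple (m : ℝ) (q : testPairs ℓ) (j : Fin 3) :
    MemLp (pairTriple ℓ q j) 2 (weightedMeasure ℓ m) := by
  fin_cases j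
  · exact testPairs_memLp_fst q m
  · exact testPairs_memLp_snd q m
  · exact MemLp.zero'

lemma integral_add_add {α : Type*} [MeasurableSpace α] {μ : Measure α} {f g h : α → ℝ}
    (hf : Integrable f μ) (hg : Integrable g μ) (hh : Integrable h μ) :
    ∫ p, (f p + g p + h p) ∂μ = ∫ p, f p ∂μ + ∫ p, g p ∂μ + ∫ p, h p ∂μ := by
  have := integral_add (hf.add hg) hh
  simp only [Pi.add_apply] at this
  rw [this, integral_add hf hg]

lemma exp_mul_cancel (m : ℝ) (p : AddCircle ℓ × ℝ) (r : ℝ) :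
    Real.exp (-m * p.2) * (Real.exp (m * p.2) * r) = r := by
  rw [← mul_assoc, ← Real.exp_add]
  simp

lemma norm_toTriple_apply_le {m : ℝ} (F : Fin 3 → AddCircle ℓ × ℝ → ℝ)
    (hF : ∀ j, MemLp (F j) 2 (weightedMeasure ℓ m)) (j : Fin 3) :
    ‖(hF j).toLp (F j)‖ ≤ ‖toTriple F hF‖ :=
  PiLp.norm_apply_le (toTriple F hF) j

lemma norm_toLp_abs {α : Type*} [MeasurableSpace α] {μ : Measure α} {f : α → ℝ}
    (hf : MemLp f 2 μ) : ‖hf.abs.toLp _‖ = ‖hf.toLp f‖ := by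
  rw [Lp.norm_toLp, Lp.norm_toLp]
  congr 1
  exact eLpNorm_norm f

/-- The right-hand side of the equation, with `g` for the derivative of the initial value, is
bounded in the norm for which the form is coercive. -/
lemma IsParabolicWith.abs_functional_le (h : IsParabolicWith a b c M S lam) {m : ℝ}
    (hm : 2 ≤ m) {k : AddCircle ℓ × ℝ → ℝ} (hk : MemLp k 2 (weightedMeasure ℓ m))
    {g : AddCircle ℓ → ℝ} (hg : MemLp g 2 volume) (q : testPairs ℓ) :
    |∫ p, k p * q.1.1 p ∂(weightedMeasure ℓ m) -
        ∫ p, a p * g p.1 * q.1.2 p ∂(weightedMeasure ℓ m)| ≤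
      (‖hk.toLp k‖ + (m * M + S) * ‖(hg.weighted_fst (m := m) (by linarith)).toLp _‖) *
        ‖toTriple _ (memLp_energyTriple hm q)‖ := by
  have hM := h.M_nonneg
  have hS := h.S_nonneg
  have hgm := hg.weighted_fst (m := m) (by linarith)
  have hP := memLp_timePrim_snd q hm
  have h1 := abs_integral_mul_le_norm hk (testPairs_memLp_fst q m)
  have h2 := h.abs_integral_le hm hg q.2.2.1.1 q.2.2.1.2
  have h3 := (le_abs_self _).trans (abs_integral_mul_le_norm hgm.abs hP.abs)
  rw [norm_toLp_abs hgm, norm_toLp_abs hP] at h3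
  rw [← integral_weighted, ← integral_weighted] at h2
  have n0 : ‖hP.toLp _‖ ≤ ‖toTriple _ (memLp_energyTriple hm q)‖ :=
    norm_toTriple_apply_le _ (memLp_energyTriple hm q) 1
  have n2 : ‖(testPairs_memLp_fst q m).toLp _‖ ≤ ‖toTriple _ (memLp_energyTriple hm q)‖ :=
    norm_toTriple_apply_le _ (memLp_energyTriple hm q) 2
  set N := ‖toTriple _ (memLp_energyTriple hm q)‖
  have hmM : 0 ≤ m * M + S := by positivity
  have h4 := h1.trans (mul_le_mul_of_nonneg_left n2 (norm_nonneg _))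
  have h5 := h2.trans (mul_le_mul_of_nonneg_left
    (h3.trans (mul_le_mul_of_nonneg_left n0 (norm_nonneg _))) hmM)
  refine (abs_sub _ _).trans ((add_le_add h4 h5).trans_eq ?_)
  ring

/-- The variational form of the equation, solved by Lions' projection lemma: `U 0` is the solution
with the initial value subtracted, `U 1` and `U 2` are its derivatives in space and time. The
second assertion says that `U` lies in the closure of the test triples: a triple `F` of functions
that annihilates all of them annihilates `U`. -/
lemma IsParabolicWith.exists_variational (h : IsParabolicWith a b c M S lam) {m : ℝ}
    (hm1 : 4 * M + 2 ≤ m) (hm2 : S + 2 * M ^ 2 + 1 ≤ m * lam) {k : AddCircle ℓ × ℝ → ℝ}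
    (hk : MemLp k 2 (weightedMeasure ℓ m)) {g : AddCircle ℓ → ℝ} (hg : MemLp g 2 volume) :
    ∃ U : Triple ℓ m,
      (∀ q : testPairs ℓ, ∫ p, Real.exp (-m * p.2) * (U 0 p * (c p * q.1.1 p) +
          U 1 p * (a p * q.1.2 p + b p * q.1.1 p) + U 2 p * q.1.1 p) ∂(cylMeasure ℓ) =
        ∫ p, Real.exp (-m * p.2) * (k p * q.1.1 p - a p * g p.1 * q.1.2 p) ∂(cylMeasure ℓ)) ∧
      ∀ F : Fin 3 → AddCircle ℓ × ℝ → ℝ, (∀ j, MemLp (F j) 2 (weightedMeasure ℓ (-m))) →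
        (∀ q : testPairs ℓ, ∫ p, (F 0 p * timePrim q.1.1 p + F 1 p * timePrim q.1.2 p +
          F 2 p * q.1.1 p) ∂(cylMeasure ℓ) = 0) →
        ∫ p, (F 0 p * U 0 p + F 1 p * U 1 p + F 2 p * U 2 p) ∂(cylMeasure ℓ) = 0 := by
  have hM := h.M_nonneg
  have hS := h.S_nonneg
  have hm : 2 ≤ m := by linarith
  have hgm := hg.weighted_fst (m := m) (by linarith)
  have hag := h.a_mul hgm
  let Z : Fin 3 → AddCircle ℓ × ℝ → ℝ := ![k, fun p => -(a p * g p.1), 0]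
  have hZ : ∀ j, MemLp (Z j) 2 (weightedMeasure ℓ m) := fun j => by
    fin_cases j
    · exact hk
    · exact hag.neg
    · exact MemLp.zero'
  let i := toTripleLin (energyTriple ℓ) (memLp_energyTriple hm)
  let A := toTripleLin (formTriple a b c) (memLp_formTriple h m)
  let L : testPairs ℓ →ₗ[ℝ] ℝ := (innerSL ℝ (toTriple Z hZ)).toLinearMap.comp
    (toTripleLin (pairTriple ℓ) (memLp_pairTriple m))
  have hLq : ∀ q, L q = ∫ p, k p * q.1.1 p ∂(weightedMeasure ℓ m) -
      ∫ p, a p * g p.1 * q.1.2 p ∂(weightedMeasure ℓ m) := fun q => by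
    change inner ℝ (toTriple Z hZ) (toTriple _ (memLp_pairTriple m q)) = _
    rw [inner_toTriple_toTriple, Fin.sum_univ_three]
    simp [Z, pairTriple, integral_neg, sub_eq_add_neg]
  have hco : ∀ q, 1 / 4 * ‖i q‖ ^ 2 ≤ inner ℝ (i q) (A q) := fun q => by
    change 1 / 4 * ‖toTriple _ (memLp_energyTriple hm q)‖ ^ 2 ≤
      inner ℝ (toTriple _ (memLp_energyTriple hm q)) (toTriple _ (memLp_formTriple h m q))
    rw [← real_inner_self_eq_norm_sq, inner_toTriple_toTriple, inner_toTriple_toTriple,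
      Fin.sum_univ_three, Fin.sum_univ_three]
    simp only [integral_weighted]
    exact h.coercive hm1 hm2 (testPairs_memLp_fst q m) (testPairs_memLp_snd q m)
      (memLp_timePrim_fst q hm) (memLp_timePrim_snd q hm)
  have hLb : ∀ q, |L q| ≤ (‖hk.toLp k‖ + (m * M + S) * ‖hgm.toLp _‖) * ‖i q‖ := fun q => by
    rw [hLq]
    exact h.abs_functional_le hm hk hg q
  obtain ⟨U, hU, hU2⟩ := exists_inner_eq_of_coercive i A L (by norm_num) hco hLb
  refine ⟨U, fun q => ?_, fun F hF hFq => ?_⟩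
  · have h1 := hU q
    rw [hLq, real_inner_comm] at h1
    change inner ℝ (toTriple _ (memLp_formTriple h m q)) U = _ at h1
    rw [inner_toTriple, Fin.sum_univ_three, integral_weighted, integral_weighted,
      integral_weighted, integral_weighted, integral_weighted] at h1
    have j0 := integrable_exp_mul (memLp_formTriple h m q 0) (Lp.memLp (U 0))
    have j1 := integrable_exp_mul (memLp_formTriple h m q 1) (Lp.memLp (U 1))
    have j2 := integrable_exp_mul (memLp_formTriple h m q 2) (Lp.memLp (U 2))
    have j3 := integrable_exp_mul hk (testPairs_memLp_fst q m)
    have j4 := integrable_exp_mul hag (testPairs_memLp_snd q m)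
    rw [← integral_add_add j0 j1 j2, ← integral_sub j3 j4] at h1
    convert! h1 using 1
    · congr 1; ext p
      simp [formTriple]; ring
    · congr 1; ext p; ring
  · let G : Fin 3 → AddCircle ℓ × ℝ → ℝ := fun j p => Real.exp (m * p.2) * F j p
    have hG : ∀ j, MemLp (G j) 2 (weightedMeasure ℓ m) := fun j => by
      rw [memLp_expWeight_mul_iff]
      convert! hF j using 2
      ring
    have h1 := hU2 (toTriple G hG) fun q => by
      change inner ℝ (toTriple G hG) (toTriple _ (memLp_energyTriple hm q)) = 0
      rw [inner_toTriple_toTriple, Fin.sum_univ_three, integral_weighted, integral_weighted,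
        integral_weighted]
      simp only [G, mul_assoc, exp_mul_cancel]
      have j0 := (hF 0).integrable_mul_weighted (memLp_energyTriple hm q 0) (by linarith)
      have j1 := (hF 1).integrable_mul_weighted (memLp_energyTriple hm q 1) (by linarith)
      have j2 := (hF 2).integrable_mul_weighted (memLp_energyTriple hm q 2) (by linarith)
      rw [← integral_add_add j0 j1 j2]
      exact hFq q
    rw [inner_toTriple, Fin.sum_univ_three, integral_weighted, integral_weighted,
      integral_weighted] at h1
    simp only [G, mul_assoc, exp_mul_cancel] at h1
    have j0 := (hF 0).integrable_mul_weighted (Lp.memLp (U 0)) (by linarith)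
    have j1 := (hF 1).integrable_mul_weighted (Lp.memLp (U 1)) (by linarith)
    have j2 := (hF 2).integrable_mul_weighted (Lp.memLp (U 2)) (by linarith)
    rwa [← integral_add_add j0 j1 j2] at h1

end

/-! ### The closure of the test triples -/

section

lemma circleDeriv_trig_mul (i : Bool × ℤ) (r : ℝ) :
    CircleDeriv (ℓ := ℓ) (fun x => trig i x * r) (fun x => trigDeriv i x * r) :=
  circleDeriv_of_hasDerivAt (fun x => (hasDerivAt_trig i x).mul_const r)
    ((continuous_trigDeriv i).mul continuous_const)

/-- A product with a continuous function of time vanishing for large times lies in all weighted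
spaces. -/
lemma memLp_tensor_of_eventually_zero {θ : AddCircle ℓ → ℝ} (hθ : MemLp θ 2 volume) {Θ : ℝ → ℝ}
    (hΘ : Continuous Θ) {T : ℝ} (hT : ∀ t, T ≤ t → Θ t = 0) (m : ℝ) :
    MemLp (fun p : AddCircle ℓ × ℝ => θ p.1 * Θ p.2) 2 (weightedMeasure ℓ m) := by
  refine hθ.weighted_tensor hΘ.aestronglyMeasurable ?_
  have h1 : IntegrableOn (fun t => Real.exp (-m * t) * Θ t ^ 2) (Icc 0 T) :=
    (Continuous.continuousOn (by fun_prop)).integrableOn_Icc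
  refine IntegrableOn.of_forall_sdiff_eq_zero h1 measurableSet_Ioi fun t ht => ?_
  have : T ≤ t := by
    by_contra! h
    exact ht.2 ⟨(mem_Ioi.1 ht.1).le, h.le⟩
  simp [hT t this]

lemma IsTimeTest.memLp_tensor {θ : AddCircle ℓ → ℝ} (hθ : MemLp θ 2 volume) {η : ℝ → ℝ}
    (hη : IsTimeTest η) (m : ℝ) :
    MemLp (fun p : AddCircle ℓ × ℝ => θ p.1 * η p.2) 2 (weightedMeasure ℓ m) :=
  hθ.weighted_tensor hη.1.continuous.aestronglyMeasurable
    ((Continuous.integrable_of_hasCompactSupport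
      (by have := hη.1.continuous; fun_prop)
      (by
        have h2 : HasCompactSupport fun t => η t ^ 2 := by
          simp only [pow_two]
          exact hη.2.1.mul_left (f := η)
        exact h2.mul_left (f := fun t => Real.exp (-m * t)))).integrableOn)

lemma integral_timePrim_mul_tensor {v : AddCircle ℓ × ℝ → ℝ} {m : ℝ} (hm : 0 ≤ m)
    (hv : MemLp v 2 (weightedMeasure ℓ m)) {θ : AddCircle ℓ → ℝ} (hθ : MemLp θ 2 volume)
    {σ Θ : ℝ → ℝ} (hσ : IsTimeTest σ) (hd : ∀ t, HasDerivAt Θ (σ t) t) {T : ℝ} (hT0 : 0 < T)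
    (hT : ∀ t, T ≤ t → Θ t = 0) :
    ∫ p, timePrim v p * (θ p.1 * σ p.2) ∂(cylMeasure ℓ) =
      -∫ p, v p * (θ p.1 * Θ p.2) ∂(cylMeasure ℓ) :=
  integral_timePrim_mul_deriv (θ := fun p => θ p.1 * Θ p.2)
    (θ' := fun p => θ p.1 * σ p.2) (m' := -(m + 2)) hm hv (by linarith)
    (memLp_tensor_of_eventually_zero hθ
      (continuous_iff_continuousAt.2 fun t => (hd t).continuousAt) hT _)
    (hσ.memLp_tensor hθ _) (fun x t => (hd t).const_mul (θ x))
    (fun x => (continuous_const.mul hσ.1.continuous : Continuous fun s => θ x * σ s)) hT0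
    fun x t ht => by simp [hT t ht]

/-- A triple `(w, wx, v)` in the closure of the test triples satisfies `w = ∫₀ᵗ v`. -/
lemma ae_eq_timePrim_of_closure {m : ℝ} (hm : 2 ≤ m) {w wx v : AddCircle ℓ × ℝ → ℝ}
    (hw : MemLp w 2 (weightedMeasure ℓ m)) (hv : MemLp v 2 (weightedMeasure ℓ m))
    (h : ∀ F : Fin 3 → AddCircle ℓ × ℝ → ℝ, (∀ j, MemLp (F j) 2 (weightedMeasure ℓ (-m))) →
        (∀ q : testPairs ℓ, ∫ p, (F 0 p * timePrim q.1.1 p + F 1 p * timePrim q.1.2 p +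
          F 2 p * q.1.1 p) ∂(cylMeasure ℓ) = 0) →
        ∫ p, (F 0 p * w p + F 1 p * wx p + F 2 p * v p) ∂(cylMeasure ℓ) = 0) :
    w =ᵐ[cylMeasure ℓ] timePrim v := by
  have hPv := hv.timePrim (by linarith)
  have hw2 := hw.weighted_mono (m' := m + 2) (by linarith)
  have key : (fun p => w p - timePrim v p) =ᵐ[cylMeasure ℓ] 0 := by
    refine ae_eq_zero_of_tensor (hw2.sub hPv) fun i σ hσ => ?_
    obtain ⟨Θ, hd, ⟨T, hT0, hT⟩, -⟩ := hσ.exists_primitive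
    have hΘ : Continuous Θ := continuous_iff_continuousAt.2 fun t => (hd t).continuousAt
    have m1 := fun k => hσ.memLp_tensor (memLp_trig (ℓ := ℓ) i) k
    have m2 := fun k => memLp_tensor_of_eventually_zero (memLp_trig (ℓ := ℓ) i) hΘ hT k
    have h1 := h ![fun p => trig i p.1 * σ p.2, 0, fun p => trig i p.1 * Θ p.2]
      (fun j => by
        fin_cases j
        · exact m1 _
        · exact MemLp.zero'
        · exact m2 _)
      (fun q => by
        have e := integral_timePrim_mul_tensor (m := 0) le_rfl (testPairs_memLp_fst q _)
          (memLp_trig i) hσ hd hT0 hT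
        have j1 := (memLp_timePrim_fst q hm).integrable_mul_weighted (m1 (-m)) (by linarith)
        have j2 := (testPairs_memLp_fst q 0).integrable_mul_weighted (m2 0) (by linarith)
        have e2 := integral_add j1 j2
        simp only [Matrix.cons_val_zero, Matrix.cons_val_one, Matrix.cons_val, Pi.zero_apply,
          zero_mul, add_zero]
        have c1 : ∀ p : AddCircle ℓ × ℝ, trig i p.1 * σ p.2 * timePrim q.1.1 p +
            trig i p.1 * Θ p.2 * q.1.1 p = timePrim q.1.1 p * (trig i p.1 * σ p.2) +
            q.1.1 p * (trig i p.1 * Θ p.2) := fun p => by ring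
        simp only [c1]
        linarith)
    have e := integral_timePrim_mul_tensor (by linarith) hv (memLp_trig i) hσ hd hT0 hT
    have j1 := (m1 (-m)).integrable_mul_weighted hw (by linarith)
    have j2 := (m2 (-m)).integrable_mul_weighted hv (by linarith)
    have j3 := hPv.integrable_mul_weighted (m1 (-(m + 2))) (by linarith)
    have j4 := hw.integrable_mul_weighted (m1 (-m)) (by linarith)
    have e2 := integral_add j1 j2
    have e3 := integral_sub j4 j3
    simp only [Matrix.cons_val_zero, Matrix.cons_val_one, Matrix.cons_val, Pi.zero_apply, zero_mul,
      add_zero] at h1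
    simp only [sub_mul]
    have c1 : ∀ p : AddCircle ℓ × ℝ, trig i p.1 * σ p.2 * w p = w p * (trig i p.1 * σ p.2) :=
      fun p => mul_comm _ _
    have c2 : ∀ p : AddCircle ℓ × ℝ, trig i p.1 * Θ p.2 * v p = v p * (trig i p.1 * Θ p.2) :=
      fun p => mul_comm _ _
    simp only [c1, c2] at h1 e2
    linarith
  filter_upwards [key] with p hp
  exact sub_eq_zero.1 hp

/-- A triple `(w, wx, v)` in the closure of the test triples satisfies `wx = ∂ₓ w`. -/
lemma ae_circleDeriv_of_closure {m : ℝ} (hm : 2 ≤ m) {w wx v : AddCircle ℓ × ℝ → ℝ}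
    (hw : MemLp w 2 (weightedMeasure ℓ m)) (hwx : MemLp wx 2 (weightedMeasure ℓ m))
    (h : ∀ F : Fin 3 → AddCircle ℓ × ℝ → ℝ, (∀ j, MemLp (F j) 2 (weightedMeasure ℓ (-m))) →
        (∀ q : testPairs ℓ, ∫ p, (F 0 p * timePrim q.1.1 p + F 1 p * timePrim q.1.2 p +
          F 2 p * q.1.1 p) ∂(cylMeasure ℓ) = 0) →
        ∫ p, (F 0 p * w p + F 1 p * wx p + F 2 p * v p) ∂(cylMeasure ℓ) = 0) :
    ∀ᵐ t ∂timeMeasure, CircleDeriv (fun x => w (x, t)) (fun x => wx (x, t)) := by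
  refine ae_circleDeriv_of_tensor hw hwx fun i σ hσ => ?_
  obtain ⟨Θ, hd, ⟨T, hT0, hT⟩, -⟩ := hσ.exists_primitive
  have hΘ : Continuous Θ := continuous_iff_continuousAt.2 fun t => (hd t).continuousAt
  have m1 := fun k => hσ.memLp_tensor (memLp_trig (ℓ := ℓ) i) k
  have m1' := fun k => hσ.memLp_tensor (memLp_trigDeriv (ℓ := ℓ) i) k
  have m2 := fun k => memLp_tensor_of_eventually_zero (memLp_trig (ℓ := ℓ) i) hΘ hT k
  have m2' := fun k => memLp_tensor_of_eventually_zero (memLp_trigDeriv (ℓ := ℓ) i) hΘ hT k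
  have h1 := h ![fun p => trigDeriv i p.1 * σ p.2, fun p => trig i p.1 * σ p.2, 0]
    (fun j => by
      fin_cases j
      · exact m1' _
      · exact m1 _
      · exact MemLp.zero')
    (fun q => by
      have e := integral_timePrim_mul_tensor (m := 0) le_rfl (testPairs_memLp_fst q _)
        (memLp_trigDeriv i) hσ hd hT0 hT
      have e' := integral_timePrim_mul_tensor (m := 0) le_rfl (testPairs_memLp_snd q _)
        (memLp_trig i) hσ hd hT0 hT
      have e2 := integral_mul_of_ae_circleDeriv (m := 0) (m' := 0) (testPairs_memLp_fst q _)
        (testPairs_memLp_snd q _) (m2 0) (m2' 0) (by simp)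
        (Eventually.of_forall q.2.2.2) (Eventually.of_forall fun t => circleDeriv_trig_mul i (Θ t))
      have j1 := (memLp_timePrim_fst q hm).integrable_mul_weighted (m1' (-m)) (by linarith)
      have j2 := (memLp_timePrim_snd q hm).integrable_mul_weighted (m1 (-m)) (by linarith)
      have e3 := integral_add j1 j2
      simp only [Matrix.cons_val_zero, Matrix.cons_val_one, Matrix.cons_val, Pi.zero_apply,
        zero_mul, add_zero]
      have c1 : ∀ p : AddCircle ℓ × ℝ, trigDeriv i p.1 * σ p.2 * timePrim q.1.1 p +
          trig i p.1 * σ p.2 * timePrim q.1.2 p = timePrim q.1.1 p * (trigDeriv i p.1 * σ p.2) +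
          timePrim q.1.2 p * (trig i p.1 * σ p.2) := fun p => by ring
      simp only [c1]
      linarith)
  have j1 := hw.integrable_mul_weighted (m1' (-m)) (by linarith)
  have j2 := hwx.integrable_mul_weighted (m1 (-m)) (by linarith)
  have e3 := integral_add j1 j2
  simp only [Matrix.cons_val_zero, Matrix.cons_val_one, Matrix.cons_val, Pi.zero_apply, zero_mul,
    add_zero] at h1
  have c1 : ∀ p : AddCircle ℓ × ℝ, trigDeriv i p.1 * σ p.2 * w p +
      trig i p.1 * σ p.2 * wx p = w p * (trigDeriv i p.1 * σ p.2) +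
      wx p * (trig i p.1 * σ p.2) := fun p => by ring
  simp only [c1] at h1
  linarith

variable {a b c : AddCircle ℓ × ℝ → ℝ} {M S lam : ℝ}

/-- The problem with the initial value subtracted: `timePrim v` vanishes at `t = 0`, and the flux
`a (g + wx)` has a derivative in space on almost all slices. -/
lemma IsParabolicWith.exists_timePrim_solution (h : IsParabolicWith a b c M S lam) {m : ℝ}
    (hm1 : 4 * M + 2 ≤ m) (hm2 : S + 2 * M ^ 2 + 1 ≤ m * lam) {k : AddCircle ℓ × ℝ → ℝ}
    (hk : MemLp k 2 (weightedMeasure ℓ m)) {g : AddCircle ℓ → ℝ} (hg : MemLp g 2 volume) :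
    ∃ wx v : AddCircle ℓ × ℝ → ℝ, MemLp (timePrim v) 2 (weightedMeasure ℓ m) ∧
      MemLp wx 2 (weightedMeasure ℓ m) ∧ MemLp v 2 (weightedMeasure ℓ m) ∧
      (∀ᵐ t ∂timeMeasure, CircleDeriv (fun x => timePrim v (x, t)) (fun x => wx (x, t))) ∧
      ∀ᵐ t ∂timeMeasure, CircleDeriv (fun x => a (x, t) * (g x + wx (x, t)))
        (fun x => v (x, t) + b (x, t) * wx (x, t) + c (x, t) * timePrim v (x, t) - k (x, t)) := by
  have hm : 2 ≤ m := by linarith [h.M_nonneg]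
  obtain ⟨U, hU, hcl⟩ := h.exists_variational hm1 hm2 hk hg
  have hU0 : MemLp (U 0) 2 (weightedMeasure ℓ m) := Lp.memLp (U 0)
  have hU1 : MemLp (U 1) 2 (weightedMeasure ℓ m) := Lp.memLp (U 1)
  have hU2 : MemLp (U 2) 2 (weightedMeasure ℓ m) := Lp.memLp (U 2)
  have hP : (U 0 : AddCircle ℓ × ℝ → ℝ) =ᵐ[cylMeasure ℓ] timePrim (U 2) :=
    ae_eq_timePrim_of_closure hm hU0 hU2 hcl
  have hPm : MemLp (timePrim (U 2)) 2 (weightedMeasure ℓ m) := by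
    refine (memLp_congr_ae ?_).1 hU0
    exact (withDensity_absolutelyContinuous _ _).ae_le hP
  refine ⟨U 1, U 2, hPm, hU1, hU2, ?_, ?_⟩
  · refine ae_circleDeriv_of_closure (v := U 2) hm hPm hU1 fun F hF hq => ?_
    rw [← hcl F hF hq]
    refine integral_congr_ae ?_
    filter_upwards [hP] with p hp
    rw [hp]
  · have hgm := hg.weighted_fst (m := m) (by linarith)
    refine ae_circleDeriv_of_tensor (f := fun p => a p * (g p.1 + U 1 p))
      (g := fun p => U 2 p + b p * U 1 p + c p * timePrim (U 2) p - k p)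
      (h.a_mul (hgm.add hU1)) (((hU2.add (h.b_mul hU1)).add (h.c_mul hPm)).sub hk)
      fun i η hη => ?_
    -- the factor `exp (m t)` in the test function removes the weight
    have hη' : IsTimeTest fun t => Real.exp (m * t) * η t := hη.mul (by fun_prop)
    have m1 := hη.memLp_tensor (memLp_trig (ℓ := ℓ) i) (-m)
    have m1' := hη.memLp_tensor (memLp_trigDeriv (ℓ := ℓ) i) (-m)
    have h1 := hU ⟨_, mem_testPairs_tensor i hη'⟩
    have c1 : ∀ᵐ p ∂(cylMeasure ℓ), Real.exp (-m * p.2) *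
        (U 0 p * (c p * (trig i p.1 * (Real.exp (m * p.2) * η p.2))) +
          U 1 p * (a p * (trigDeriv i p.1 * (Real.exp (m * p.2) * η p.2)) +
            b p * (trig i p.1 * (Real.exp (m * p.2) * η p.2))) +
          U 2 p * (trig i p.1 * (Real.exp (m * p.2) * η p.2))) =
        (U 2 p + b p * U 1 p + c p * timePrim (U 2) p) * (trig i p.1 * η p.2) +
          a p * U 1 p * (trigDeriv i p.1 * η p.2) := by
      filter_upwards [hP] with p hp
      rw [← exp_mul_cancel m p ((U 2 p + b p * U 1 p + c p * timePrim (U 2) p) *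
        (trig i p.1 * η p.2) + a p * U 1 p * (trigDeriv i p.1 * η p.2)), hp]
      ring
    have c2 : ∀ p : AddCircle ℓ × ℝ, Real.exp (-m * p.2) *
        (k p * (trig i p.1 * (Real.exp (m * p.2) * η p.2)) -
          a p * g p.1 * (trigDeriv i p.1 * (Real.exp (m * p.2) * η p.2))) =
        k p * (trig i p.1 * η p.2) - a p * g p.1 * (trigDeriv i p.1 * η p.2) := fun p => by
      rw [← exp_mul_cancel m p (k p * (trig i p.1 * η p.2) -
        a p * g p.1 * (trigDeriv i p.1 * η p.2))]
      ring
    simp only [c2] at h1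
    rw [integral_congr_ae c1] at h1
    have j1 := ((hU2.add (h.b_mul hU1)).add (h.c_mul hPm)).integrable_mul_weighted m1 (by linarith)
    have j2 := (h.a_mul hU1).integrable_mul_weighted m1' (by linarith)
    have j3 := hk.integrable_mul_weighted m1 (by linarith)
    have j4 := (h.a_mul hgm).integrable_mul_weighted m1' (by linarith)
    have e1 := integral_add j1 j2
    have e2 := integral_sub j3 j4
    have e3 := integral_sub j1 j3
    have e4 := integral_add j4 j2
    simp only [Pi.add_apply] at e1 e3
    simp only [mul_add, add_mul, sub_mul] at h1 e1 e2 e3 e4 ⊢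
    linarith

end

/-! ### Strong and weak solutions -/

section

lemma CircleDeriv.add {f g f' g' : AddCircle ℓ → ℝ} (hf : MemLp f 2 volume)
    (hf' : MemLp f' 2 volume) (hg : MemLp g 2 volume) (hg' : MemLp g' 2 volume)
    (h : CircleDeriv f f') (h' : CircleDeriv g g') :
    CircleDeriv (fun x => f x + g x) (fun x => f' x + g' x) := fun i => by
  simp only [add_mul]
  rw [integral_add (integrable_mul_continuous hf (continuous_trigDeriv i))
      (integrable_mul_continuous hg (continuous_trigDeriv i)),
    integral_add (integrable_mul_continuous hf' (continuous_trig i))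
      (integrable_mul_continuous hg' (continuous_trig i)), h i, h' i]
  ring

lemma CircleDeriv.const_mul {f f' : AddCircle ℓ → ℝ} (h : CircleDeriv f f') (r : ℝ) :
    CircleDeriv (fun x => r * f x) (fun x => r * f' x) := fun i => by
  simp only [mul_assoc, integral_const_mul, h i]
  ring

/-- The indicator of the time interval `(0, ε)`. -/
def cutoff (ε : ℝ) (p : AddCircle ℓ × ℝ) : ℝ := (Ioo 0 ε).indicator 1 p.2

lemma setIntegral_Ioo_eq (ε : ℝ) (F : AddCircle ℓ × ℝ → ℝ) :
    ∫ p in univ ×ˢ Ioo 0 ε, F p = ∫ p, cutoff ε p * F p ∂(cylMeasure ℓ) := by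
  have h1 : (fun p => cutoff ε p * F p) =
      ((univ : Set (AddCircle ℓ)) ×ˢ Ioo 0 ε).indicator F := by
    ext p
    by_cases hp : p.2 ∈ Ioo 0 ε <;> simp [cutoff, indicator, hp]
  rw [h1, integral_indicator (MeasurableSet.univ.prod measurableSet_Ioo), cylMeasure,
    Measure.restrict_restrict (MeasurableSet.univ.prod measurableSet_Ioo)]
  congr 2
  ext p
  simp
  tauto

/-- A cutoff in time makes the exponential weight irrelevant. -/
lemma _root_.MeasureTheory.MemLp.cutoff_mul {f : AddCircle ℓ × ℝ → ℝ} {m : ℝ}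
    (hf : MemLp f 2 (weightedMeasure ℓ m)) (ε m' : ℝ) :
    MemLp (fun p => cutoff ε p * f p) 2 (weightedMeasure ℓ m') := by
  have h1 : MemLp (fun p => Real.exp ((m - m') / 2 * p.2) * cutoff ε p * f p) 2
      (weightedMeasure ℓ m) := by
    refine hf.bdd_mul_weighted (M := Real.exp (|(m - m') / 2| * |ε|)) ?_ ?_
    · refine ((measurable_expWeight _).mul ?_).aestronglyMeasurable
      exact (measurable_one.indicator measurableSet_Ioo).comp measurable_snd
    · refine Eventually.of_forall fun p => ?_
      by_cases hp : p.2 ∈ Ioo 0 ε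
      · simp only [cutoff, indicator_of_mem hp, Pi.one_apply, mul_one, Real.abs_exp]
        refine Real.exp_le_exp.2 ((le_abs_self _).trans ?_)
        rw [abs_mul]
        gcongr
        · exact hp.1.le
        · exact hp.2.le
      · simp [cutoff, indicator_of_notMem hp, Real.exp_nonneg]
  have h2 := (memLp_expWeight_mul_iff ((m' - m) / 2) (m := m')
    (f := fun p => Real.exp ((m - m') / 2 * p.2) * cutoff ε p * f p)).2 (by
      convert! h1 using 2
      ring)
  convert! h2 using 2 with p
  rw [← mul_assoc, ← mul_assoc, ← Real.exp_add]
  have : (m' - m) / 2 * p.2 + (m - m') / 2 * p.2 = 0 := by ring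
  simp [this]

variable {a b c : AddCircle ℓ × ℝ → ℝ} {M S lam : ℝ}

/-- The strong form of the problem: the slices `u(·, t)` and `a uₓ(·, t)` are differentiable, with
derivatives `uₓ` and `uₜ + b uₓ + c u - h`. -/
structure IsStrongSolution (a b c h : AddCircle ℓ × ℝ → ℝ) (u₀ : AddCircle ℓ → ℝ) (m : ℝ)
    (u ux ut : AddCircle ℓ × ℝ → ℝ) : Prop where
  memLp : MemLp u 2 (weightedMeasure ℓ m)
  memLp_x : MemLp ux 2 (weightedMeasure ℓ m)
  memLp_t : MemLp ut 2 (weightedMeasure ℓ m)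
  deriv_x : ∀ᵐ t ∂timeMeasure, CircleDeriv (fun x => u (x, t)) (fun x => ux (x, t))
  deriv_t : HasWeakDerivT 1 u ut
  initial : HasInitialValue u u₀
  flux : ∀ᵐ t ∂timeMeasure, CircleDeriv (fun x => a (x, t) * ux (x, t))
    (fun x => ut (x, t) + b (x, t) * ux (x, t) + c (x, t) * u (x, t) - h (x, t))

lemma IsParabolicWith.exists_isStrongSolution (hL : IsParabolicWith a b c M S lam) {m : ℝ}
    (hm1 : 4 * M + 2 ≤ m) (hm2 : S + 2 * M ^ 2 + 1 ≤ m * lam) {u₀ g : AddCircle ℓ → ℝ}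
    (hu₀ : MemLp u₀ 2 volume) (hg : MemLp g 2 volume) (hug : CircleDeriv u₀ g)
    {h : AddCircle ℓ × ℝ → ℝ} (hh : MemLp h 2 (weightedMeasure ℓ m)) :
    ∃ u ux ut, IsStrongSolution a b c h u₀ m u ux ut := by
  have hm : 2 ≤ m := by linarith [hL.M_nonneg]
  have hum := hu₀.weighted_fst (m := m) (by linarith)
  have hgm := hg.weighted_fst (m := m) (by linarith)
  obtain ⟨wx, v, hw, hwx, hv, hd, hd2⟩ := hL.exists_timePrim_solution hm1 hm2
    ((hh.sub (hL.b_mul hgm)).sub (hL.c_mul hum)) hg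
  refine ⟨fun p => u₀ p.1 + timePrim v p, fun p => g p.1 + wx p, v, hum.add hw, hgm.add hwx, hv,
    ?_, ?_, hasInitialValue_add_timePrim (by linarith) hv u₀, ?_⟩
  · filter_upwards [hd, hw.ae_slice, hwx.ae_slice] with t h1 h2 h3
    exact hug.add hu₀ hg h2 h3 h1
  · have h1 := (hasWeakDerivT_fst u₀ hu₀).add (m := m) hum hw (MemLp.zero (ε := ℝ)) hv
      (hasWeakDerivT_timePrim (by linarith) hv)
    simpa only [Pi.zero_apply, zero_add] using h1
  · filter_upwards [hd2] with t ht
    convert! ht using 2 with x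
    simp only [Pi.sub_apply]
    ring

lemma IsStrongSolution.memLp_flux (hL : IsParabolicWith a b c M S lam) {m : ℝ}
    {h u ux ut : AddCircle ℓ × ℝ → ℝ} {u₀ : AddCircle ℓ → ℝ}
    (hs : IsStrongSolution a b c h u₀ m u ux ut) (hh : MemLp h 2 (weightedMeasure ℓ m)) :
    MemLp (fun p => ut p + b p * ux p + c p * u p - h p) 2 (weightedMeasure ℓ m) :=
  ((hs.memLp_t.add (hL.b_mul hs.memLp_x)).add (hL.c_mul hs.memLp)).sub hh

lemma IsStrongSolution.solvesAE (hL : IsParabolicWith a b c M S lam) {m : ℝ}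
    {h u ux ut : AddCircle ℓ × ℝ → ℝ} {u₀ : AddCircle ℓ → ℝ}
    (hs : IsStrongSolution a b c h u₀ m u ux ut) (hh : MemLp h 2 (weightedMeasure ℓ m)) :
    SolvesAE a b c h m u := by
  have hq := hs.memLp_flux hL hh
  exact ⟨ux, ut, _, hs.memLp, hs.memLp_x,
    hasWeakDerivX_one_of_ae_circleDeriv hs.memLp hs.memLp_x hs.deriv_x, hs.memLp_t, hs.deriv_t, hq,
    hasWeakDerivX_one_of_ae_circleDeriv (hL.a_mul hs.memLp_x) hq hs.flux,
    Eventually.of_forall fun p => by ring⟩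

lemma IsStrongSolution.isWeakSolution (hL : IsParabolicWith a b c M S lam) {m : ℝ}
    {h u ux ut : AddCircle ℓ × ℝ → ℝ} {u₀ : AddCircle ℓ → ℝ}
    (hs : IsStrongSolution a b c h u₀ m u ux ut) (hh : MemLp h 2 (weightedMeasure ℓ m)) :
    IsWeakSolution a b c h u₀ m u := by
  refine ⟨ux, ut, hs.memLp, hs.memLp_x,
    hasWeakDerivX_one_of_ae_circleDeriv hs.memLp hs.memLp_x hs.deriv_x, hs.memLp_t, hs.deriv_t,
    hs.initial, fun φ φx φt hφ hφx hdx _ _ _ ε _ => ?_⟩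
  rw [← weightedMeasure_zero] at hφ hφx
  have hq := hs.memLp_flux hL hh
  have h1 := hφ.cutoff_mul ε (-m)
  have h2 := hφx.cutoff_mul ε (-m)
  have key := integral_mul_of_ae_circleDeriv (hL.a_mul hs.memLp_x) hq h1 h2 (by simp) hs.flux (by
    filter_upwards [hdx.ae_circleDeriv hφ hφx] with t ht
    exact ht.const_mul ((Ioo 0 ε).indicator 1 t))
  rw [setIntegral_Ioo_eq, setIntegral_Ioo_eq]
  have j1 := (hL.a_mul hs.memLp_x).integrable_mul_weighted h2 (by simp)
  have j2 := hq.integrable_mul_weighted h1 (by simp)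
  have j3 := hh.integrable_mul_weighted h1 (by simp)
  have e1 := integral_add_add j1 j2 j3
  have c1 : ∀ p, cutoff ε p * (ut p * φ p + a p * ux p * φx p + b p * ux p * φ p + c p * u p * φ p)
      = a p * ux p * (cutoff ε p * φx p) +
        (ut p + b p * ux p + c p * u p - h p) * (cutoff ε p * φ p) +
        h p * (cutoff ε p * φ p) := fun p => by ring
  have c2 : ∀ p, cutoff ε p * (h p * φ p) = h p * (cutoff ε p * φ p) := fun p => by ring
  simp only [c1, c2]
  linarith

end

/-! ### Uniqueness -/

section

lemma HasWeakDerivX.exp_mul {f g : AddCircle ℓ × ℝ → ℝ} (h : HasWeakDerivX 1 f g) (k : ℝ) :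
    HasWeakDerivX 1 (fun p => Real.exp (k * p.2) * f p) (fun p => Real.exp (k * p.2) * g p) := by
  intro φ hφ
  have h1 := h _ (hφ.mul_time (ρ := fun t => Real.exp (k * t)) (by fun_prop))
  have c1 : ∀ p, derivX 1 (fun p => Real.exp (k * p.2) * φ p) p =
      Real.exp (k * p.2) * derivX 1 φ p := fun p => by
    obtain ⟨x, t⟩ := p
    induction x using QuotientAddGroup.induction_on with
    | H x =>
      refine (derivX_one_coe _ x t).trans ?_
      exact ((hφ.hasDerivAt_derivX x t).const_mul (Real.exp (k * t))).deriv
  simp only [c1] at h1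
  simp only [mul_left_comm (f _), ← mul_assoc] at h1
  simpa only [mul_assoc, mul_left_comm (f _), mul_left_comm (g _)] using h1

lemma HasWeakDerivT.exp_mul {f g : AddCircle ℓ × ℝ → ℝ} {m : ℝ}
    (hf : MemLp f 2 (weightedMeasure ℓ m)) (hg : MemLp g 2 (weightedMeasure ℓ m))
    (h : HasWeakDerivT 1 f g) (k : ℝ) :
    HasWeakDerivT 1 (fun p => Real.exp (k * p.2) * f p)
      (fun p => Real.exp (k * p.2) * (g p + k * f p)) := by
  intro φ hφ
  have hφ' := hφ.mul_time (ρ := fun t => Real.exp (k * t)) (by fun_prop)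
  have h1 := h _ hφ'
  have c1 : ∀ p, derivT 1 (fun p => Real.exp (k * p.2) * φ p) p =
      Real.exp (k * p.2) * derivT 1 φ p + k * (Real.exp (k * p.2) * φ p) := fun p => by
    obtain ⟨x, t⟩ := p
    rw [derivT_one]
    have d1 : HasDerivAt (fun s : ℝ => Real.exp (k * s)) (Real.exp (k * t) * k) t := by
      simpa using ((hasDerivAt_id t).const_mul k).exp
    have d2 := (d1.fun_mul (hφ.hasDerivAt_derivT x t)).deriv
    simp only at d2 ⊢
    rw [d2]
    ring
  have hD := hφ.derivT.mul_time (ρ := fun t => Real.exp (k * t)) (by fun_prop)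
  have j1 := hf.integrable_mul_weighted (hD.memLp (-m)) (by simp)
  have j2 := (hf.integrable_mul_weighted (hφ'.memLp (-m)) (by simp)).const_mul k
  have j3 := hg.integrable_mul_weighted (hφ'.memLp (-m)) (by simp)
  have e1 := integral_add j1 j2
  have e2 := integral_add j3 j2
  have c2 : ∀ p, f p * (Real.exp (k * p.2) * derivT 1 φ p + k * (Real.exp (k * p.2) * φ p)) =
    f p * (Real.exp (k * p.2) * derivT 1 φ p) + k * (f p * (Real.exp (k * p.2) * φ p)) :=
    fun p => by ring
  have c3 : ∀ p, Real.exp (k * p.2) * (g p + k * f p) * φ p =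
    g p * (Real.exp (k * p.2) * φ p) + k * (f p * (Real.exp (k * p.2) * φ p)) :=
    fun p => by ring
  have c4 : ∀ p, Real.exp (k * p.2) * f p * derivT 1 φ p =
    f p * (Real.exp (k * p.2) * derivT 1 φ p) := fun p => by ring
  simp only [c1, c2, e1] at h1
  simp only [c3, c4, e2]
  linarith

lemma HasInitialValue.exp_mul {f : AddCircle ℓ × ℝ → ℝ} (h : HasInitialValue f fun _ => 0)
    {k : ℝ} (hk : k ≤ 0) : HasInitialValue (fun p => Real.exp (k * p.2) * f p) fun _ => 0 := by
  refine tendsto_of_tendsto_of_tendsto_of_le_of_le' tendsto_const_nhds h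
    (Eventually.of_forall fun _ => zero_le) ?_
  have h1 : ∀ᶠ t in 𝓝[>] (0 : ℝ) ⊓ ae volume, 0 < t :=
    Filter.mem_inf_of_left self_mem_nhdsWithin
  filter_upwards [h1] with t ht
  refine eLpNorm_mono fun x => ?_
  simp only [sub_zero, norm_mul, Real.norm_eq_abs, Real.abs_exp]
  exact mul_le_of_le_one_left (abs_nonneg _)
    (Real.exp_le_one_iff.2 (mul_nonpos_of_nonpos_of_nonneg hk ht.le))

lemma HasWeakDerivX.sub {f g f' g' : AddCircle ℓ × ℝ → ℝ} {m : ℝ}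
    (hf : MemLp f 2 (weightedMeasure ℓ m)) (hg : MemLp g 2 (weightedMeasure ℓ m))
    (hf' : MemLp f' 2 (weightedMeasure ℓ m)) (hg' : MemLp g' 2 (weightedMeasure ℓ m))
    (h : HasWeakDerivX 1 f f') (h' : HasWeakDerivX 1 g g') :
    HasWeakDerivX 1 (fun p => f p - g p) (fun p => f' p - g' p) := by
  intro φ hφ
  have i1 := hf.integrable_mul_weighted (hφ.derivX.memLp (-m)) (by simp)
  have i2 := hg.integrable_mul_weighted (hφ.derivX.memLp (-m)) (by simp)
  have i3 := hf'.integrable_mul_weighted (hφ.memLp (-m)) (by simp)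
  have i4 := hg'.integrable_mul_weighted (hφ.memLp (-m)) (by simp)
  simp only [sub_mul]
  rw [integral_sub i1 i2, integral_sub i3 i4, h φ hφ, h' φ hφ]
  ring

variable {a b c : AddCircle ℓ × ℝ → ℝ} {M S lam : ℝ}

lemma integral_cyl_eq_zero_of_setIntegral_Ioo {F : AddCircle ℓ × ℝ → ℝ}
    (hF : Integrable F (cylMeasure ℓ)) (h : ∀ ε : ℝ, 0 < ε → ∫ p in univ ×ˢ Ioo 0 ε, F p = 0) :
    ∫ p, F p ∂(cylMeasure ℓ) = 0 := by
  have hU : ⋃ n : ℕ, (univ : Set (AddCircle ℓ)) ×ˢ Ioo (0 : ℝ) (n + 1) = univ ×ˢ Ioi 0 := by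
    ext p
    simp only [mem_iUnion, mem_prod, mem_univ, true_and, mem_Ioo, mem_Ioi]
    refine ⟨fun ⟨n, hn⟩ => hn.1, fun hp => ?_⟩
    obtain ⟨n, hn⟩ := exists_nat_gt p.2
    exact ⟨n, hp, by linarith⟩
  have h1 := tendsto_setIntegral_of_monotone (μ := (volume : Measure (AddCircle ℓ × ℝ))) (f := F)
    (s := fun n : ℕ => (univ : Set (AddCircle ℓ)) ×ˢ Ioo (0 : ℝ) (n + 1))
    (fun n => MeasurableSet.univ.prod measurableSet_Ioo)
    (fun n k hnk => Set.prod_mono le_rfl (Ioo_subset_Ioo le_rfl (by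
      have : (n : ℝ) ≤ k := by exact_mod_cast hnk
      linarith))) (by rw [hU]; exact hF)
  rw [hU] at h1
  refine tendsto_nhds_unique h1 ?_
  have h2 : ∀ n : ℕ, ∫ p in (univ : Set (AddCircle ℓ)) ×ˢ Ioo (0 : ℝ) (n + 1), F p = 0 :=
    fun n => h _ (by positivity)
  simp only [h2]
  exact tendsto_const_nhds

/-- Two weak solutions agree: their difference `w`, tested with `exp (-k t) w`, has energy
`∫ exp (-k t) w² = 0` once `k` is large. -/
lemma IsParabolicWith.ae_eq_of_isWeakSolution (hL : IsParabolicWith a b c M S lam)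
    {h u v : AddCircle ℓ × ℝ → ℝ} {u₀ : AddCircle ℓ → ℝ} {m m' : ℝ}
    (hu₀ : MemLp u₀ 2 volume)
    (hu : IsWeakSolution a b c h u₀ m u) (hv : IsWeakSolution a b c h u₀ m' v) :
    v =ᵐ[cylMeasure ℓ] u := by
  obtain ⟨ux, ut, u1, u2, u3, u4, u5, u6, u7⟩ := hu
  obtain ⟨vx, vt, v1, v2, v3, v4, v5, v6, v7⟩ := hv
  have hM := hL.M_nonneg
  have hlam := hL.lam_pos
  -- a weight `k` beating `m`, `m'` and the lower order terms
  obtain ⟨k, hk0, hkm, hkm', hkM⟩ : ∃ k : ℝ, 0 ≤ k ∧ m ≤ k ∧ m' ≤ k ∧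
      1 ≤ k / 2 - M ^ 2 / (4 * lam) - M := by
    refine ⟨|m| + |m'| + 2 * (M ^ 2 / (4 * lam) + M + 1), by positivity, ?_, ?_, ?_⟩
    · have : 0 ≤ M ^ 2 / (4 * lam) := by positivity
      linarith [le_abs_self m, abs_nonneg m']
    · have : 0 ≤ M ^ 2 / (4 * lam) := by positivity
      linarith [le_abs_self m', abs_nonneg m]
    · linarith [abs_nonneg m, abs_nonneg m']
  have hI := v6.sub v1 u1 hu₀.1 hu₀.1 u6
  replace u1 := u1.weighted_mono hkm
  replace u2 := u2.weighted_mono hkm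
  replace u4 := u4.weighted_mono hkm
  replace v1 := v1.weighted_mono hkm'
  replace v2 := v2.weighted_mono hkm'
  replace v4 := v4.weighted_mono hkm'
  simp only [sub_self] at hI
  have w1 := v1.sub u1
  have w2 := v2.sub u2
  have w4 := v4.sub u4
  have w3 := v3.sub v1 u1 v2 u2 u3
  have w5 := (v5.add v1 u1.neg v4 u4.neg u5.neg)
  set w : AddCircle ℓ × ℝ → ℝ := fun p => v p - u p with hw
  set wx : AddCircle ℓ × ℝ → ℝ := fun p => vx p - ux p with hwx
  set wt : AddCircle ℓ × ℝ → ℝ := fun p => vt p - ut p with hwt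
  replace w1 : MemLp w 2 (weightedMeasure ℓ k) := w1
  replace w2 : MemLp wx 2 (weightedMeasure ℓ k) := w2
  replace w4 : MemLp wt 2 (weightedMeasure ℓ k) := w4
  replace w5 : HasWeakDerivT 1 w wt := by
    simpa only [hw, hwt, sub_eq_add_neg, Pi.neg_apply] using w5
  have lift : ∀ f : AddCircle ℓ × ℝ → ℝ, MemLp f 2 (weightedMeasure ℓ k) →
      MemLp (fun p => Real.exp (-k * p.2) * f p) 2 (weightedMeasure ℓ (-k)) := fun f hf => by
    rw [memLp_expWeight_mul_iff]
    convert! hf using 2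
    ring
  have lift0 : ∀ f : AddCircle ℓ × ℝ → ℝ, MemLp f 2 (weightedMeasure ℓ k) →
      MemLp (fun p => Real.exp (-k * p.2) * f p) 2 (cylMeasure ℓ) := fun f hf => by
    rw [← weightedMeasure_zero]
    exact (lift f hf).weighted_mono (by linarith)
  -- the tested equation for the difference on every time interval, and then on all times
  have hz : ∀ ε : ℝ, 0 < ε → ∫ p in univ ×ˢ Ioo 0 ε, Real.exp (-k * p.2) *
      (wt p * w p + a p * wx p * wx p + b p * wx p * w p + c p * w p * w p) = 0 := by
    intro ε hε
    have e1 := u7 _ _ _ (lift0 w w1) (lift0 wx w2) (w3.exp_mul (-k))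
      (lift0 _ (w4.add (w1.const_mul (-k)))) (w5.exp_mul w1 w4 (-k)) (hI.exp_mul (by linarith)) ε hε
    have e2 := v7 _ _ _ (lift0 w w1) (lift0 wx w2) (w3.exp_mul (-k))
      (lift0 _ (w4.add (w1.const_mul (-k)))) (w5.exp_mul w1 w4 (-k)) (hI.exp_mul (by linarith)) ε hε
    have l1 := lift w w1
    have l2 := lift wx w2
    have int : ∀ f fx ft : AddCircle ℓ × ℝ → ℝ, MemLp f 2 (weightedMeasure ℓ k) →
        MemLp fx 2 (weightedMeasure ℓ k) → MemLp ft 2 (weightedMeasure ℓ k) →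
        IntegrableOn (fun p => ft p * (Real.exp (-k * p.2) * w p) +
          a p * fx p * (Real.exp (-k * p.2) * wx p) + b p * fx p * (Real.exp (-k * p.2) * w p) +
          c p * f p * (Real.exp (-k * p.2) * w p)) ((univ : Set (AddCircle ℓ)) ×ˢ Ioo 0 ε)
          volume := by
      intro f fx ft hf hfx hft
      have := (((hft.integrable_mul_weighted l1 (by simp)).add
        ((hL.a_mul hfx).integrable_mul_weighted l2 (by simp))).add
        ((hL.b_mul hfx).integrable_mul_weighted l1 (by simp))).add
        ((hL.c_mul hf).integrable_mul_weighted l1 (by simp))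
      exact IntegrableOn.mono_set (t := univ ×ˢ Ioi 0) this
        (Set.prod_mono le_rfl Ioo_subset_Ioi_self)
    have e3 := integral_sub (int v vx vt v1 v2 v4) (int u ux ut u1 u2 u4)
    rw [e1, e2, sub_self] at e3
    refine (integral_congr_ae (Eventually.of_forall fun p => ?_)).trans e3
    simp only [hw, hwx, hwt]
    ring
  have i1 := integrable_exp_mul w4 w1
  have i2 := integrable_exp_mul (hL.a_mul w2) w2
  have i3 := integrable_exp_mul (hL.b_mul w2) w1
  have i4 := integrable_exp_mul (hL.c_mul w1) w1
  have i5 := integrable_exp_mul w1 w1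
  have hz2 : ∫ p, Real.exp (-k * p.2) *
      (wt p * w p + a p * wx p * wx p + b p * wx p * w p + c p * w p * w p)
        ∂(cylMeasure ℓ) = 0 := by
    refine integral_cyl_eq_zero_of_setIntegral_Ioo ?_ hz
    convert! ((i1.add i2).add i3).add i4 using 1
    ext p
    simp only [Pi.add_apply]
    ring
  -- the energy inequality for the time derivative
  have hP : w =ᵐ[cylMeasure ℓ] timePrim wt := ae_eq_timePrim hk0 w1 w4 w5 hI
  have hPm : MemLp (timePrim wt) 2 (weightedMeasure ℓ k) := by
    refine (memLp_congr_ae ?_).1 w1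
    exact (withDensity_absolutelyContinuous _ _).ae_le hP
  have hE := energy_timePrim hk0 w4 hPm
  have hE1 : ∫ p, Real.exp (-k * p.2) * timePrim wt p ^ 2 ∂(cylMeasure ℓ) =
      ∫ p, Real.exp (-k * p.2) * (w p * w p) ∂(cylMeasure ℓ) := by
    refine integral_congr_ae ?_
    filter_upwards [hP] with p hp
    rw [← hp, pow_two]
  have hE2 : ∫ p, Real.exp (-k * p.2) * (timePrim wt p * wt p) ∂(cylMeasure ℓ) =
      ∫ p, Real.exp (-k * p.2) * (wt p * w p) ∂(cylMeasure ℓ) := by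
    refine integral_congr_ae ?_
    filter_upwards [hP] with p hp
    rw [← hp, mul_comm (w p)]
  rw [hE1, hE2] at hE
  have hlow : ∫ p, (Real.exp (-k * p.2) * (wt p * w p) -
      (M ^ 2 / (4 * lam) + M) * (Real.exp (-k * p.2) * (w p * w p))) ∂(cylMeasure ℓ) ≤ 0 := by
    rw [← hz2]
    refine integral_mono_ae (i1.sub (i5.const_mul _)) ?_ ?_
    · convert! ((i1.add i2).add i3).add i4 using 1
      ext p
      simp only [Pi.add_apply]
      ring
    · filter_upwards [ae_cyl_pos] with p hp
      have q1 := hL.elliptic p.1 p.2 hp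
      have q2 := abs_le.1 (hL.bound_b p.1 p.2 hp)
      have q3 := abs_le.1 (hL.bound_c p.1 p.2 hp)
      have r1 : lam * (wx p * wx p) ≤ a p * wx p * wx p := by
        nlinarith [mul_self_nonneg (wx p)]
      have r3 : -M * (w p * w p) ≤ c p * w p * w p := by
        nlinarith [mul_self_nonneg (w p)]
      have r2 : -(lam * (wx p * wx p)) - M ^ 2 / (4 * lam) * (w p * w p) ≤ b p * wx p * w p := by
        have s1 : 0 ≤ lam * (wx p + b p * w p / (2 * lam)) ^ 2 := by positivity
        have s2 : lam * (wx p + b p * w p / (2 * lam)) ^ 2 = lam * (wx p * wx p) +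
            b p * wx p * w p + b p ^ 2 / (4 * lam) * (w p * w p) := by
          field_simp
          ring
        have s3 : b p ^ 2 / (4 * lam) * (w p * w p) ≤ M ^ 2 / (4 * lam) * (w p * w p) := by
          have : b p ^ 2 ≤ M ^ 2 := sq_le_sq' q2.1 q2.2
          have := mul_self_nonneg (w p)
          gcongr
        linarith
      have := mul_le_mul_of_nonneg_left
        (by linarith : wt p * w p - (M ^ 2 / (4 * lam) + M) * (w p * w p) ≤
          wt p * w p + a p * wx p * wx p + b p * wx p * w p + c p * w p * w p)
        (Real.exp_nonneg (-k * p.2))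
      linarith
  rw [integral_sub i1 (i5.const_mul _), integral_const_mul] at hlow
  have hnn : ∀ p : AddCircle ℓ × ℝ, 0 ≤ Real.exp (-k * p.2) * (w p * w p) := fun p =>
    mul_nonneg (Real.exp_nonneg _) (mul_self_nonneg _)
  have h0 : ∫ p, Real.exp (-k * p.2) * (w p * w p) ∂(cylMeasure ℓ) = 0 := by
    have := integral_nonneg (μ := cylMeasure ℓ) (Pi.le_def.2 hnn)
    nlinarith
  have := (integral_eq_zero_iff_of_nonneg hnn i5).1 h0
  filter_upwards [this] with p hp
  have h2 : w p = 0 := by simpa [Real.exp_ne_zero] using hp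
  exact sub_eq_zero.1 h2

end

/-! ### The second derivative in space -/

section

lemma dist_add_coe_le (x : AddCircle ℓ) (y : ℝ) : dist (x + (y : AddCircle ℓ)) x ≤ |y| := by
  rw [dist_eq_norm, add_sub_cancel_left]
  exact QuotientAddGroup.norm_mk_le_norm

/-- A bound for the difference quotients of `f` gives a bound for `φ ↦ ∫ f φ'`, with a free
parameter `s` from Young's inequality. -/
lemma abs_integral_mul_deriv_le {f : AddCircle ℓ → ℝ} (hf : MemLp f 2 volume) {D : ℝ}
    (hD : ∀ y : ℝ, ∫ x, (f (x + (y : AddCircle ℓ)) - f x) ^ 2 ≤ y ^ 2 * D)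
    {φ φ' : AddCircle ℓ → ℝ} (hφ : Continuous φ) (hφ' : Continuous φ')
    (hd : ∀ x : ℝ, HasDerivAt (fun y : ℝ => φ (y : AddCircle ℓ)) (φ' (x : AddCircle ℓ)) x)
    {s : ℝ} (hs : 0 < s) : |∫ x, f x * φ' x| ≤ (s * D + s⁻¹ * ∫ x, φ x ^ 2) / 2 := by
  obtain ⟨C, hC⟩ := (isCompact_range hφ').isBounded.exists_norm_le
  have hC' : ∀ x, |φ' x| ≤ C := fun x => hC _ (mem_range_self x)
  have hd' : ∀ (x : AddCircle ℓ) (y : ℝ), HasDerivAt (fun y : ℝ => φ (x + (y : AddCircle ℓ)))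
      (φ' (x + (y : AddCircle ℓ))) y := fun x y => by
    induction x using QuotientAddGroup.induction_on with
    | H x => exact (hd (x + y)).comp_const_add x y
  have hG : HasDerivAt (fun y : ℝ => ∫ x, f x * φ (x + (y : AddCircle ℓ))) (∫ x, f x * φ' x) 0 := by
    have h1 := (hasDerivAt_integral_of_dominated_loc_of_deriv_le
      (μ := (volume : Measure (AddCircle ℓ)))
      (F := fun (y : ℝ) x => f x * φ (x + (y : AddCircle ℓ)))
      (F' := fun (y : ℝ) x => f x * φ' (x + (y : AddCircle ℓ))) (x₀ := 0)
      (bound := fun x => |f x| * C) univ_mem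
      (Eventually.of_forall fun y => (integrable_mul_continuous hf
        (hφ.comp (continuous_add_const (y : AddCircle ℓ)))).1)
      (integrable_mul_continuous hf (hφ.comp (continuous_add_const _)))
      (integrable_mul_continuous hf (hφ'.comp (continuous_add_const _))).1
      (Eventually.of_forall fun x y _ => by
        rw [norm_mul]
        exact mul_le_mul_of_nonneg_left (hC' _) (norm_nonneg _))
      (integrable_mul_continuous hf.abs continuous_const)
      (Eventually.of_forall fun x y _ => (hd' x y).const_mul (f x))).2
    simpa using h1
  have hint : ∀ y : ℝ, Integrable fun x => (f (x + (y : AddCircle ℓ)) - f x) ^ 2 := fun y =>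
    ((hf.translate y).sub hf).integrable_sq
  have hφ2 : Integrable fun x => φ x ^ 2 := circle_integrable (by fun_prop)
  have hnn : 0 ≤ ∫ x, φ x ^ 2 := integral_nonneg fun x => sq_nonneg _
  have hD0 : 0 ≤ D := by
    have := (integral_nonneg fun x =>
      sq_nonneg (f (x + ((1 : ℝ) : AddCircle ℓ)) - f x)).trans (hD 1)
    simpa using this
  refine hG.le_of_lip' (by positivity) (Eventually.of_forall fun y => ?_)
  rcases eq_or_ne y 0 with rfl | hy
  · simp
  have hy' : 0 < |y| := abs_pos.2 hy
  -- translate in the integral, so that the difference falls on `f`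
  have h1 : ∫ x, f x * φ (x + (y : AddCircle ℓ)) = ∫ x, f (x + ((-y : ℝ) : AddCircle ℓ)) * φ x := by
    rw [← integral_add_right_eq_self (fun x => f (x + ((-y : ℝ) : AddCircle ℓ)) * φ x)
      (y : AddCircle ℓ)]
    simp [add_assoc]
  have i1 := integrable_mul_continuous (hf.translate ((-y : ℝ) : AddCircle ℓ)) hφ
  have i2 := integrable_mul_continuous hf hφ
  have h2 : (∫ x, f x * φ (x + (y : AddCircle ℓ))) - ∫ x, f x * φ (x + ((0 : ℝ) : AddCircle ℓ)) =
      ∫ x, (f (x + ((-y : ℝ) : AddCircle ℓ)) - f x) * φ x := by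
    simp only [AddCircle.coe_zero, add_zero, sub_mul]
    rw [h1, integral_sub i1 i2]
  rw [h2, sub_zero]
  refine (norm_integral_le_integral_norm _).trans ?_
  have h3 : ∫ x, ‖(f (x + ((-y : ℝ) : AddCircle ℓ)) - f x) * φ x‖ ≤
      ∫ x, (s / (2 * |y|) * (f (x + ((-y : ℝ) : AddCircle ℓ)) - f x) ^ 2 +
        |y| / (2 * s) * φ x ^ 2) := by
    refine integral_mono_of_nonneg (Eventually.of_forall fun x => norm_nonneg _)
      (((hint (-y)).const_mul _).add (hφ2.const_mul _)) (Eventually.of_forall fun x => ?_)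
    simp only [norm_mul, Real.norm_eq_abs]
    set d := f (x + ((-y : ℝ) : AddCircle ℓ)) - f x
    rw [← sq_abs d, ← sq_abs (φ x)]
    have h4 : s / (2 * |y|) * |d| ^ 2 + |y| / (2 * s) * |φ x| ^ 2 - |d| * |φ x| =
        s / (2 * |y|) * (|d| - |y| / s * |φ x|) ^ 2 := by
      field_simp
      ring
    have : 0 ≤ s / (2 * |y|) * (|d| - |y| / s * |φ x|) ^ 2 := by positivity
    linarith
  refine h3.trans ?_
  rw [integral_add ((hint (-y)).const_mul _) (hφ2.const_mul _), integral_const_mul,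
    integral_const_mul]
  have h5 := mul_le_mul_of_nonneg_left (hD (-y)) (by positivity : 0 ≤ s / (2 * |y|))
  refine (add_le_add_left h5 _).trans_eq ?_
  rw [Real.norm_eq_abs, neg_sq, ← sq_abs y]
  field_simp

/-- If `a f` is differentiable and `a` is Lipschitz and bounded below, the difference quotients of
`f` are bounded. -/
lemma integral_translate_sub_sq_le_of_mul {a f q : AddCircle ℓ → ℝ} {lam K : ℝ} (hlam : 0 < lam)
    (ha : ∀ x, lam ≤ a x) (hK : ∀ x y, |a x - a y| ≤ K * dist x y) (hf : MemLp f 2 volume)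
    (hF : MemLp (fun x => a x * f x) 2 volume) (hq : MemLp q 2 volume)
    (h : CircleDeriv (fun x => a x * f x) q) (y : ℝ) :
    ∫ x, (f (x + (y : AddCircle ℓ)) - f x) ^ 2 ≤
      y ^ 2 * (2 / lam ^ 2 * ((∫ x, q x ^ 2) + K ^ 2 * ∫ x, f x ^ 2)) := by
  have h1 := h.integral_translate_sub_sq_le hF hq y
  have i1 : Integrable fun x => (a (x + (y : AddCircle ℓ)) * f (x + (y : AddCircle ℓ)) -
      a x * f x) ^ 2 := ((hF.translate (y : AddCircle ℓ)).sub hF).integrable_sq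
  have i2 := hf.integrable_sq
  have h2 : ∫ x, (f (x + (y : AddCircle ℓ)) - f x) ^ 2 ≤
      ∫ x, (2 / lam ^ 2 * (a (x + (y : AddCircle ℓ)) * f (x + (y : AddCircle ℓ)) - a x * f x) ^ 2 +
        2 / lam ^ 2 * (K ^ 2 * y ^ 2) * f x ^ 2) := by
    refine integral_mono_of_nonneg (Eventually.of_forall fun x => sq_nonneg _)
      ((i1.const_mul _).add (i2.const_mul _)) (Eventually.of_forall fun x => ?_)
    have hd : |a (x + (y : AddCircle ℓ)) - a x| ≤ |K| * |y| :=
      (hK _ _).trans (mul_le_mul (le_abs_self K) (dist_add_coe_le x y) dist_nonneg (abs_nonneg K))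
    have hd2 : (a (x + (y : AddCircle ℓ)) - a x) ^ 2 ≤ K ^ 2 * y ^ 2 := by
      rw [← sq_abs (_ - _), ← sq_abs K, ← sq_abs y, ← mul_pow]
      exact pow_le_pow_left₀ (abs_nonneg _) hd 2
    have ha' := ha (x + (y : AddCircle ℓ))
    set fy := f (x + (y : AddCircle ℓ))
    set ay := a (x + (y : AddCircle ℓ))
    have e1 : lam ^ 2 * (fy - f x) ^ 2 ≤ (ay * (fy - f x)) ^ 2 := by
      rw [mul_pow]
      gcongr
    have e2 : (ay * (fy - f x)) ^ 2 ≤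
        2 * (ay * fy - a x * f x) ^ 2 + 2 * ((ay - a x) ^ 2 * f x ^ 2) := by
      nlinarith [sq_nonneg ((ay * fy - a x * f x) + (ay - a x) * f x)]
    have e3 : (ay - a x) ^ 2 * f x ^ 2 ≤ K ^ 2 * y ^ 2 * f x ^ 2 := by gcongr
    have e4 : (fy - f x) ^ 2 ≤
        (2 * (ay * fy - a x * f x) ^ 2 + 2 * (K ^ 2 * y ^ 2 * f x ^ 2)) / lam ^ 2 := by
      rw [le_div_iff₀ (by positivity)]
      linarith
    refine e4.trans_eq ?_
    ring
  refine h2.trans ?_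
  rw [integral_add (i1.const_mul _) (i2.const_mul _), integral_const_mul, integral_const_mul]
  have h3 := mul_le_mul_of_nonneg_left h1 (by positivity : 0 ≤ 2 / lam ^ 2)
  refine (add_le_add_left h3 _).trans_eq ?_
  ring

/-- The Riesz representation for a functional bounded by a quadratic expression, which scales to a
linear bound. -/
lemma exists_inner_eq_of_quadratic_bound {V H : Type*} [AddCommGroup V] [Module ℝ V]
    [NormedAddCommGroup H] [InnerProductSpace ℝ H] [CompleteSpace H] (A : V →ₗ[ℝ] H)
    (L : V →ₗ[ℝ] ℝ) {C : ℝ} (h : ∀ v, |L v| ≤ (C + ‖A v‖ ^ 2) / 2) :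
    ∃ U : H, ∀ v, inner ℝ U (A v) = L v := by
  refine exists_inner_eq_of_bound A L ((C + 1) / 2) fun v => ?_
  rcases (norm_nonneg (A v)).eq_or_lt with h0 | h0
  · by_contra! hlt
    rw [← h0, mul_zero] at hlt
    have h1 := h (((C + 1) / |L v|) • v)
    rw [map_smul, map_smul, norm_smul, ← h0, smul_eq_mul, abs_mul, abs_div, abs_abs,
      div_mul_cancel₀ _ hlt.ne'] at h1
    have h2 := le_abs_self (C + 1)
    have h3 := abs_nonneg (C + 1)
    have h4 : |C + 1| ≤ C / 2 := by simpa using h1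
    linarith
  · have h1 := h (‖A v‖⁻¹ • v)
    rw [map_smul, map_smul, norm_smul, smul_eq_mul, abs_mul, norm_inv, norm_norm,
      inv_mul_cancel₀ h0.ne', abs_of_pos (inv_pos.2 h0)] at h1
    rw [inv_mul_le_iff₀ h0] at h1
    linarith

/-- The space of test functions. -/
def testSpace (ℓ : ℝ) [Fact (0 < ℓ)] : Submodule ℝ (AddCircle ℓ × ℝ → ℝ) where
  carrier := {φ | IsTest φ}
  add_mem' := fun {φ ψ} hφ hψ => ⟨hφ.1.add hψ.1, hφ.2.1.add hψ.2.1,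
    (closure_minimal ((Function.support_add φ ψ).trans
      (union_subset_union subset_closure subset_closure))
      ((isClosed_tsupport _).union (isClosed_tsupport _))).trans (union_subset hφ.2.2 hψ.2.2)⟩
  zero_mem' := ⟨contDiff_const, HasCompactSupport.zero, by simp [tsupport]⟩
  smul_mem' := fun r φ hφ => ⟨hφ.1.const_smul r, hφ.2.1.smul_left (f := fun _ => r),
    (tsupport_smul_subset_right (fun _ => r) φ).trans hφ.2.2⟩

lemma norm_toLp_sq {m : ℝ} {f : AddCircle ℓ × ℝ → ℝ} (hf : MemLp f 2 (weightedMeasure ℓ m)) :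
    ‖hf.toLp f‖ ^ 2 = ∫ p, Real.exp (-m * p.2) * (f p * f p) ∂(cylMeasure ℓ) := by
  rw [← real_inner_self_eq_norm_sq, L2.inner_def, ← integral_weighted]
  refine integral_congr_ae ?_
  filter_upwards [hf.coeFn_toLp] with p hp
  simp [hp, pow_two]

lemma memLp_exp_mul_test {φ : AddCircle ℓ × ℝ → ℝ} (hφ : IsTest φ) (m : ℝ) :
    MemLp (fun p => Real.exp (m * p.2) * φ p) 2 (weightedMeasure ℓ m) :=
  (memLp_expWeight_mul_iff m).2 (hφ.memLp _)

lemma derivX_one_add {φ ψ : AddCircle ℓ × ℝ → ℝ} (hφ : IsTest φ) (hψ : IsTest ψ) :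
    derivX 1 (φ + ψ) = derivX 1 φ + derivX 1 ψ := by
  ext ⟨x, t⟩
  induction x using QuotientAddGroup.induction_on with
  | H x =>
    refine (derivX_one_coe _ x t).trans ?_
    exact ((hφ.hasDerivAt_derivX x t).add (hψ.hasDerivAt_derivX x t)).deriv

lemma derivX_one_smul {φ : AddCircle ℓ × ℝ → ℝ} (r : ℝ) (hφ : IsTest φ) :
    derivX 1 (r • φ) = r • derivX 1 φ := by
  ext ⟨x, t⟩
  induction x using QuotientAddGroup.induction_on with
  | H x =>
    refine (derivX_one_coe _ x t).trans ?_
    exact ((hφ.hasDerivAt_derivX x t).const_smul r).deriv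

/-- If `φ ↦ ∫ f ∂ₓ φ` is bounded in the dual weighted norm, with weight `exp (m t)`, then `f` has a
weak derivative in space in the weighted space. -/
lemma exists_hasWeakDerivX_of_bound {f : AddCircle ℓ × ℝ → ℝ} {m C : ℝ}
    (hf : MemLp f 2 (weightedMeasure ℓ m))
    (h : ∀ φ, IsTest φ → |∫ p, f p * derivX 1 φ p ∂(cylMeasure ℓ)| ≤
      (C + ∫ p, Real.exp (m * p.2) * φ p ^ 2 ∂(cylMeasure ℓ)) / 2) :
    ∃ g, MemLp g 2 (weightedMeasure ℓ m) ∧ HasWeakDerivX 1 f g := by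
  have hA := fun φ : testSpace ℓ => memLp_exp_mul_test φ.2 m
  let A : testSpace ℓ →ₗ[ℝ] Lp ℝ 2 (weightedMeasure ℓ m) :=
    { toFun := fun φ => (hA φ).toLp _
      map_add' := fun φ ψ => by
        rw [← MemLp.toLp_add]
        congr 1
        ext p
        exact mul_add _ _ _
      map_smul' := fun r φ => by
        rw [RingHom.id_apply, ← MemLp.toLp_const_smul]
        congr 1
        ext p
        exact mul_left_comm _ _ _ }
  have hint : ∀ φ, IsTest φ → Integrable (fun p => f p * derivX 1 φ p) (cylMeasure ℓ) :=
    fun φ hφ => hf.integrable_mul_weighted (hφ.derivX.memLp (-m)) (by simp)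
  let L : testSpace ℓ →ₗ[ℝ] ℝ :=
    { toFun := fun φ => -∫ p, f p * derivX 1 φ.1 p ∂(cylMeasure ℓ)
      map_add' := fun φ ψ => by
        simp only [Submodule.coe_add, derivX_one_add φ.2 ψ.2, Pi.add_apply, mul_add]
        rw [integral_add (hint _ φ.2) (hint _ ψ.2), neg_add]
      map_smul' := fun r φ => by
        simp only [Submodule.coe_smul, derivX_one_smul r φ.2, Pi.smul_apply, smul_eq_mul,
          mul_left_comm _ r, integral_const_mul, RingHom.id_apply, mul_neg] }
  obtain ⟨U, hU⟩ := exists_inner_eq_of_quadratic_bound A L (C := C) fun φ => by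
    have h1 := h φ.1 φ.2
    have h2 : ‖A φ‖ ^ 2 = ∫ p, Real.exp (m * p.2) * φ.1 p ^ 2 ∂(cylMeasure ℓ) := by
      refine (norm_toLp_sq (hA φ)).trans (integral_congr_ae (Eventually.of_forall fun p => ?_))
      simp only
      rw [← exp_mul_cancel m p (Real.exp (m * p.2) * φ.1 p ^ 2)]
      ring
    rw [h2]
    simpa only [L, LinearMap.coe_mk, AddHom.coe_mk, abs_neg] using h1
  refine ⟨U, Lp.memLp U, fun φ hφ => ?_⟩
  have h1 := hU ⟨φ, hφ⟩
  have h2 : inner ℝ U (A ⟨φ, hφ⟩) = ∫ p, U p * φ p ∂(cylMeasure ℓ) := by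
    refine Eq.trans (b := ∫ p, U p * (Real.exp (m * p.2) * φ p) ∂(weightedMeasure ℓ m)) ?_ ?_
    · rw [L2.inner_def]
      refine integral_congr_ae ?_
      filter_upwards [(hA ⟨φ, hφ⟩).coeFn_toLp] with p hp
      rw [show A ⟨φ, hφ⟩ p = Real.exp (m * p.2) * φ p from hp]
      simp [mul_comm]
    · rw [integral_weighted]
      refine integral_congr_ae (Eventually.of_forall fun p => ?_)
      simp only
      rw [← exp_mul_cancel m p (U p * φ p)]
      ring
  rw [h2] at h1
  rw [h1]
  simp [L]

variable {a b c : AddCircle ℓ × ℝ → ℝ} {M S lam : ℝ}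

/-- If the flux `a f` has a square integrable derivative in space and `a` is Lipschitz in space,
then so does `f`. -/
lemma IsParabolicWith.exists_hasWeakDerivX_of_flux (hL : IsParabolicWith a b c M S lam)
    (ha : LipschitzInSpace a) {m : ℝ} {f q : AddCircle ℓ × ℝ → ℝ}
    (hf : MemLp f 2 (weightedMeasure ℓ m)) (hq : MemLp q 2 (weightedMeasure ℓ m))
    (h : ∀ᵐ t ∂timeMeasure, CircleDeriv (fun x => a (x, t) * f (x, t)) (fun x => q (x, t))) :
    ∃ g, MemLp g 2 (weightedMeasure ℓ m) ∧ HasWeakDerivX 1 f g := by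
  obtain ⟨K, hK⟩ := ha
  have hlam := hL.lam_pos
  have i1 := integrable_exp_mul hq hq
  have i2 := integrable_exp_mul hf hf
  have i3 : Integrable (fun p => 2 / lam ^ 2 * (Real.exp (-m * p.2) * (q p * q p) +
      K ^ 2 * (Real.exp (-m * p.2) * (f p * f p)))) (cylMeasure ℓ) :=
    (i1.add (i2.const_mul (K ^ 2))).const_mul (2 / lam ^ 2)
  refine exists_hasWeakDerivX_of_bound hf (C := ∫ p, 2 / lam ^ 2 *
    (Real.exp (-m * p.2) * (q p * q p) + K ^ 2 * (Real.exp (-m * p.2) * (f p * f p)))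
      ∂(cylMeasure ℓ)) fun φ hφ => ?_
  have i4 : Integrable (fun p => Real.exp (m * p.2) * φ p ^ 2) (cylMeasure ℓ) := by
    have := integrable_exp_mul (hφ.memLp (-m)) (hφ.memLp (-m))
    simpa only [neg_neg, pow_two] using this
  have i5 : Integrable (fun p => f p * derivX 1 φ p) (cylMeasure ℓ) :=
    hf.integrable_mul_weighted (hφ.derivX.memLp (-m)) (by simp)
  have i6 : Integrable (fun p => (2 / lam ^ 2 * (Real.exp (-m * p.2) * (q p * q p) +
      K ^ 2 * (Real.exp (-m * p.2) * (f p * f p))) + Real.exp (m * p.2) * φ p ^ 2) / 2)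
      (cylMeasure ℓ) := (i3.add i4).div_const 2
  rw [← integral_add i3 i4, ← integral_div, integral_cyl i5, integral_cyl i6]
  rw [cylMeasure_eq_prod] at i6
  refine (abs_integral_le_integral_abs).trans ?_
  refine integral_mono_of_nonneg (Eventually.of_forall fun t => abs_nonneg _)
    i6.integral_prod_right ?_
  filter_upwards [h, hf.ae_slice, hq.ae_slice, (hL.a_mul hf).ae_slice,
    ae_restrict_mem measurableSet_Ioi] with t h1 h2 h3 h4 ht
  -- Young's parameter `exp (-m t)` distributes the weight between `f` and `φ`
  have h5 := abs_integral_mul_deriv_le h2 (integral_translate_sub_sq_le_of_mul hlam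
    (fun x => hL.elliptic x t ht) (fun x y => hK x y t ht) h2 h4 h3 h1)
    (hφ.continuous.comp (by fun_prop : Continuous fun x : AddCircle ℓ => (x, t)))
    (hφ.derivX.continuous.comp (by fun_prop : Continuous fun x : AddCircle ℓ => (x, t)))
    (fun x => hφ.hasDerivAt_derivX x t) (Real.exp_pos (-m * t))
  refine h5.trans_eq ?_
  have c1 := h3.integrable_sq
  have c2 := h2.integrable_sq
  have c3 : Integrable fun x => φ (x, t) ^ 2 := by
    have := hφ.continuous
    exact circle_integrable (by fun_prop)
  have e1 : ∀ x, (2 / lam ^ 2 * (Real.exp (-m * t) * (q (x, t) * q (x, t)) +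
      K ^ 2 * (Real.exp (-m * t) * (f (x, t) * f (x, t)))) +
      Real.exp (m * t) * φ (x, t) ^ 2) / 2 = 2 / lam ^ 2 * Real.exp (-m * t) / 2 * q (x, t) ^ 2 +
      2 / lam ^ 2 * Real.exp (-m * t) / 2 * K ^ 2 * f (x, t) ^ 2 +
      Real.exp (m * t) / 2 * φ (x, t) ^ 2 := fun x => by
    ring
  refine Eq.trans ?_ (integral_congr_ae (Eventually.of_forall e1)).symm
  rw [integral_add_add (c1.const_mul _) (c2.const_mul _) (c3.const_mul _), integral_const_mul,
    integral_const_mul, integral_const_mul, ← Real.exp_neg]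
  simp only [Function.comp, neg_mul, neg_neg]
  ring

/-- If `a` is Lipschitz in space, the solution has a second weak derivative in space. -/
lemma IsStrongSolution.memSobolev (hL : IsParabolicWith a b c M S lam) {m : ℝ}
    {h u ux ut : AddCircle ℓ × ℝ → ℝ} {u₀ : AddCircle ℓ → ℝ}
    (hs : IsStrongSolution a b c h u₀ m u ux ut) (hh : MemLp h 2 (weightedMeasure ℓ m))
    (ha : LipschitzInSpace a) : MemSobolev (weightedMeasure ℓ m) 2 1 u := by
  have hx := hasWeakDerivX_one_of_ae_circleDeriv hs.memLp hs.memLp_x hs.deriv_x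
  refine ⟨hs.memLp, fun i hi => ?_, fun j hj => ?_⟩
  · interval_cases i
    · exact ⟨u, hs.memLp, fun φ _ => by simp [derivX_zero]⟩
    · exact ⟨ux, hs.memLp_x, hx⟩
    · obtain ⟨g, hg, hgx⟩ := hL.exists_hasWeakDerivX_of_flux ha hs.memLp_x (hs.memLp_flux hL hh)
        hs.flux
      refine ⟨g, hg, fun φ hφ => ?_⟩
      have h1 := hx _ hφ.derivX
      have h2 := hgx _ hφ
      rw [derivX_succ 1 φ, h1, h2]
      ring
  · interval_cases j
    · exact ⟨u, hs.memLp, fun φ _ => by simp [derivT_zero]⟩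
    · exact ⟨ut, hs.memLp_t, hs.deriv_t⟩

end

end

end ParabolicOnCurve

open ParabolicOnCurve in
theorem mainTheorem3 (γ₀ : ClosedPlaneCurve) (a b c : γ₀.Param × ℝ → ℝ)
    (hL : IsParabolic a b c) :
    ∃ m₀ : ℝ, 0 < m₀ ∧ ∀ m : ℝ, m₀ ≤ m →
      ∀ (α β : ℕ) (u₀ : γ₀.Param → ℝ) (h : γ₀.Param × ℝ → ℝ),
        MemW (α + 1) u₀ → MemWW α β h →
        ∃ u : γ₀.Param × ℝ → ℝ,
          IsWeakSolution a b c h u₀ m u ∧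
          SolvesAE a b c h m u ∧
          (LipschitzInSpace a → MemSobolev (weightedMeasure γ₀.length m) 2 1 u) ∧
          ∀ (m' : ℝ) (v : γ₀.Param × ℝ → ℝ),
            IsWeakSolution a b c h u₀ m' v → v =ᵐ[cylMeasure γ₀.length] u := by
  obtain ⟨M, S, lam, hP⟩ := hL.exists_constants
  have hM := hP.M_nonneg
  have hS := hP.S_nonneg
  have hlam := hP.lam_pos
  have hq : 0 ≤ (S + 2 * M ^ 2 + 1) / lam := by positivity
  -- both conditions for coercivity, `4 M + 2 ≤ m` and `S + 2 M² + 1 ≤ m λ`, hold for `m ≥ m₀`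
  refine ⟨4 * M + 2 + (S + 2 * M ^ 2 + 1) / lam, by positivity, ?_⟩
  intro m hm α β u₀ h hu₀ hh
  have hm1 : 4 * M + 2 ≤ m := by linarith
  have hm2 : S + 2 * M ^ 2 + 1 ≤ m * lam := by
    rw [← div_le_iff₀ hlam]
    linarith
  have hhm : MemLp h 2 (weightedMeasure γ₀.length m) := hh.1.weighted_of_cyl (by linarith)
  obtain ⟨g, hg, hug⟩ := hu₀.exists_circleDeriv
  obtain ⟨u, ux, ut, hs⟩ := hP.exists_isStrongSolution hm1 hm2 hu₀.1 hg hug hhm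
  have hw := hs.isWeakSolution hP hhm
  exact ⟨u, hw, hs.solvesAE hP hhm, hs.memSobolev hP hhm,
    fun m' v hv => hP.ae_eq_of_isWeakSolution hu₀.1 hw hv⟩
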